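/- Let $n\ge 1$ and let $F(x)=f(x)+\sum_{k=1}^n\Psi_k(x_k)$ on $\mathbb{R}^n$, where $f:\mathbb{R}^n\to\mathbb{R}$ is convex and differentiable and each $\Psi_k:\mathbb{R}\to\mathbb{R}$ is convex (possibly non-smooth). Suppose that $F$ attains its minimum, normalized to be $0$, and let $X^*$ be the set of minimum points. Let $L_{jk}$ be constants with $|\nabla_k f(x+r\vec e_j)-\nabla_k f(x)|\le L_{jk}|r|$ for all $x\in\mathbb{R}^n$, $r\in\mathbb{R}$ and all $j,k$; put $L_j:=L_{jj}$ and $L_{\mathrm{res}}:=\max_j\big(\sum_k L_{jk}^2\big)^{1/2}$. Let $\Gamma>0$ be the step-size parameter. Stochastic asynchronous coordinate descent. Starting from $x^\circ\in\mathbb{R}^n$ in a shared memory, exactly $\bar t\ge 1$ updates are performed, numbered $1,\dots,\bar t$ by their starting times. When update $t$ starts, it picks a coordinate $k_t$ uniformly at random from $\{1,\dots,n\}$, independently of everything that has happened before. It then reads the coordinates from the shared memory, possibly at different times, obtaining a point $\tilde x$, computes $\tilde g=\nabla_{k_t}f(\tilde x)$, and finally, at its commit time, adds to the then current value $x_{k_t}$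 of coordinate $k_t$ the maximizer over $d\in\mathbb{R}$ of $$-\tilde g\,d-\tfrac{\Gamma}{2}d^2+\Psi_{k_t}(x_{k_t})-\Psi_{k_t}(x_{k_t}+d).$$ Exactly one update commits at a time. Start, read and commit times are arbitrary and may depend on the coordinates picked so far (not on future picks); in particular, the commit order may differ from the starting order. An update interferes with update $t$ if it commits between the start and the commit of update $t$. Assume that, for some integer $q\ge 0$ and every $t$, the only updates that interfere with update $t$ are among those numbered $t-q,\dots,t-1,t+1,\dots,t+q$. Let $x^{\bar t}$ be the point reached after all $\bar t$ updates have committed. Suppose that $\Gamma\ge\max_j L_j$ and $q\le\min\left\{\frac{\Gamma\sqrt{n-q}}{8\sqrt{10}\,L_{\mathrm{res}}},\ \frac{9n}{100}\right\}$ (the first bound being void if $L_{\mathrm{res}}=0$), and let $\alpha=\frac12$ and $\beta=\frac{\alpha q}{n}$, so that $\frac{\beta}{q}$ stands for $\frac{\alpha}{n}$ (also when $q=0$). Then: (i) If $F$ is strongly convex with parameter $\mu_F>0$ and $f$ is strongly convex with parameter $\mu_f\ge 0$, then $$\mathbb{E}\big[F(x^{\bar t})\big]\le\left[1-\min\left\{\frac{\alpha}{2n}\cdot\frac{\mu_F}{\mu_F+\Gamma-\mu_f},\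 \frac{\beta}{2q}\right\}\right]^{\bar t-1}F(x^\circ).$$ (ii) In general, let $R=\sup\{\operatorname{dist}(x,X^*): F(x)\le F(x^\circ)\}\in[0,\infty]$. Then $$\mathbb{E}\big[F(x^{\bar t})\big]\le\frac{F(x^\circ)}{1+\min\left\{\frac{\beta}{4q},\ \frac{\alpha}{8n},\ \frac{\alpha\,F(x^\circ)}{16\,n\,\Gamma R^2}\right\}(\bar t-1)},$$ where the last term of the minimum is $0$ if $R=\infty$, and the right-hand side is $0$ if $F(x^\circ)=0$. -/

import Mathlib

open scoped BigOperators ENNReal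

noncomputable section

namespace SACD

/-- Points of `ℝⁿ`, with the Euclidean norm. -/
abbrev Pt (n : ℕ) : Type := EuclideanSpace ℝ (Fin n)

/-- The objective `F(x) = f(x) + ∑ₖ Ψₖ(xₖ)`. -/
def objective {n : ℕ} (f : Pt n → ℝ) (Ψ : Fin n → ℝ → ℝ) (x : Pt n) : ℝ :=
  f x + ∑ k, Ψ k (x k)

/-- The set of minimum points of `F`. -/
def minimizers {n : ℕ} (F : Pt n → ℝ) : Set (Pt n) :=
  {y | ∀ z, F y ≤ F z}

/-- `L j k` bounds the rate of change of the `k`-th partial derivative of `f` along the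
`j`-th coordinate direction, for all `j` and `k`. -/
def CoordLipschitz {n : ℕ} (f : Pt n → ℝ) (L : Fin n → Fin n → ℝ) : Prop :=
  ∀ (j k : Fin n) (x : Pt n) (r : ℝ),
    |gradient f (x + EuclideanSpace.single j r) k - gradient f x k| ≤ L j k * |r|

/-- `L_res = max_j (∑ₖ L_{jk}²)^{1/2}`. -/
def Lres {n : ℕ} (L : Fin n → Fin n → ℝ) : ℝ :=
  ⨆ j, Real.sqrt (∑ k, L j k ^ 2)

/-- The proximal function `W(d, g, x, Γ, Ψ) = -g d - (Γ/2) d² + Ψ(x) - Ψ(x + d)`. -/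
def proxW (d g x Γ : ℝ) (Ψ : ℝ → ℝ) : ℝ :=
  -(g * d) - Γ / 2 * d ^ 2 + Ψ x - Ψ (x + d)

/-- The radius of the level set of `x₀`: the supremum, over all `x` with `F x ≤ F x₀`, of the
distance from `x` to the set of minimum points. It is `∞` if these distances are unbounded. -/
def levelRadius {n : ℕ} (F : Pt n → ℝ) (x₀ : Pt n) : ℝ≥0∞ :=
  ⨆ x ∈ {x : Pt n | F x ≤ F x₀}, Metric.infEDist x (minimizers F)

/-- The sequence of coordinates selected in a run with `T` selections: `π t` is the coordinate
picked by the `t`-th update to start. -/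
abbrev Path (n T : ℕ) : Type := Fin T → Fin n

/-- The timing of an asynchronous execution, as a function of the selected coordinates.
Update `t` starts (picks its coordinate) at the real time `start π t`, reads the value of
coordinate `j` from the shared memory at time `read π t j`, and finishes, by writing its
coordinate, at time `commit π t`. -/
structure Schedule (n T : ℕ) where
  start : Path n T → Fin T → ℝ
  read : Path n T → Fin T → Fin n → ℝ
  commit : Path n T → Fin T → ℝ

/-- The timings are those of an actual execution. -/
structure Schedule.Valid {n T : ℕ} (S : Schedule n T) : Prop where
  /-- Updates are numbered by their starting times. -/
  start_strictMono : ∀ π, StrictMono (S.start π)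
  /-- One coordinate value is written at a time. -/
  commit_injective : ∀ π, Function.Injective (S.commit π)
  start_lt_commit : ∀ π t, S.start π t < S.commit π t
  /-- The reads of an update happen between its start and its end, in any order and possibly
  at different times for different coordinates. -/
  read_mem : ∀ π t j, S.read π t j ∈ Set.Icc (S.start π t) (S.commit π t)
  /-- What happens up to the moment at which the `m`-th coordinate is picked does not depend on
  that pick or on later ones (it may depend on all the earlier picks). -/
  nonanticipating : ∀ (π π' : Path n T) (m : Fin T), (∀ i < m, π i = π' i) →
    S.start π' m = S.start π m ∧
    ∀ t < m,
      (S.commit π t < S.start π m → S.commit π' t = S.commit π t) ∧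
      ∀ j, S.read π t j < S.start π m → S.read π' t j = S.read π t j

/-- Update `s` interferes with update `t`: it finishes within the interim interval of `t`. -/
def Schedule.Interferes {n T : ℕ} (S : Schedule n T) (π : Path n T) (s t : Fin T) : Prop :=
  s ≠ t ∧ S.commit π s ∈ Set.Icc (S.start π t) (S.commit π t)

/-- The only updates that may interfere with update `t` are those numbered
`t - q, …, t - 1` and `t + 1, …, t + q`. -/
def Schedule.BoundedInterference {n T : ℕ} (S : Schedule n T) (q : ℕ) : Prop :=
  ∀ π s t, S.Interferes π s t → (t : ℕ) ≤ s + q ∧ (s : ℕ) ≤ t + q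

/-- The content of the shared memory just before time `τ`, if update `s` adds `Δ s` to
coordinate `π s` when it finishes. -/
def Schedule.memory {n T : ℕ} (S : Schedule n T) (x₀ : Pt n) (π : Path n T) (Δ : Fin T → ℝ)
    (τ : ℝ) : Pt n :=
  WithLp.toLp 2 fun j => x₀ j + ∑ s with π s = j ∧ S.commit π s < τ, Δ s

/-- The point `x̃` assembled by update `t` from its reads of the shared memory. -/
def Schedule.readPoint {n T : ℕ} (S : Schedule n T) (x₀ : Pt n) (π : Path n T) (Δ : Fin T → ℝ)
    (t : Fin T) : Pt n :=
  WithLp.toLp 2 fun j => S.memory x₀ π Δ (S.read π t j) j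

/-- `Δ` is the sequence of increments of the run along `π`: each update maximizes the proximal
function, with the gradient taken at the point it has read and with the value of its coordinate
at the moment of writing. -/
def Schedule.IsRun {n T : ℕ} (S : Schedule n T) (f : Pt n → ℝ) (Ψ : Fin n → ℝ → ℝ) (Γ : ℝ)
    (x₀ : Pt n) (π : Path n T) (Δ : Fin T → ℝ) : Prop :=
  ∀ t, IsMaxOn
    (fun d => proxW d (gradient f (S.readPoint x₀ π Δ t) (π t))
      (S.memory x₀ π Δ (S.commit π t) (π t)) Γ (Ψ (π t)))
    Set.univ (Δ t)

/-- The point reached once all `T` updates have been made. -/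
def finalPoint {n T : ℕ} (x₀ : Pt n) (π : Path n T) (Δ : Fin T → ℝ) : Pt n :=
  WithLp.toLp 2 fun j => x₀ j + ∑ s with π s = j, Δ s

end SACD

end

/-! A run is followed through the optimal values of the one-dimensional proximal problems that its
updates solve. `W` is the value for the inexact gradient an update has used, `V` the value for the
exact gradient at a given point, `Vbar` the mean of `V` over the coordinates. The square root of the
value is Lipschitz in the gradient (`sqrt_proxMax_le`), and after a step the value for the same
gradient has not grown (`IsProxStep.proxMax_add_le`). A commit changes F by at most -W + 2√W·eps ≤
eps², where `eps` sums (interaction)·√W over the interfering updates. If none of them wrote the same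
coordinate, F drops by 4/5·V, taken at the start of the update, up to 6·eps²
(`commit_step_le_of_no_collision`).

Without errors and collisions this proves the theorem: the mean of V over a fresh pick is `Vbar`,
and n·`Vbar` is bounded below by a multiple of F under strong convexity (`sum_V_ge_strong`), or by
l·F - l²Γ·dist²/2 in general (`sum_V_ge_convex`). So errors and collisions must be shown to cost
only a fraction of the total of E[`Vbar`].

The obstacle is that W of an update depends on later picks, because the timing may react to them.
The remedy is to move backwards in commit order. `sqrt_proxMax_le_sum` bounds W of update s by V at
the start of an update r ≤ s with s ≤ r + q, plus kernels times W of updates committed before s. One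
kernel forces equal coordinates, the other is the squared interaction; normalized, each has mean at
most 1 over the pick of s. Iteration produces a root and a list of leaves, all committed after the
root. If r is the smallest index among them, V at the start of r is independent of all their picks,
which can then be averaged out one at a time. Where the commit order enters the kernel only through
indicators, these are bounded by 1. The leaves of a nonzero kernel are distinct, so there are at
most T of them, and downward induction on their number closes the recursion because the kernels have
total weight below 1 (`sum_Rz_le`, `Fam.first_moment`).

With slowly growing weights w, summation by parts then yields w_{T-1}·E[F_final] ≤ Σ (w_t -
w_{t-1})·E[F(z_t)] - 1/4·Σ w_t·E[`Vbar`(z_t)], where z_t is the memory at the start of update t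
(`main_inequality`). Geometric weights give the linear rate, weights (1 + a·t)² the sublinear one.

In the sublinear case F may rise above F(x₀) along the run, where the level radius says nothing
directly. Convexity gives dist ≤ R·max(F(x₀), F)/F(x₀) (`exists_minimizer_dist_le`), and pathwise F
≤ F(x₀) + Σ eps², so the second moment of the right-hand side is needed (`Ex_Ofin_sq_le`). It comes
from the potential (F(x₀) + accumulated eps²)·F, which starts at F(x₀)² and stays nonnegative, and
from second-moment analogues of the recursion: the three estimates of `Bounds`, proved together by
the same downward induction, with fourth moments of `eps` from an expansion in commit order
(`Kern.sum_ez_pow_four_le`). -/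

noncomputable section

namespace SACD

/-! ### The one-dimensional proximal problem -/

section Prox
variable {ψ : ℝ → ℝ} {Γ : ℝ}

/-- The maximal value of the proximal function. -/
def proxMax (Γ : ℝ) (ψ : ℝ → ℝ) (g y : ℝ) : ℝ := ⨆ d, proxW d g y Γ ψ

/-- `Δ` maximizes the proximal function. -/
def IsProxStep (Γ : ℝ) (ψ : ℝ → ℝ) (g y Δ : ℝ) : Prop :=
  IsMaxOn (fun d => proxW d g y Γ ψ) Set.univ Δ

lemma proxW_zero (g y : ℝ) : proxW 0 g y Γ ψ = 0 := by simp [proxW]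

/-- Concavity in d comes from ψ, the quadratic surplus from the penalty -(Γ/2)d². -/
lemma proxW_convexComb (hψ : ConvexOn ℝ Set.univ ψ) (g y a b t : ℝ) (h0 : 0 ≤ t) (h1 : t ≤ 1) :
    (1 - t) * proxW a g y Γ ψ + t * proxW b g y Γ ψ + Γ / 2 * (t * (1 - t)) * (b - a) ^ 2 ≤
      proxW (a + t * (b - a)) g y Γ ψ := by
  have h := hψ.2 (Set.mem_univ (y + a)) (Set.mem_univ (y + b)) (by linarith : 0 ≤ 1 - t) h0
    (by ring)
  simp only [smul_eq_mul] at h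
  have e : (1 - t) * (y + a) + t * (y + b) = y + (a + t * (b - a)) := by ring
  rw [e] at h
  unfold proxW
  nlinarith

/-- An affine minorant of ψ lets the quadratic penalty win far out: `M` is large enough that the
value outside [-M, M] is at most 0, the value at d = 0. A maximum over this compact interval is
therefore global. -/
lemma exists_isProxStep (hψ : ConvexOn ℝ Set.univ ψ) (hΓ : 0 < Γ) (g y : ℝ) :
    ∃ Δ, IsProxStep Γ ψ g y Δ := by
  have hc : Continuous ψ := hψ.locallyLipschitz.continuous
  obtain ⟨l, c, hlc⟩ := hψ.exists_affine_le_real isClosed_univ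
    (hc.continuousOn.lowerSemicontinuousOn)
  set b : ℝ := ψ y - l * y - c
  set M : ℝ := 1 + 2 * (|g + l| + |b|) / Γ with hM
  have hMpos : 1 ≤ M := by
    have : 0 ≤ 2 * (|g + l| + |b|) / Γ := by positivity
    linarith
  have hM' : Γ / 2 * M ≥ |g + l| + |b| := by
    have : Γ / 2 * M = Γ / 2 + (|g + l| + |b|) := by rw [hM]; field_simp
    linarith
  have hcont : Continuous fun d => proxW d g y Γ ψ := by
    unfold proxW; fun_prop
  obtain ⟨Δ, hΔ, hmax⟩ := (isCompact_Icc (a := -M) (b := M)).exists_isMaxOn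
    ⟨0, by constructor <;> linarith⟩ hcont.continuousOn
  refine ⟨Δ, fun d _ => ?_⟩
  by_cases hd : d ∈ Set.Icc (-M) M
  · exact hmax hd
  have h0 : proxW 0 g y Γ ψ ≤ proxW Δ g y Γ ψ := hmax ⟨by linarith, by linarith⟩
  rw [proxW_zero] at h0
  refine le_trans ?_ h0
  have hdM : M ≤ |d| := by
    by_contra h
    push Not at h
    exact hd ⟨by linarith [(abs_lt.1 h).1], by linarith [(abs_lt.1 h).2]⟩
  have h1 := hlc (y + d) (Set.mem_univ _)
  have h2 : proxW d g y Γ ψ ≤ -((g + l) * d) - Γ / 2 * d ^ 2 + b := by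
    simp only [proxW, b]; linarith
  have h3 : -((g + l) * d) ≤ |g + l| * |d| := by
    rw [← abs_mul]; exact neg_le_abs _
  have h4 : b ≤ |b| * |d| := by nlinarith [le_abs_self b, abs_nonneg b]
  have h5 : (|g + l| + |b|) * |d| ≤ Γ / 2 * |d| * |d| :=
    mul_le_mul_of_nonneg_right (by nlinarith) (abs_nonneg d)
  have h6 : |d| * |d| = d ^ 2 := by rw [← sq, sq_abs]
  change proxW d g y Γ ψ ≤ 0
  nlinarith

lemma IsProxStep.proxMax_eq {g y Δ : ℝ}
    (h : IsProxStep Γ ψ g y Δ) : proxMax Γ ψ g y = proxW Δ g y Γ ψ :=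
  le_antisymm (ciSup_le fun d => h (Set.mem_univ d))
    (le_ciSup (f := fun d => proxW d g y Γ ψ)
      ⟨proxW Δ g y Γ ψ, by rintro _ ⟨d, rfl⟩; exact h (Set.mem_univ d)⟩ Δ)

lemma proxW_le_proxMax (hψ : ConvexOn ℝ Set.univ ψ) (hΓ : 0 < Γ) (g y d : ℝ) :
    proxW d g y Γ ψ ≤ proxMax Γ ψ g y := by
  obtain ⟨Δ, h⟩ := exists_isProxStep hψ hΓ g y
  rw [h.proxMax_eq]; exact h (Set.mem_univ d)

lemma proxMax_nonneg (hψ : ConvexOn ℝ Set.univ ψ) (hΓ : 0 < Γ) (g y : ℝ) :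
    0 ≤ proxMax Γ ψ g y := by
  simpa [proxW_zero] using proxW_le_proxMax hψ hΓ g y 0

/-- The proximal function decreases quadratically away from its maximizer. -/
lemma IsProxStep.proxW_add_sq_le (hψ : ConvexOn ℝ Set.univ ψ) {g y Δ : ℝ}
    (h : IsProxStep Γ ψ g y Δ) (d : ℝ) :
    proxW d g y Γ ψ + Γ / 2 * (d - Δ) ^ 2 ≤ proxW Δ g y Γ ψ := by
  set c := Γ / 2 * (d - Δ) ^ 2 with hc
  have key : ∀ t : ℝ, 0 < t → t ≤ 1 →
      proxW d g y Γ ψ + (1 - t) * c ≤ proxW Δ g y Γ ψ := by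
    intro t ht0 ht1
    have h1 := proxW_convexComb (Γ := Γ) hψ g y Δ d t ht0.le ht1
    have h2 : proxW (Δ + t * (d - Δ)) g y Γ ψ ≤ proxW Δ g y Γ ψ := h (Set.mem_univ _)
    have h3 : t * (proxW d g y Γ ψ + (1 - t) * c) ≤ t * proxW Δ g y Γ ψ := by
      rw [hc]; nlinarith
    exact le_of_mul_le_mul_left h3 ht0
  by_contra hcon
  push Not at hcon
  by_cases hc0 : c ≤ 0
  · have := key 1 one_pos le_rfl
    linarith
  push Not at hc0
  set gap := proxW d g y Γ ψ + c - proxW Δ g y Γ ψ with hgap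
  have hg : 0 < gap := by linarith
  -- This replaces a limit t → 0: the chosen t makes t·c at most half of the supposed gap.
  have := key (min 1 (gap / (2 * c))) (lt_min one_pos (by positivity)) (min_le_left _ _)
  have h4 : min 1 (gap / (2 * c)) * c ≤ gap / 2 := by
    calc _ ≤ gap / (2 * c) * c := mul_le_mul_of_nonneg_right (min_le_right _ _) hc0.le
      _ = gap / 2 := by field_simp
  nlinarith

lemma IsProxStep.sq_le_proxMax (hψ : ConvexOn ℝ Set.univ ψ) {g y Δ : ℝ}
    (h : IsProxStep Γ ψ g y Δ) :
    Γ / 2 * Δ ^ 2 ≤ proxMax Γ ψ g y := by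
  have := h.proxW_add_sq_le hψ 0
  rw [proxW_zero] at this
  rw [h.proxMax_eq]; linarith [this, show (0 - Δ) ^ 2 = Δ ^ 2 by ring]

lemma IsProxStep.eq_of_isProxStep (hψ : ConvexOn ℝ Set.univ ψ) (hΓ : 0 < Γ) {g y Δ Δ' : ℝ}
    (h : IsProxStep Γ ψ g y Δ)
    (h' : IsProxStep Γ ψ g y Δ') : Δ = Δ' := by
  have h1 := h.proxW_add_sq_le hψ Δ'
  have h2 : proxW Δ g y Γ ψ ≤ proxW Δ' g y Γ ψ := h' (Set.mem_univ Δ)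
  have h3 : (Δ' - Δ) ^ 2 ≤ 0 := by
    by_contra hcon
    push Not at hcon
    nlinarith [mul_pos hΓ hcon]
  have : Δ' - Δ = 0 := by nlinarith [sq_nonneg (Δ' - Δ)]
  linarith

lemma IsProxStep.mul_abs_le (hψ : ConvexOn ℝ Set.univ ψ) (hΓ : 0 < Γ) {g y Δ : ℝ}
    (h : IsProxStep Γ ψ g y Δ) :
    Γ * |Δ| ≤ √(2 * Γ) * √(proxMax Γ ψ g y) := by
  have h1 := h.sq_le_proxMax hψ
  rw [← Real.sqrt_mul (by positivity)]
  apply Real.le_sqrt_of_sq_le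
  rw [mul_pow, sq_abs]
  nlinarith [mul_le_mul_of_nonneg_left h1 hΓ.le]

/-- The square root of the maximal value depends on the gradient in a Lipschitz way. -/
lemma sqrt_proxMax_le (hψ : ConvexOn ℝ Set.univ ψ) (hΓ : 0 < Γ) (g g' y : ℝ) :
    √(proxMax Γ ψ g' y) ≤ √(proxMax Γ ψ g y) + |g' - g| / √(2 * Γ) := by
  set s := √(proxMax Γ ψ g' y) with hs
  set e := |g' - g| / √(2 * Γ) with he
  have hs0 : 0 ≤ s := Real.sqrt_nonneg _
  have h2Γ : 0 < √(2 * Γ) := Real.sqrt_pos.2 (by positivity)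
  have he0 : 0 ≤ e := by positivity
  have hδ : |g' - g| = √(2 * Γ) * e := by rw [he]; field_simp
  have hsq : √(2 * Γ) * √(2 * Γ) = 2 * Γ := Real.mul_self_sqrt (by positivity)
  rcases le_or_gt s e with hse | hse
  · linarith [Real.sqrt_nonneg (proxMax Γ ψ g y)]
  have hspos : 0 < s := he0.trans_lt hse
  obtain ⟨d, hd⟩ := exists_isProxStep hψ hΓ g' y
  have hW : proxW d g' y Γ ψ = s ^ 2 := by
    rw [hs, Real.sq_sqrt (proxMax_nonneg hψ hΓ _ _), hd.proxMax_eq]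
  -- The best step for g' is shrunk by t, so that t·s = s - e. The surplus from strong concavity
  -- absorbs the cost of exchanging the gradients, and the shrunk step still has value at least (s -
  -- e)² for g.
  set t := 1 - e / s with ht
  have ht1 : t ≤ 1 := by
    have : 0 ≤ e / s := by positivity
    linarith
  have ht0 : 0 < t := by
    have : e / s < 1 := (div_lt_one hspos).2 hse
    linarith
  have hts : t * s = s - e := by rw [ht]; field_simp
  have h1 := proxW_convexComb (Γ := Γ) hψ g' y 0 d t ht0.le ht1
  rw [proxW_zero, hW] at h1
  have h2 : proxW (0 + t * (d - 0)) g y Γ ψ =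
      proxW (0 + t * (d - 0)) g' y Γ ψ + (g' - g) * (t * d) := by unfold proxW; ring
  have h3 : proxW (0 + t * (d - 0)) g y Γ ψ ≤ proxMax Γ ψ g y := proxW_le_proxMax hψ hΓ _ _ _
  have h4 : -((g' - g) * (t * d)) ≤ t * (|g' - g| * |d|) := by
    rw [← abs_mul, ← abs_of_pos ht0, ← abs_mul, abs_of_pos ht0]
    calc _ ≤ |(g' - g) * (t * d)| := neg_le_abs _
      _ = _ := by congr 1; ring
  have hkey : s * (t * s) ≤ s ^ 2 + Γ / 2 * (1 - t) * d ^ 2 - |g' - g| * |d| := by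
    rw [hts, hδ]
    have h5 : s * (1 - t) = e := by rw [ht]; field_simp; ring
    have h6 : s * (s * e + Γ / 2 * (1 - t) * d ^ 2 - √(2 * Γ) * e * |d|) =
        e / 4 * (2 * s - √(2 * Γ) * |d|) ^ 2 := by
      have h7 : (√(2 * Γ) * |d|) ^ 2 = 2 * Γ * d ^ 2 := by
        rw [mul_pow, sq_abs, Real.sq_sqrt (by positivity)]
      linear_combination Γ / 2 * d ^ 2 * h5 - e / 4 * h7
    have h8 : 0 ≤ s * (s * e + Γ / 2 * (1 - t) * d ^ 2 - √(2 * Γ) * e * |d|) := by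
      rw [h6]; positivity
    have h9 := nonneg_of_mul_nonneg_right h8 hspos
    nlinarith
  have h10 : (s - e) ^ 2 ≤ proxMax Γ ψ g y := by
    have : t * (s * (t * s)) ≤ t * (s ^ 2 + Γ / 2 * (1 - t) * d ^ 2 - |g' - g| * |d|) :=
      mul_le_mul_of_nonneg_left hkey ht0.le
    have e1 : t * (s * (t * s)) = (s - e) ^ 2 := by rw [← hts]; ring
    nlinarith
  have := Real.le_sqrt_of_sq_le h10
  linarith

/-- After a step, the maximal value for the same gradient is at most the value of the step. -/
lemma IsProxStep.proxMax_add_le (hψ : ConvexOn ℝ Set.univ ψ) (hΓ : 0 < Γ) {g y Δ : ℝ}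
    (h : IsProxStep Γ ψ g y Δ) :
    proxMax Γ ψ g (y + Δ) ≤ proxMax Γ ψ g y := by
  refine le_trans (ciSup_le fun e => ?_) (h.sq_le_proxMax hψ)
  have h1 := h.proxW_add_sq_le hψ (Δ + e)
  -- Moving the base point changes the penalty by the cross term ΓΔe. Against -(Γ/2)e² from the
  -- decay around the maximizer, at most (Γ/2)Δ² remains.
  have h2 : proxW e g (y + Δ) Γ ψ = proxW (Δ + e) g y Γ ψ - proxW Δ g y Γ ψ + Γ * Δ * e := by
    unfold proxW; rw [add_assoc]; ring
  rw [h2]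
  nlinarith [mul_nonneg hΓ.le (sq_nonneg (e - Δ))]

/-- A change of gradient alters the value of a fixed step linearly, by (g' - g)Δ, and `mul_abs_le`
controls |Δ| by the square root of the value. -/
lemma IsProxStep.proxMax_sub_le (hψ : ConvexOn ℝ Set.univ ψ) (hΓ : 0 < Γ) {g y Δ : ℝ}
    (h : IsProxStep Γ ψ g y Δ) (g' : ℝ) :
    proxMax Γ ψ g y - 2 * √(proxMax Γ ψ g y) * (|g' - g| / √(2 * Γ)) ≤ proxW Δ g' y Γ ψ := by
  have h2Γ : 0 < √(2 * Γ) := Real.sqrt_pos.2 (by positivity)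
  have hsq : √(2 * Γ) * √(2 * Γ) = 2 * Γ := Real.mul_self_sqrt (by positivity)
  have h1 := h.mul_abs_le hψ hΓ
  have h2 : proxW Δ g' y Γ ψ = proxW Δ g y Γ ψ - (g' - g) * Δ := by unfold proxW; ring
  have h3 : (g' - g) * Δ ≤ |g' - g| * |Δ| := by rw [← abs_mul]; exact le_abs_self _
  have h4 : |g' - g| * |Δ| ≤ 2 * √(proxMax Γ ψ g y) * (|g' - g| / √(2 * Γ)) := by
    have h5 : |Δ| ≤ 2 * √(proxMax Γ ψ g y) / √(2 * Γ) := by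
      rw [le_div_iff₀ h2Γ]
      refine le_of_mul_le_mul_left ?_ h2Γ
      have : √(2 * Γ) * (|Δ| * √(2 * Γ)) = 2 * (Γ * |Δ|) := by linear_combination |Δ| * hsq
      linarith
    calc _ ≤ |g' - g| * (2 * √(proxMax Γ ψ g y) / √(2 * Γ)) :=
          mul_le_mul_of_nonneg_left h5 (abs_nonneg _)
      _ = _ := by ring
  rw [h2, ← h.proxMax_eq]; linarith

/-- A step made with an inexact gradient `g` is almost as good, for the exact gradient `g'`,
as the best step for a third gradient `g₀`. -/
lemma IsProxStep.proxMax_sub_sub_le (hψ : ConvexOn ℝ Set.univ ψ) (hΓ : 0 < Γ) {g y Δ : ℝ}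
    (h : IsProxStep Γ ψ g y Δ) (g' g₀ : ℝ) :
    proxMax Γ ψ g₀ y - 2 * √(proxMax Γ ψ g₀ y) * (|g' - g₀| / √(2 * Γ))
      - (|g' - g| / √(2 * Γ)) ^ 2 ≤ proxW Δ g' y Γ ψ := by
  obtain ⟨d, hd⟩ := exists_isProxStep hψ hΓ g₀ y
  have h1 := hd.proxMax_sub_le hψ hΓ g'
  have h2 := h.proxW_add_sq_le hψ d
  have h3 : proxW Δ g' y Γ ψ = proxW Δ g y Γ ψ - (g' - g) * Δ := by unfold proxW; ring
  have h4 : proxW d g' y Γ ψ = proxW d g y Γ ψ - (g' - g) * d := by unfold proxW; ring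
  have h5 : (|g' - g| / √(2 * Γ)) ^ 2 = (g' - g) ^ 2 / (2 * Γ) := by
    rw [div_pow, sq_abs, Real.sq_sqrt (by positivity)]
  -- Replacing the best step d for g₀ by Δ costs (g' - g)(d - Δ), and the decay around Δ pays Γ/2·(d
  -- - Δ)² for it. Completing the square leaves the squared error.
  have h6 : -((g' - g) ^ 2 / (2 * Γ)) ≤ Γ / 2 * (d - Δ) ^ 2 + (g' - g) * (d - Δ) := by
    have : Γ / 2 * (d - Δ) ^ 2 + (g' - g) * (d - Δ) + (g' - g) ^ 2 / (2 * Γ) =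
        (Γ * (d - Δ) + (g' - g)) ^ 2 / (2 * Γ) := by field_simp; ring
    have h7 : 0 ≤ (Γ * (d - Δ) + (g' - g)) ^ 2 / (2 * Γ) := by positivity
    linarith
  rw [h5]; nlinarith

end Prox

/-! ### Composite objectives: smoothness and convexity along coordinates -/

/-- A composite objective with coordinatewise Lipschitz gradient and minimum `0`. -/
structure Composite (n : ℕ) where
  f : Pt n → ℝ
  Ψ : Fin n → ℝ → ℝ
  L : Fin n → Fin n → ℝ
  Γ : ℝ
  n_pos : 0 < n
  diff : Differentiable ℝ f
  convex : ConvexOn ℝ Set.univ f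
  convexΨ : ∀ k, ConvexOn ℝ Set.univ (Ψ k)
  exists_zero : ∃ y, objective f Ψ y = 0
  nonneg : ∀ y, 0 ≤ objective f Ψ y
  lip : CoordLipschitz f L
  Γ_pos : 0 < Γ
  L_le : ∀ j, L j j ≤ Γ

namespace Composite
variable {n : ℕ} (P : Composite n)

/-- The objective function. -/
abbrev F (x : Pt n) : ℝ := objective P.f P.Ψ x

/-- The partial derivatives of the smooth part. -/
abbrev g (x : Pt n) (k : Fin n) : ℝ := gradient P.f x k

lemma hasDerivAt_line (x d : Pt n) (t : ℝ) :
    HasDerivAt (fun t : ℝ => P.f (x + t • d)) (∑ k, P.g (x + t • d) k * d k) t := by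
  have h1 := (P.diff (x + t • d)).hasGradientAt.hasFDerivAt
  have h2 : HasDerivAt (fun t : ℝ => x + t • d) d t := by
    simpa using ((hasDerivAt_id t).smul_const d).const_add x
  have h3 := h1.comp_hasDerivAt t h2
  refine h3.congr_deriv ?_
  rw [InnerProductSpace.toDual_apply_apply, PiLp.inner_apply]
  exact Finset.sum_congr rfl fun k _ => mul_comm _ _

lemma hasDerivAt_coord (x : Pt n) (k : Fin n) (t : ℝ) :
    HasDerivAt (fun t : ℝ => P.f (x + EuclideanSpace.single k t))
      (P.g (x + EuclideanSpace.single k t) k) t := by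
  have h := P.hasDerivAt_line x (EuclideanSpace.single k 1) t
  have e : ∀ t : ℝ, t • (EuclideanSpace.single k (1 : ℝ) : Pt n) = EuclideanSpace.single k t := by
    intro t; ext i; simp
  simp only [e] at h
  convert h using 1
  simp

lemma L_nonneg (j k : Fin n) : 0 ≤ P.L j k := by
  have h := P.lip j k 0 1
  rw [abs_one, mul_one] at h
  exact (abs_nonneg _).trans h

/-- The roles of the two coordinates in `CoordLipschitz` can be exchanged. -/
lemma lip_symm (j k : Fin n) (x : Pt n) (r : ℝ) :
    |P.g (x + EuclideanSpace.single j r) k - P.g x k| ≤ P.L k j * |r| := by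
  -- The mixed second difference of f does not see the order of j and k. The mean value inequality
  -- in direction j bounds it by L k j·|r|·|s|, and letting s tend to 0 turns it into a difference
  -- of k-th partial derivatives.
  have h1 : ∀ s : ℝ, |(P.f (x + EuclideanSpace.single j r + EuclideanSpace.single k s) -
      P.f (x + EuclideanSpace.single k s)) -
      (P.f (x + EuclideanSpace.single j r + EuclideanSpace.single k 0) -
      P.f (x + EuclideanSpace.single k 0))| ≤ P.L k j * |r| * |s| := by
    intro s
    have hd : ∀ r ∈ (Set.univ : Set ℝ), HasDerivWithinAt
        (fun r : ℝ => P.f (x + EuclideanSpace.single k s + EuclideanSpace.single j r) -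
          P.f (x + EuclideanSpace.single j r))
        (P.g (x + EuclideanSpace.single k s + EuclideanSpace.single j r) j -
          P.g (x + EuclideanSpace.single j r) j) Set.univ r := fun r _ =>
      ((P.hasDerivAt_coord _ _ _).sub (P.hasDerivAt_coord _ _ _)).hasDerivWithinAt
    have hb : ∀ r ∈ (Set.univ : Set ℝ),
        ‖P.g (x + EuclideanSpace.single k s + EuclideanSpace.single j r) j -
          P.g (x + EuclideanSpace.single j r) j‖ ≤ P.L k j * |s| := by
      intro r _
      rw [Real.norm_eq_abs, add_right_comm]
      exact P.lip k j _ s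
    have := convex_univ.norm_image_sub_le_of_norm_hasDerivWithin_le hd hb
      (Set.mem_univ 0) (Set.mem_univ r)
    simp only [Real.norm_eq_abs, sub_zero] at this
    have e0 : ∀ i : Fin n, (EuclideanSpace.single i (0 : ℝ) : Pt n) = 0 := by simp
    simp only [e0, add_zero] at this ⊢
    calc _ = _ := by
            rw [add_right_comm x (EuclideanSpace.single j r)]; congr 1; ring
      _ ≤ _ := this
      _ = _ := by ring
  have hφ := ((P.hasDerivAt_coord (x + EuclideanSpace.single j r) k 0).sub
    (P.hasDerivAt_coord x k 0))
  have hC : 0 ≤ P.L k j * |r| := mul_nonneg (P.L_nonneg _ _) (abs_nonneg _)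
  have h2 := hφ.le_of_lip' hC (Filter.Eventually.of_forall fun s => by
    simpa [Real.norm_eq_abs] using h1 s)
  have e0 : (EuclideanSpace.single k (0 : ℝ) : Pt n) = 0 := by simp
  rw [e0, add_zero, add_zero] at h2
  exact h2

/-- First order characterization of (strong) convexity. -/
lemma first_order {μ : ℝ} (h : StrongConvexOn Set.univ μ P.f) (x d : Pt n) :
    P.f x + ∑ k, P.g x k * d k + μ / 2 * ‖d‖ ^ 2 ≤ P.f (x + d) := by
  set ψ : ℝ → ℝ := fun t => P.f (x + t • d) - P.f x - t * (P.f (x + d) - P.f x)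
    + μ / 2 * (t * (1 - t)) * ‖d‖ ^ 2 with hψ
  have hψ0 : ψ 0 = 0 := by simp [hψ]
  have hneg : ∀ t : ℝ, 0 < t → t ≤ 1 → ψ t ≤ 0 := by
    intro t h0 h1
    have := h.2 (Set.mem_univ x) (Set.mem_univ (x + d)) (by linarith : 0 ≤ 1 - t) h0.le (by ring)
    have e : (1 - t) • x + t • (x + d) = x + t • d := by module
    rw [e] at this
    simp only [smul_eq_mul, sub_add_cancel_left, norm_neg] at this
    simp only [hψ]; nlinarith
  have hd : HasDerivAt ψ (∑ k, P.g x k * d k - (P.f (x + d) - P.f x) + μ / 2 * ‖d‖ ^ 2) 0 := by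
    have h1 := P.hasDerivAt_line x d 0
    have h2 : HasDerivAt (fun t : ℝ => t * (P.f (x + d) - P.f x)) (P.f (x + d) - P.f x) 0 := by
      simpa using (hasDerivAt_id (0 : ℝ)).mul_const (P.f (x + d) - P.f x)
    have h3 : HasDerivAt (fun t : ℝ => μ / 2 * (t * (1 - t)) * ‖d‖ ^ 2) (μ / 2 * ‖d‖ ^ 2) 0 := by
      have := (((hasDerivAt_id (0 : ℝ)).mul ((hasDerivAt_id (0 : ℝ)).const_sub 1)).const_mul
        (μ / 2)).mul_const (‖d‖ ^ 2)
      simpa using this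
    have h4 := ((h1.sub_const (P.f x)).sub h2).add h3
    simp only [zero_smul, add_zero] at h4
    exact h4
  have hle := hd.tendsto_slope_zero_right
  have := le_of_tendsto hle (b := 0) (by
    filter_upwards [Ioc_mem_nhdsGT (show (0 : ℝ) < 1 by norm_num)] with t ht
    have := hneg t ht.1 ht.2
    simp only [zero_add, hψ0, sub_zero, smul_eq_mul]
    exact mul_nonpos_of_nonneg_of_nonpos (inv_nonneg.2 ht.1.le) this)
  linarith

lemma strongConvexOn_zero : StrongConvexOn Set.univ 0 P.f := by
  have := P.convex
  rwa [← _root_.strongConvexOn_zero] at this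

lemma first_order_convex (x d : Pt n) : P.f x + ∑ k, P.g x k * d k ≤ P.f (x + d) := by
  simpa using P.first_order P.strongConvexOn_zero x d

/-- A function with a derivative that is Lipschitz at a point has a quadratic upper bound. -/
lemma le_quadratic_of_deriv {φ φ' : ℝ → ℝ} (hφ : ∀ t, HasDerivAt φ (φ' t) t) {c : ℝ}
    (hl : ∀ t, |φ' t - φ' 0| ≤ c * |t|) (d : ℝ) : φ d ≤ φ 0 + φ' 0 * d + c / 2 * d ^ 2 := by
  have hη : ∀ t, HasDerivAt (fun t => φ t - φ' 0 * t - c / 2 * t ^ 2) (φ' t - φ' 0 - c * t) t := by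
    intro t
    have h1 : HasDerivAt (fun t => φ' 0 * t) (φ' 0) t := by
      simpa using (hasDerivAt_id t).const_mul (φ' 0)
    have h2 : HasDerivAt (fun t => c / 2 * t ^ 2) (c * t) t := by
      refine (((hasDerivAt_id t).pow 2).const_mul (c / 2)).congr_deriv ?_
      simp only [id_eq]; push_cast; ring
    exact ((hφ t).sub h1).sub h2
  rcases le_total 0 d with hd | hd
  · have := antitoneOn_of_deriv_nonpos (convex_Icc 0 d)
      (fun t _ => (hη t).continuousAt.continuousWithinAt)
      (fun t _ => (hη t).differentiableAt.differentiableWithinAt)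
      (fun t ht => by
        rw [interior_Icc] at ht
        rw [(hη t).deriv]
        have := hl t
        rw [abs_of_pos ht.1] at this
        linarith [le_abs_self (φ' t - φ' 0)])
      (Set.left_mem_Icc.2 hd) (Set.right_mem_Icc.2 hd) hd
    simp only at this; nlinarith
  · have := monotoneOn_of_deriv_nonneg (convex_Icc d 0)
      (fun t _ => (hη t).continuousAt.continuousWithinAt)
      (fun t _ => (hη t).differentiableAt.differentiableWithinAt)
      (fun t ht => by
        rw [interior_Icc] at ht
        rw [(hη t).deriv]
        have := hl t
        rw [abs_of_neg ht.2] at this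
        linarith [neg_abs_le (φ' t - φ' 0)])
      (Set.left_mem_Icc.2 hd) (Set.right_mem_Icc.2 hd) hd
    simp only at this; nlinarith

lemma descent_coord (y : Pt n) (k : Fin n) (d : ℝ) :
    P.f (y + EuclideanSpace.single k d) ≤ P.f y + P.g y k * d + P.Γ / 2 * d ^ 2 := by
  have e0 : (EuclideanSpace.single k (0 : ℝ) : Pt n) = 0 := by simp
  have h := le_quadratic_of_deriv (P.hasDerivAt_coord y k) (c := P.L k k) (fun t => by
    rw [e0, add_zero]; exact P.lip k k y t) d
  rw [e0, add_zero] at h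
  nlinarith [P.L_le k, sq_nonneg d]

/-- A step of length -δ/Γ along coordinate k lowers f below f(x + d) by at least the descent
estimate, while f stays above its tangent plane at x. -/
lemma cocoercive (x d : Pt n) (k : Fin n) :
    P.f x + ∑ i, P.g x i * d i + (P.g (x + d) k - P.g x k) ^ 2 / (2 * P.Γ) ≤ P.f (x + d) := by
  set δ := P.g (x + d) k - P.g x k with hδ
  have h1 := P.first_order_convex x (d + EuclideanSpace.single k (-δ / P.Γ))
  have h2 := P.descent_coord (x + d) k (-δ / P.Γ)
  rw [← add_assoc] at h1
  have h3 : ∑ i, P.g x i * (d + EuclideanSpace.single k (-δ / P.Γ) : Pt n) i =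
      ∑ i, P.g x i * d i + P.g x k * (-δ / P.Γ) := by
    simp [mul_add, Finset.sum_add_distrib]
  rw [h3] at h1
  have hΓ := P.Γ_pos
  have h4 : P.g (x + d) k * (-δ / P.Γ) + P.Γ / 2 * (-δ / P.Γ) ^ 2 - P.g x k * (-δ / P.Γ) =
      - (δ ^ 2 / (2 * P.Γ)) := by
    have : P.g (x + d) k = δ + P.g x k := by rw [hδ]; ring
    rw [this]; field_simp; ring
  linarith

/-- Cocoercivity used in both directions between x and x + r·e_j bounds (change of the k-th
partial)²/Γ by (change of the j-th partial)·r ≤ L j j·r². So no interaction exceeds Γ, which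
justifies truncating `ell` at 1. -/
lemma lip_Γ (j k : Fin n) (x : Pt n) (r : ℝ) :
    |P.g (x + EuclideanSpace.single j r) k - P.g x k| ≤ P.Γ * |r| := by
  have hΓ := P.Γ_pos
  set y := x + EuclideanSpace.single j r with hy
  have h1 := P.cocoercive x (EuclideanSpace.single j r) k
  have h2 := P.cocoercive y (EuclideanSpace.single j (-r)) k
  have e : y + EuclideanSpace.single j (-r) = x := by
    ext i; by_cases h : i = j <;> simp [hy, h]
  rw [e] at h2
  rw [← hy] at h1
  have h3 : ∀ (z : Pt n) (r : ℝ), ∑ i, P.g z i * (EuclideanSpace.single j r : Pt n) i = P.g z j * r := by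
    intro z r; simp
  rw [h3] at h1 h2
  have h4 := P.lip j j x r
  have h5 : (P.g y j - P.g x j) * r ≤ P.L j j * r ^ 2 := by
    calc _ ≤ |(P.g y j - P.g x j) * r| := le_abs_self _
      _ = |P.g y j - P.g x j| * |r| := abs_mul _ _
      _ ≤ P.L j j * |r| * |r| := mul_le_mul_of_nonneg_right h4 (abs_nonneg _)
      _ = _ := by rw [mul_assoc, ← sq, sq_abs]
  have h6 : (P.g y k - P.g x k) ^ 2 / P.Γ ≤ P.Γ * r ^ 2 := by
    have : (P.g y k - P.g x k) ^ 2 / P.Γ = (P.g y k - P.g x k) ^ 2 / (2 * P.Γ) +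
      (P.g x k - P.g y k) ^ 2 / (2 * P.Γ) := by field_simp; ring
    rw [this]
    nlinarith [P.L_le j, sq_nonneg r]
  rw [div_le_iff₀ hΓ] at h6
  apply abs_le_of_sq_le_sq' _ (by positivity) |> abs_le.2
  rw [mul_pow, sq_abs]; nlinarith

/-! ### Interaction constants -/

/-- Normalized, symmetrized interaction constants. -/
def ell (j k : Fin n) : ℝ := min (min (P.L j k) (P.L k j)) P.Γ / P.Γ

lemma ell_nonneg (j k : Fin n) : 0 ≤ P.ell j k :=
  div_nonneg (le_min (le_min (P.L_nonneg _ _) (P.L_nonneg _ _)) P.Γ_pos.le) P.Γ_pos.le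

lemma ell_le_one (j k : Fin n) : P.ell j k ≤ 1 :=
  (div_le_one P.Γ_pos).2 (min_le_right _ _)

/-- Symmetry allows the mean over either of two picks to be estimated by `sum_ell_sq_le`. -/
lemma ell_symm (j k : Fin n) : P.ell j k = P.ell k j := by
  unfold ell; rw [min_comm (P.L j k)]

lemma lip_ell (j k : Fin n) (x : Pt n) (r : ℝ) :
    |P.g (x + EuclideanSpace.single j r) k - P.g x k| ≤ P.Γ * P.ell j k * |r| := by
  have hΓ := P.Γ_pos
  have : P.Γ * P.ell j k = min (min (P.L j k) (P.L k j)) P.Γ := by unfold ell; field_simp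
  rw [this]
  rcases min_choice (min (P.L j k) (P.L k j)) P.Γ with h | h <;> rw [h]
  · rcases min_choice (P.L j k) (P.L k j) with h | h <;> rw [h]
    · exact P.lip j k x r
    · exact P.lip_symm j k x r
  · exact P.lip_Γ j k x r

/-- The coordinates are changed one at a time, each change costing its own interaction constant. -/
lemma abs_grad_sub_le (k : Fin n) (a b : Pt n) :
    |P.g a k - P.g b k| ≤ P.Γ * ∑ j, P.ell j k * |a j - b j| := by
  have key : ∀ s : Finset (Fin n),
      |P.g (b + ∑ j ∈ s, EuclideanSpace.single j (a j - b j)) k - P.g b k| ≤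
        P.Γ * ∑ j ∈ s, P.ell j k * |a j - b j| := by
    intro s
    induction s using Finset.induction_on with
    | empty => simp
    | insert i s hi ih =>
      rw [Finset.sum_insert hi, Finset.sum_insert hi, add_comm (EuclideanSpace.single i _), ← add_assoc]
      have h1 := P.lip_ell i k (b + ∑ j ∈ s, EuclideanSpace.single j (a j - b j)) (a i - b i)
      have h2 := abs_sub_le (P.g (b + ∑ j ∈ s, EuclideanSpace.single j (a j - b j) +
        EuclideanSpace.single i (a i - b i)) k)
        (P.g (b + ∑ j ∈ s, EuclideanSpace.single j (a j - b j)) k) (P.g b k)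
      linarith
  have h := key Finset.univ
  have e : b + ∑ j, EuclideanSpace.single j (a j - b j) = a := by
    ext i
    simp [Finset.sum_apply, Pi.single_apply]
  rwa [e] at h

/-- The mean square interaction. -/
def rho : ℝ := Lres P.L ^ 2 / (n * P.Γ ^ 2)

lemma n_cast_pos (P : Composite n) : (0 : ℝ) < n := by exact_mod_cast P.n_pos

lemma rho_nonneg : 0 ≤ P.rho := by
  have := P.n_cast_pos
  unfold rho; positivity

lemma sum_ell_sq_le (j : Fin n) : ∑ k, P.ell j k ^ 2 ≤ n * P.rho := by
  have hn := P.n_cast_pos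
  have hΓ := P.Γ_pos
  have h1 : √(∑ k, P.L j k ^ 2) ≤ Lres P.L :=
    le_ciSup (f := fun j => √(∑ k, P.L j k ^ 2)) (Set.finite_range _).bddAbove j
  have h2 : ∑ k, P.L j k ^ 2 ≤ Lres P.L ^ 2 := by
    rw [← Real.sq_sqrt (Finset.sum_nonneg fun k _ => sq_nonneg (P.L j k))]
    exact pow_le_pow_left₀ (Real.sqrt_nonneg _) h1 2
  have h3 : (n : ℝ) * P.rho = Lres P.L ^ 2 / P.Γ ^ 2 := by unfold rho; field_simp
  rw [h3, le_div_iff₀ (by positivity), Finset.sum_mul]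
  refine le_trans (Finset.sum_le_sum fun k _ => ?_) h2
  rw [← mul_pow]
  refine pow_le_pow_left₀ (mul_nonneg (P.ell_nonneg _ _) hΓ.le) ?_ 2
  unfold ell
  rw [div_mul_cancel₀ _ hΓ.ne']
  exact (min_le_left _ _).trans (min_le_left _ _)

/-! ### Best coordinate steps compared with the objective -/

lemma continuous_F : Continuous P.F := by
  have h : ∀ k, Continuous (P.Ψ k) := fun k => (P.convexΨ k).locallyLipschitz.continuous
  have := P.diff.continuous
  unfold F objective
  fun_prop

lemma convex_F : ConvexOn ℝ Set.univ P.F := by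
  refine ⟨convex_univ, fun x _ y _ a b ha hb hab => ?_⟩
  have h1 := P.convex.2 (Set.mem_univ x) (Set.mem_univ y) ha hb hab
  have h2 : ∀ k, P.Ψ k ((a • x + b • y) k) ≤ a * P.Ψ k (x k) + b * P.Ψ k (y k) := fun k => by
    simpa using (P.convexΨ k).2 (Set.mem_univ (x k)) (Set.mem_univ (y k)) ha hb hab
  have h3 := Finset.sum_le_sum fun k (_ : k ∈ Finset.univ) => h2 k
  simp only [F, objective, smul_eq_mul] at *
  rw [Finset.sum_add_distrib, ← Finset.mul_sum, ← Finset.mul_sum] at h3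
  linarith

/-- The value of the best step along coordinate `k` at `z`. -/
def V (z : Pt n) (k : Fin n) : ℝ := proxMax P.Γ (P.Ψ k) (P.g z k) (z k)

lemma V_nonneg (z : Pt n) (k : Fin n) : 0 ≤ P.V z k := proxMax_nonneg (P.convexΨ k) P.Γ_pos _ _

/-- The mean over the coordinates of the values of the best steps. -/
def Vbar (z : Pt n) : ℝ := (1 / n : ℝ) * ∑ k, P.V z k

lemma Vbar_nonneg (z : Pt n) : 0 ≤ P.Vbar z :=
  mul_nonneg (by positivity) (Finset.sum_nonneg fun k _ => P.V_nonneg z k)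

lemma F_add_single_le (y : Pt n) (k : Fin n) (d : ℝ) :
    P.F (y + EuclideanSpace.single k d) ≤ P.F y - proxW d (P.g y k) (y k) P.Γ (P.Ψ k) := by
  have h1 := P.descent_coord y k d
  have h2 : ∑ j, P.Ψ j ((y + EuclideanSpace.single k d : Pt n) j) =
      ∑ j, P.Ψ j (y j) + (P.Ψ k (y k + d) - P.Ψ k (y k)) := by
    rw [← Finset.add_sum_erase _ _ (Finset.mem_univ k),
      ← Finset.add_sum_erase (a := k) _ (fun j => P.Ψ j (y j)) (Finset.mem_univ k)]
    have : ∀ j ∈ Finset.univ.erase k, P.Ψ j ((y + EuclideanSpace.single k d : Pt n) j) =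
        P.Ψ j (y j) := by
      intro j hj
      simp [Finset.ne_of_mem_erase hj]
    rw [Finset.sum_congr rfl this]
    simp
    ring
  simp only [F, objective, proxW]
  rw [h2]; linarith

/-- Cauchy–Schwarz is applied to each row of `ell` and then to the sum of |d j|. The outcome is that
n·√ρ·Γ acts as a global smoothness constant of f. -/
lemma abs_sum_grad_sub_le (z d : Pt n) (t : ℝ) :
    |∑ k, P.g (z + t • d) k * d k - ∑ k, P.g z k * d k| ≤
      (√n * √(n * P.rho) * P.Γ * ‖d‖ ^ 2) * |t| := by
  have hΓ := P.Γ_pos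
  have hd : ∑ k, |d k| ^ 2 = ‖d‖ ^ 2 := by
    rw [EuclideanSpace.norm_sq_eq]; simp
  have hd' : √(∑ k, |d k| ^ 2) = ‖d‖ := by rw [hd, Real.sqrt_sq (norm_nonneg _)]
  have h1 : ∀ k, |P.g (z + t • d) k * d k - P.g z k * d k| ≤
      P.Γ * |t| * ∑ j, |d j| * (P.ell j k * |d k|) := by
    intro k
    rw [← sub_mul, abs_mul]
    calc _ ≤ (P.Γ * ∑ j, P.ell j k * |(z + t • d : Pt n) j - z j|) * |d k| :=
          mul_le_mul_of_nonneg_right (P.abs_grad_sub_le k _ _) (abs_nonneg _)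
      _ = _ := by
          simp only [PiLp.add_apply, PiLp.smul_apply, add_sub_cancel_left, smul_eq_mul, abs_mul,
            Finset.mul_sum, Finset.sum_mul]
          exact Finset.sum_congr rfl fun j _ => by ring
  have h2 : ∀ j, ∑ k, P.ell j k * |d k| ≤ √(n * P.rho) * ‖d‖ := by
    intro j
    refine (Real.sum_mul_le_sqrt_mul_sqrt _ _ _).trans ?_
    rw [hd']
    exact mul_le_mul_of_nonneg_right (Real.sqrt_le_sqrt (P.sum_ell_sq_le j)) (norm_nonneg _)
  have h3 : ∑ j, |d j| ≤ √n * ‖d‖ := by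
    have := Real.sum_mul_le_sqrt_mul_sqrt Finset.univ (fun _ : Fin n => (1 : ℝ)) (fun j => |d j|)
    simp only [one_mul, hd'] at this
    simpa using this
  have h4 : ∑ k, ∑ j, |d j| * (P.ell j k * |d k|) ≤ √n * ‖d‖ * (√(n * P.rho) * ‖d‖) := by
    rw [Finset.sum_comm]
    simp_rw [← Finset.mul_sum]
    calc _ ≤ ∑ j, |d j| * (√(n * P.rho) * ‖d‖) :=
          Finset.sum_le_sum fun j _ => mul_le_mul_of_nonneg_left (h2 j) (abs_nonneg _)
      _ = (∑ j, |d j|) * (√(n * P.rho) * ‖d‖) := by rw [Finset.sum_mul]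
      _ ≤ _ := mul_le_mul_of_nonneg_right h3 (by positivity)
  rw [← Finset.sum_sub_distrib]
  calc _ ≤ ∑ k, |P.g (z + t • d) k * d k - P.g z k * d k| := Finset.abs_sum_le_sum_abs _ _
    _ ≤ ∑ k, P.Γ * |t| * ∑ j, |d j| * (P.ell j k * |d k|) := Finset.sum_le_sum fun k _ => h1 k
    _ = P.Γ * |t| * ∑ k, ∑ j, |d j| * (P.ell j k * |d k|) := by rw [Finset.mul_sum]
    _ ≤ P.Γ * |t| * (√n * ‖d‖ * (√(n * P.rho) * ‖d‖)) :=
        mul_le_mul_of_nonneg_left h4 (by positivity)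
    _ = _ := by ring

lemma f_add_le (z d : Pt n) : P.f (z + d) ≤ P.f z + ∑ k, P.g z k * d k +
    √n * √(n * P.rho) * P.Γ / 2 * ‖d‖ ^ 2 := by
  have h := le_quadratic_of_deriv (P.hasDerivAt_line z d)
    (c := √n * √(n * P.rho) * P.Γ * ‖d‖ ^ 2) (fun t => by
      simp only [zero_smul, add_zero]; exact P.abs_sum_grad_sub_le z d t) 1
  simp only [zero_smul, add_zero, one_smul] at h
  linarith

/-- The mean value of the best steps is controlled by the value of the objective. -/
lemma Vbar_le (z : Pt n) : P.Vbar z ≤ max (1 / (n : ℝ)) (√P.rho) * P.F z := by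
  have hn := P.n_cast_pos
  have hΓ := P.Γ_pos
  have hρ := P.rho_nonneg
  -- c·Γ dominates the smoothness constant of f. All n best steps, taken simultaneously and shrunk
  -- by θ = 1/c, thus bring F down by at least θ·ΣV; since F ≥ 0 there, θ·ΣV ≤ F z.
  set c : ℝ := max 1 (n * √P.rho) with hc
  have hc1 : 1 ≤ c := le_max_left _ _
  have hc2 : √n * √(n * P.rho) ≤ c := by
    have : √n * √(n * P.rho) = n * √P.rho := by
      rw [Real.sqrt_mul hn.le, ← mul_assoc, Real.mul_self_sqrt hn.le]
    rw [this]; exact le_max_right _ _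
  choose d hd using fun k => exists_isProxStep (P.convexΨ k) hΓ (P.g z k) (z k)
  set D : Pt n := WithLp.toLp 2 d with hD
  set θ : ℝ := 1 / c
  have hθ0 : 0 ≤ θ := by positivity
  have hθ1 : θ ≤ 1 := by rw [div_le_one (by linarith)]; exact hc1
  have hθc : θ * c = 1 := by simp only [θ]; field_simp
  have h1 := P.f_add_le z (θ • D)
  have hsq : ‖θ • D‖ ^ 2 = θ ^ 2 * ∑ k, d k ^ 2 := by
    rw [norm_smul, mul_pow, Real.norm_eq_abs, sq_abs, EuclideanSpace.norm_sq_eq]; simp [hD]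
  have hsum0 : 0 ≤ ∑ k, d k ^ 2 := Finset.sum_nonneg fun k _ => sq_nonneg _
  have h2 : √n * √(n * P.rho) * P.Γ / 2 * ‖θ • D‖ ^ 2 ≤ θ * (P.Γ / 2 * ∑ k, d k ^ 2) := by
    rw [hsq]
    have : √n * √(n * P.rho) * θ ≤ 1 := by
      rw [← hθc, mul_comm θ]; exact mul_le_mul_of_nonneg_right hc2 hθ0
    have h3 : 0 ≤ θ * (P.Γ / 2 * ∑ k, d k ^ 2) := by positivity
    nlinarith
  have h3 : ∑ k, P.g z k * (θ • D : Pt n) k = θ * ∑ k, P.g z k * d k := by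
    rw [Finset.mul_sum]
    exact Finset.sum_congr rfl fun k _ => by simp [hD]; ring
  have h4 : ∑ k, P.Ψ k ((z + θ • D : Pt n) k) ≤
      ∑ k, P.Ψ k (z k) + θ * ∑ k, (P.Ψ k (z k + d k) - P.Ψ k (z k)) := by
    rw [Finset.mul_sum, ← Finset.sum_add_distrib]
    refine Finset.sum_le_sum fun k _ => ?_
    have := (P.convexΨ k).2 (Set.mem_univ (z k)) (Set.mem_univ (z k + d k))
      (by linarith : 0 ≤ 1 - θ) hθ0 (by ring)
    have e : (1 - θ) • z k + θ • (z k + d k) = (z + θ • D : Pt n) k := by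
      simp [hD]; ring
    rw [e] at this
    simp only [smul_eq_mul] at this
    linarith
  have h5 : ∑ k, P.V z k = -(∑ k, P.g z k * d k) - P.Γ / 2 * ∑ k, d k ^ 2
      - ∑ k, (P.Ψ k (z k + d k) - P.Ψ k (z k)) := by
    rw [Finset.mul_sum, ← Finset.sum_neg_distrib, ← Finset.sum_sub_distrib,
      ← Finset.sum_sub_distrib]
    refine Finset.sum_congr rfl fun k _ => ?_
    rw [V, (hd k).proxMax_eq, proxW]; ring
  have h6 := P.nonneg (z + θ • D)
  have h7 : θ * ∑ k, P.V z k ≤ P.F z := by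
    simp only [F, objective] at h6 ⊢
    rw [h5]; linarith
  have h8 : ∑ k, P.V z k ≤ c * P.F z := by
    calc _ = c * (θ * ∑ k, P.V z k) := by rw [← mul_assoc, mul_comm c, hθc, one_mul]
      _ ≤ _ := mul_le_mul_of_nonneg_left h7 (by linarith)
  have h9 : max (1 / (n : ℝ)) (√P.rho) = 1 / n * c := by
    rw [hc, mul_max_of_nonneg _ _ (by positivity)]
    congr 1
    · ring
    · field_simp
  rw [h9, Vbar, mul_assoc]
  exact mul_le_mul_of_nonneg_left h8 (by positivity)

/-- The coordinates of an arbitrary displacement d are candidates for the n separate proximal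
problems. Below, d points towards a minimizer. -/
lemma sum_V_ge {μ : ℝ} (h : StrongConvexOn Set.univ μ P.f) (z d : Pt n) :
    P.F z - P.F (z + d) - (P.Γ - μ) / 2 * ‖d‖ ^ 2 ≤ ∑ k, P.V z k := by
  have h1 := P.first_order h z d
  have h2 : ∑ k, proxW (d k) (P.g z k) (z k) P.Γ (P.Ψ k) ≤ ∑ k, P.V z k :=
    Finset.sum_le_sum fun k _ => proxW_le_proxMax (P.convexΨ k) P.Γ_pos _ _ _
  have h3 : ∑ k, proxW (d k) (P.g z k) (z k) P.Γ (P.Ψ k) = -(∑ k, P.g z k * d k)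
      - P.Γ / 2 * ‖d‖ ^ 2 + ∑ k, P.Ψ k (z k) - ∑ k, P.Ψ k (z k + d k) := by
    rw [EuclideanSpace.norm_sq_eq, Finset.mul_sum, ← Finset.sum_neg_distrib,
      ← Finset.sum_sub_distrib, ← Finset.sum_add_distrib, ← Finset.sum_sub_distrib]
    refine Finset.sum_congr rfl fun k _ => ?_
    simp [proxW]
  simp only [F, objective, PiLp.add_apply]
  rw [h3] at h2
  linarith

lemma sum_V_ge_convex (z x : Pt n) {l : ℝ} (h0 : 0 ≤ l) (h1 : l ≤ 1) (hx : P.F x = 0) :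
    l * P.F z - l ^ 2 * P.Γ / 2 * dist z x ^ 2 ≤ ∑ k, P.V z k := by
  have h := P.sum_V_ge P.strongConvexOn_zero z (l • (x - z))
  have h2 := P.convex_F.2 (Set.mem_univ z) (Set.mem_univ x) (by linarith : 0 ≤ 1 - l) h0 (by ring)
  have e : (1 - l) • z + l • x = z + l • (x - z) := by module
  rw [e, hx] at h2
  simp only [smul_eq_mul, mul_zero, add_zero] at h2
  have e2 : ‖l • (x - z)‖ ^ 2 = l ^ 2 * dist z x ^ 2 := by
    rw [norm_smul, mul_pow, Real.norm_eq_abs, sq_abs, dist_comm, dist_eq_norm]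
  rw [e2] at h
  nlinarith

lemma strong_param_le {μ : ℝ} (h : StrongConvexOn Set.univ μ P.f) : μ ≤ P.Γ := by
  have k : Fin n := ⟨0, P.n_pos⟩
  have h1 := P.first_order h 0 (EuclideanSpace.single k 1)
  have h2 := P.descent_coord 0 k 1
  have h3 : ∑ i, P.g 0 i * (EuclideanSpace.single k (1 : ℝ) : Pt n) i = P.g 0 k := by simp
  rw [h3] at h1
  rw [show ‖(EuclideanSpace.single k (1 : ℝ) : Pt n)‖ = 1 by simp] at h1
  simp only [one_pow, mul_one] at h1 h2
  linarith

lemma sum_V_ge_strong {μF μ : ℝ} (hμF : 0 < μF) (hF : StrongConvexOn Set.univ μF P.F)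
    (h : StrongConvexOn Set.univ μ P.f) (z : Pt n) :
    μF / (μF + P.Γ - μ) * P.F z ≤ ∑ k, P.V z k := by
  obtain ⟨x, hx⟩ := P.exists_zero
  have hμ := P.strong_param_le h
  -- This l solves l·(Γ - μ) = (1 - l)·μF, so the quadratic loss in `sum_V_ge` cancels exactly
  -- against the gain from strong convexity of F on the segment.
  set l := μF / (μF + P.Γ - μ) with hl
  have hden : 0 < μF + P.Γ - μ := by linarith
  have h0 : 0 ≤ l := by positivity
  have h1 : l ≤ 1 := by rw [hl, div_le_one hden]; linarith
  have hl' : l * (μF + P.Γ - μ) = μF := by rw [hl]; field_simp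
  have h2 := P.sum_V_ge h z (l • (x - z))
  have h3 := hF.2 (Set.mem_univ z) (Set.mem_univ x) (by linarith : 0 ≤ 1 - l) h0 (by ring)
  have e : (1 - l) • z + l • x = z + l • (x - z) := by module
  rw [e, show P.F x = 0 from hx] at h3
  simp only [smul_eq_mul, mul_zero, add_zero] at h3
  have e2 : ‖l • (x - z)‖ ^ 2 = l ^ 2 * ‖z - x‖ ^ 2 := by
    rw [norm_smul, mul_pow, Real.norm_eq_abs, sq_abs, norm_sub_rev]
  rw [e2] at h2
  have e3 : (P.Γ - μ) / 2 * (l ^ 2 * ‖z - x‖ ^ 2) =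
      (1 - l) * l * (μF / 2 * ‖z - x‖ ^ 2) := by
    linear_combination (l * ‖z - x‖ ^ 2 / 2) * hl'
  rw [e3] at h2
  linarith

/-- The radius only speaks about points with F ≤ F(x₀). For a higher z, let y be the point at
fraction s = F(x₀)/F(z) from the nearest minimizer x towards z. Convexity puts y in the level set,
so dist(z, x) ≤ (1 - s)·dist(z, x) + R, that is, s·dist(z, x) ≤ R. -/
lemma exists_minimizer_dist_le {x₀ : Pt n} (h0 : 0 < P.F x₀) {R : ℝ}
    (hR : levelRadius P.F x₀ ≤ ENNReal.ofReal R) (hR0 : 0 ≤ R) (z : Pt n) :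
    ∃ x, P.F x = 0 ∧ dist z x * P.F x₀ ≤ R * max (P.F x₀) (P.F z) := by
  have hmem : ∀ x, x ∈ minimizers P.F ↔ P.F x = 0 := by
    obtain ⟨y, hy⟩ := P.exists_zero
    intro x
    constructor
    · intro h
      exact le_antisymm ((h y).trans hy.le) (P.nonneg x)
    · intro h w
      rw [h]; exact P.nonneg w
  have hne : (minimizers P.F).Nonempty := by
    obtain ⟨y, hy⟩ := P.exists_zero
    exact ⟨y, (hmem y).2 hy⟩
  have hcl : IsClosed (minimizers P.F) := by
    have : minimizers P.F = P.F ⁻¹' {0} := by ext x; rw [hmem]; rfl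
    rw [this]; exact isClosed_singleton.preimage P.continuous_F
  have hlev : ∀ y, P.F y ≤ P.F x₀ → Metric.infDist y (minimizers P.F) ≤ R := by
    intro y hy
    refine ENNReal.toReal_le_of_le_ofReal hR0 (le_trans ?_ hR)
    exact le_iSup₂ (f := fun x (_ : x ∈ {x : Pt n | P.F x ≤ P.F x₀}) =>
      Metric.infEDist x (minimizers P.F)) y hy
  obtain ⟨x, hx, hxd⟩ := hcl.exists_infDist_eq_dist hne z
  have hx0 := (hmem x).1 hx
  refine ⟨x, hx0, ?_⟩
  rcases le_total (P.F z) (P.F x₀) with h | h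
  · rw [max_eq_left h, ← hxd]
    exact mul_le_mul_of_nonneg_right (hlev z h) h0.le
  · rw [max_eq_right h]
    have hz : 0 < P.F z := h0.trans_le h
    set s := P.F x₀ / P.F z with hs
    have hs0 : 0 ≤ s := by positivity
    have hs1 : s ≤ 1 := (div_le_one hz).2 h
    have hsz : s * P.F z = P.F x₀ := by rw [hs]; field_simp
    set y := (1 - s) • x + s • z with hy
    have hFy : P.F y ≤ P.F x₀ := by
      have := P.convex_F.2 (Set.mem_univ x) (Set.mem_univ z) (by linarith : 0 ≤ 1 - s) hs0
        (by ring)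
      simp only [smul_eq_mul] at this
      rw [hx0] at this
      linarith
    obtain ⟨x', hx', hxd'⟩ := hcl.exists_infDist_eq_dist hne y
    have h1 := hlev y hFy
    have h2 : dist z x ≤ dist z x' := by
      rw [← hxd]; exact Metric.infDist_le_dist_of_mem hx'
    have h3 : dist z y = (1 - s) * dist z x := by
      have : z - y = (1 - s) • (z - x) := by rw [hy]; module
      rw [dist_eq_norm, this, norm_smul, Real.norm_eq_abs, abs_of_nonneg (by linarith),
        dist_eq_norm]
    have h4 := dist_triangle z y x'
    rw [hxd'] at h1
    have h5 : s * dist z x ≤ R := by nlinarith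
    calc dist z x * P.F x₀ = s * dist z x * P.F z := by rw [← hsz]; ring
      _ ≤ _ := mul_le_mul_of_nonneg_right h5 hz.le

end Composite

/-! ### Asynchronous runs and their commit order -/

/-- An asynchronous run for a composite objective, with bounded interference. -/
structure AsyncRun (n T q : ℕ) extends Composite n where
  T_pos : 0 < T
  q_lip : (q : ℝ) * (8 * √10 * Lres L) ≤ Γ * √((n : ℝ) - q)
  q_le : (q : ℝ) ≤ 9 / 100 * n
  S : Schedule n T
  valid : S.Valid
  bounded : S.BoundedInterference q
  x₀ : Pt n
  Δ : Path n T → Fin T → ℝ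
  run : ∀ π, S.IsRun f Ψ Γ x₀ π (Δ π)

namespace AsyncRun
variable {n T q : ℕ} (A : AsyncRun n T q)

/-- The memory once the updates in `s` have been written. -/
def memOf (π : Path n T) (s : Finset (Fin T)) : Pt n :=
  WithLp.toLp 2 fun j => A.x₀ j + ∑ u ∈ s with π u = j, A.Δ π u

/-- The updates written before time `τ`. -/
def below (π : Path n T) (τ : ℝ) : Finset (Fin T) := {u | A.S.commit π u < τ}

/-- The memory just before time `τ`. -/
abbrev mem (π : Path n T) (τ : ℝ) : Pt n := A.S.memory A.x₀ π (A.Δ π) τ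

/-- The point read by an update. -/
abbrev rd (π : Path n T) (t : Fin T) : Pt n := A.S.readPoint A.x₀ π (A.Δ π) t

lemma mem_below {π : Path n T} {τ : ℝ} {u : Fin T} :
    u ∈ A.below π τ ↔ A.S.commit π u < τ := by simp [below]

lemma mem_eq_memOf (π : Path n T) (τ : ℝ) : A.mem π τ = A.memOf π (A.below π τ) := by
  ext j
  simp only [mem, Schedule.memory, memOf, below, Finset.filter_filter]
  congr 2
  ext u
  simp [and_comm]

lemma memOf_insert (π : Path n T) {s : Finset (Fin T)} {u : Fin T} (h : u ∉ s) :
    A.memOf π (insert u s) = A.memOf π s + EuclideanSpace.single (π u) (A.Δ π u) := by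
  ext j
  by_cases hj : π u = j
  · subst hj
    simp [memOf, Finset.filter_insert, h]
    ring
  · simp [memOf, Finset.filter_insert, hj, Ne.symm hj]

/-- Summation of the increments along the commits in a time interval. -/
lemma sum_increments (π : Path n T) (H : Finset (Fin T) → ℝ) {a b : ℝ} (hab : a ≤ b) :
    H (A.below π b) = H (A.below π a) +
      ∑ u with a ≤ A.S.commit π u ∧ A.S.commit π u < b,
        (H (insert u (A.below π (A.S.commit π u))) - H (A.below π (A.S.commit π u))) := by
  generalize hN : (Finset.univ.filter fun u => a ≤ A.S.commit π u ∧ A.S.commit π u < b).card = N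
  induction N generalizing b with
  | zero =>
    rw [Finset.card_eq_zero] at hN
    rw [hN, Finset.sum_empty, add_zero]
    congr 1
    ext u
    rw [mem_below, mem_below]
    refine ⟨fun h => ?_, fun h => h.trans_le hab⟩
    by_contra hc
    have : u ∈ Finset.univ.filter fun u => a ≤ A.S.commit π u ∧ A.S.commit π u < b := by
      simp [h, not_lt.1 hc]
    rw [hN] at this
    simp at this
  | succ N ih =>
    set s := Finset.univ.filter fun u => a ≤ A.S.commit π u ∧ A.S.commit π u < b with hs
    obtain ⟨w, hw, hmax⟩ := s.exists_max_image (A.S.commit π)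
      (Finset.card_pos.1 (by rw [hN]; omega))
    have hw' : a ≤ A.S.commit π w ∧ A.S.commit π w < b := by simpa [hs] using hw
    have e1 : Finset.univ.filter (fun u => a ≤ A.S.commit π u ∧
        A.S.commit π u < A.S.commit π w) = s.erase w := by
      ext u
      simp only [Finset.mem_filter, Finset.mem_univ, true_and, Finset.mem_erase, hs]
      constructor
      · rintro ⟨h1, h2⟩
        exact ⟨by rintro rfl; exact lt_irrefl _ h2, h1, h2.trans hw'.2⟩
      · rintro ⟨h1, h2, h3⟩
        refine ⟨h2, lt_of_le_of_ne (hmax u (by simp [hs, h2, h3])) ?_⟩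
        exact fun h => h1 (A.valid.commit_injective π h)
    have e2 : A.below π b = insert w (A.below π (A.S.commit π w)) := by
      ext u
      rw [Finset.mem_insert, mem_below, mem_below]
      constructor
      · intro h
        by_cases hu : u = w
        · exact Or.inl hu
        right
        refine lt_of_le_of_ne ?_ (fun h => hu (A.valid.commit_injective π h))
        by_cases ha : a ≤ A.S.commit π u
        · exact hmax u (by simp [hs, ha, h])
        · linarith
      · rintro (rfl | h)
        · exact hw'.2
        · exact h.trans hw'.2
    have h3 := ih hw'.1 (by rw [e1, Finset.card_erase_of_mem hw, hN]; rfl)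
    rw [e1] at h3
    rw [← Finset.add_sum_erase _ _ hw, e2, h3]
    ring

/-- If w were still pending when r starts, whichever of the two commits first would interfere with
the other, which is excluded for indices more than q apart. All index ranges below derive from this.
-/
lemma commit_lt_start {π : Path n T} {w r : Fin T} (h : (w : ℕ) + q < r) :
    A.S.commit π w < A.S.start π r := by
  by_contra hc
  push Not at hc
  have hwr : w < r := by rw [Fin.lt_def]; omega
  have h1 := A.valid.start_strictMono π hwr
  rcases le_total (A.S.commit π w) (A.S.commit π r) with h2 | h2
  · have := A.bounded π w r ⟨hwr.ne, hc, h2⟩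
    omega
  · have := A.bounded π r w ⟨hwr.ne', (h1.trans (A.valid.start_lt_commit π r)).le, h2⟩
    omega

lemma le_add_of_commit_lt {π : Path n T} {w s : Fin T}
    (h : A.S.commit π w < A.S.commit π s) : (w : ℕ) ≤ s + q := by
  by_contra hc
  push Not at hc
  have h1 := A.commit_lt_start (π := π) hc
  have h2 := A.valid.start_lt_commit π w
  linarith

lemma le_add_of_start_le {π : Path n T} {w r : Fin T}
    (h : A.S.start π r ≤ A.S.commit π w) : (r : ℕ) ≤ w + q := by
  by_contra hc
  push Not at hc
  exact absurd (A.commit_lt_start (π := π) hc) (not_lt.2 h)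

/-! ### Gradient errors and the effect of one commit -/

/-- The value, for its own gradient estimate, of the step made by an update. -/
def W (π : Path n T) (u : Fin T) : ℝ :=
  proxMax A.Γ (A.Ψ (π u)) (A.g (A.rd π u) (π u)) (A.mem π (A.S.commit π u) (π u))

lemma W_nonneg (π : Path n T) (u : Fin T) : 0 ≤ A.W π u :=
  proxMax_nonneg (A.convexΨ _) A.Γ_pos _ _

lemma isProxStep (π : Path n T) (u : Fin T) :
    IsProxStep A.Γ (A.Ψ (π u)) (A.g (A.rd π u) (π u)) (A.mem π (A.S.commit π u) (π u))
      (A.Δ π u) := A.run π u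

/-- The size of the gradient error caused by the interference with an update. -/
def eps (π : Path n T) (u : Fin T) : ℝ :=
  ∑ v with A.S.start π u ≤ A.S.commit π v ∧ A.S.commit π v < A.S.commit π u,
    A.ell (π v) (π u) * √(A.W π v)

lemma abs_mem_sub_le (π : Path n T) (j : Fin n) {a b τ τ' : ℝ} (h : τ ∈ Set.Icc a b)
    (h' : τ' ∈ Set.Icc a b) :
    |A.mem π τ j - A.mem π τ' j| ≤
      ∑ v with π v = j ∧ a ≤ A.S.commit π v ∧ A.S.commit π v < b, |A.Δ π v| := by
  wlog hle : τ' ≤ τ generalizing τ τ'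
  · rw [abs_sub_comm]; exact this h' h (le_of_not_ge hle)
  have h1 : A.mem π τ j - A.mem π τ' j = ∑ v with π v = j ∧ τ' ≤ A.S.commit π v ∧
      A.S.commit π v < τ, A.Δ π v := by
    simp only [mem, Schedule.memory]
    rw [add_sub_add_left_eq_sub, sub_eq_iff_eq_add, ← Finset.sum_union]
    · congr 1
      ext v
      simp only [Finset.mem_filter, Finset.mem_univ, true_and, Finset.mem_union]
      constructor
      · rintro ⟨h1, h2⟩
        rcases lt_or_ge (A.S.commit π v) τ' with h3 | h3
        · exact Or.inr ⟨h1, h3⟩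
        · exact Or.inl ⟨h1, h3, h2⟩
      · rintro (⟨h1, h2, h3⟩ | ⟨h1, h2⟩)
        · exact ⟨h1, h3⟩
        · exact ⟨h1, h2.trans_le hle⟩
    · rw [Finset.disjoint_left]
      intro v hv hv'
      simp only [Finset.mem_filter, Finset.mem_univ, true_and] at hv hv'
      linarith [hv.2.1, hv'.2]
  rw [h1]
  refine (Finset.abs_sum_le_sum_abs _ _).trans
    (Finset.sum_le_sum_of_subset_of_nonneg ?_ fun _ _ _ => abs_nonneg _)
  intro v
  simp only [Finset.mem_filter, Finset.mem_univ, true_and]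
  rintro ⟨h2, h3, h4⟩
  exact ⟨h2, h'.1.trans h3, h4.trans_le h.2⟩

/-- Gradients at two points assembled from reads of the memory during a time interval. -/
lemma abs_grad_sub_le_sum (π : Path n T) (k : Fin n) {a b : ℝ} {p p' : Pt n} {τ τ' : Fin n → ℝ}
    (hp : ∀ j, p j = A.mem π (τ j) j) (hp' : ∀ j, p' j = A.mem π (τ' j) j)
    (h : ∀ j, τ j ∈ Set.Icc a b) (h' : ∀ j, τ' j ∈ Set.Icc a b) :
    |A.g p k - A.g p' k| / √(2 * A.Γ) ≤
      ∑ v with a ≤ A.S.commit π v ∧ A.S.commit π v < b, A.ell (π v) k * √(A.W π v) := by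
  have h2Γ : 0 < √(2 * A.Γ) := Real.sqrt_pos.2 (by linarith [A.Γ_pos])
  rw [div_le_iff₀ h2Γ]
  refine (A.abs_grad_sub_le k p p').trans ?_
  calc A.Γ * ∑ j, A.ell j k * |p j - p' j|
      ≤ A.Γ * ∑ j, A.ell j k * ∑ v with π v = j ∧ a ≤ A.S.commit π v ∧ A.S.commit π v < b,
        |A.Δ π v| := by
        refine mul_le_mul_of_nonneg_left (Finset.sum_le_sum fun j _ => ?_) A.Γ_pos.le
        rw [hp, hp']
        exact mul_le_mul_of_nonneg_left (A.abs_mem_sub_le π j (h j) (h' j)) (A.ell_nonneg _ _)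
    _ = ∑ v with a ≤ A.S.commit π v ∧ A.S.commit π v < b,
        A.ell (π v) k * (A.Γ * |A.Δ π v|) := by
        rw [← Finset.sum_fiberwise _ π, Finset.mul_sum]
        refine Finset.sum_congr rfl fun j _ => ?_
        rw [Finset.mul_sum, Finset.mul_sum, Finset.filter_filter]
        have : (Finset.univ.filter fun v => π v = j ∧ a ≤ A.S.commit π v ∧ A.S.commit π v < b) =
          (Finset.univ.filter fun v => (a ≤ A.S.commit π v ∧ A.S.commit π v < b) ∧ π v = j) := by
          ext v; simp [and_comm]
        rw [this]
        refine Finset.sum_congr rfl fun v hv => ?_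
        simp only [Finset.mem_filter] at hv
        rw [hv.2.2]; ring
    _ ≤ ∑ v with a ≤ A.S.commit π v ∧ A.S.commit π v < b,
        A.ell (π v) k * (√(2 * A.Γ) * √(A.W π v)) := by
        refine Finset.sum_le_sum fun v _ => mul_le_mul_of_nonneg_left ?_ (A.ell_nonneg _ _)
        exact (A.isProxStep π v).mul_abs_le (A.convexΨ _) A.Γ_pos
    _ = _ := by
        rw [Finset.sum_mul]
        exact Finset.sum_congr rfl fun v _ => by ring

/-- The memory at the start of an update. -/
abbrev z (π : Path n T) (t : Fin T) : Pt n := A.mem π (A.S.start π t)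

lemma mem_coord_eq {π : Path n T} {k : Fin n} {a b : ℝ} (hab : a ≤ b)
    (h : ∀ v, a ≤ A.S.commit π v → A.S.commit π v < b → π v ≠ k) :
    A.mem π b k = A.mem π a k := by
  have := A.abs_mem_sub_le π k (Set.right_mem_Icc.2 hab) (Set.left_mem_Icc.2 hab)
  rw [Finset.sum_eq_zero] at this
  · exact sub_eq_zero.1 (abs_nonpos_iff.1 this)
  · intro v hv
    simp only [Finset.mem_filter, Finset.mem_univ, true_and] at hv
    exact absurd hv.1 (h v hv.2.1 hv.2.2)

/-- The point in memory after the write of an update. -/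
lemma memOf_insert_below (π : Path n T) (u : Fin T) :
    A.memOf π (insert u (A.below π (A.S.commit π u))) =
      A.mem π (A.S.commit π u) + EuclideanSpace.single (π u) (A.Δ π u) := by
  rw [memOf_insert _ _ (by simp [below]), ← mem_eq_memOf]

lemma start_le_commit (π : Path n T) (u : Fin T) : A.S.start π u ≤ A.S.commit π u :=
  (A.valid.start_lt_commit π u).le

/-- The point that was read and the memory at the commit are both assembled from contents of the
memory between start and commit, so `eps` bounds the gradient discrepancy, in units of √(2Γ). -/
lemma commit_step_le (π : Path n T) (u : Fin T) :
    A.F (A.memOf π (insert u (A.below π (A.S.commit π u)))) ≤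
      A.F (A.mem π (A.S.commit π u)) - A.W π u + 2 * √(A.W π u) * A.eps π u := by
  rw [memOf_insert_below]
  have h1 := A.F_add_single_le (A.mem π (A.S.commit π u)) (π u) (A.Δ π u)
  have h2 := (A.isProxStep π u).proxMax_sub_le (A.convexΨ _) A.Γ_pos
    (A.g (A.mem π (A.S.commit π u)) (π u))
  have h3 : _ ≤ A.eps π u := A.abs_grad_sub_le_sum π (π u) (p := A.mem π (A.S.commit π u))
    (p' := A.rd π u)
    (fun _ => rfl) (fun _ => rfl) (fun _ => Set.right_mem_Icc.2 (A.start_le_commit π u))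
    (fun j => A.valid.read_mem π u j)
  have h4 := mul_le_mul_of_nonneg_left h3 (show 0 ≤ 2 * √(A.W π u) by positivity)
  unfold W at h4 ⊢
  linarith

/-- Completing the square in √W. This holds with or without collisions. -/
lemma commit_step_le_eps_sq (π : Path n T) (u : Fin T) :
    A.F (A.memOf π (insert u (A.below π (A.S.commit π u)))) ≤
      A.F (A.mem π (A.S.commit π u)) + A.eps π u ^ 2 := by
  have h := A.commit_step_le π u
  nlinarith [sq_nonneg (√(A.W π u) - A.eps π u), Real.sq_sqrt (A.W_nonneg π u)]

/-- Progress of an update whose coordinate is not written by interfering updates. -/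
lemma commit_step_le_of_no_collision (π : Path n T) (u : Fin T)
    (h : ∀ v, A.S.start π u ≤ A.S.commit π v → A.S.commit π v < A.S.commit π u → π v ≠ π u) :
    A.F (A.memOf π (insert u (A.below π (A.S.commit π u)))) ≤
      A.F (A.mem π (A.S.commit π u)) - 4 / 5 * A.V (A.z π u) (π u) + 6 * A.eps π u ^ 2 := by
  rw [memOf_insert_below]
  -- Without a collision the coordinate still has its value from the start of u, so the proximal
  -- problem at the commit, with the gradient at z, has value V(z).
  have h0 := A.mem_coord_eq (A.start_le_commit π u) h
  have h1 := A.F_add_single_le (A.mem π (A.S.commit π u)) (π u) (A.Δ π u)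
  have h2 := (A.isProxStep π u).proxMax_sub_sub_le (A.convexΨ _) A.Γ_pos
    (A.g (A.mem π (A.S.commit π u)) (π u)) (A.g (A.z π u) (π u))
  have h3 : _ ≤ A.eps π u := A.abs_grad_sub_le_sum π (π u) (p := A.mem π (A.S.commit π u))
    (p' := A.rd π u)
    (fun _ => rfl) (fun _ => rfl) (fun _ => Set.right_mem_Icc.2 (A.start_le_commit π u))
    (fun j => A.valid.read_mem π u j)
  have h4 : _ ≤ A.eps π u := A.abs_grad_sub_le_sum π (π u) (p := A.mem π (A.S.commit π u))
    (p' := A.z π u)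
    (fun _ => rfl) (fun _ => rfl) (fun _ => Set.right_mem_Icc.2 (A.start_le_commit π u))
    (fun j => Set.left_mem_Icc.2 (A.start_le_commit π u))
  rw [h0] at h1 h2
  change A.V (A.z π u) (π u) - 2 * √(A.V (A.z π u) (π u)) * _ - _ ≤ _ at h2
  set v := √(A.V (A.z π u) (π u)) with hv
  have hvs : v ^ 2 = A.V (A.z π u) (π u) := Real.sq_sqrt (A.V_nonneg _ _)
  have hv0 : 0 ≤ v := Real.sqrt_nonneg _
  have h5 := mul_le_mul_of_nonneg_left h4 (show 0 ≤ 2 * v by positivity)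
  have h6 := pow_le_pow_left₀ (by positivity) h3 2
  have h7 : 2 * v * A.eps π u ≤ 1 / 5 * v ^ 2 + 5 * A.eps π u ^ 2 := by
    nlinarith [sq_nonneg (v - 5 * A.eps π u)]
  linarith

/-! ### Accumulated errors and pathwise bounds -/

/-- The value of the objective at the start plus the accumulated errors. -/
def Om (π : Path n T) (τ : ℝ) : ℝ := A.F A.x₀ + ∑ u ∈ A.below π τ, A.eps π u ^ 2

lemma F_x₀_nonneg : 0 ≤ A.F A.x₀ := A.nonneg _

lemma Om_nonneg (π : Path n T) (τ : ℝ) : 0 ≤ A.Om π τ :=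
  add_nonneg A.F_x₀_nonneg (Finset.sum_nonneg fun _ _ => sq_nonneg _)

lemma below_subset {π : Path n T} {τ τ' : ℝ} (h : τ ≤ τ') : A.below π τ ⊆ A.below π τ' := by
  intro u
  rw [mem_below, mem_below]
  exact fun hu => hu.trans_le h

lemma Om_mono {π : Path n T} {τ τ' : ℝ} (h : τ ≤ τ') : A.Om π τ ≤ A.Om π τ' :=
  add_le_add_right
    (Finset.sum_le_sum_of_subset_of_nonneg (A.below_subset h) fun _ _ _ => sq_nonneg _) _

lemma memOf_empty (π : Path n T) : A.memOf π ∅ = A.x₀ := by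
  ext j; simp [memOf]

lemma exists_below_eq_empty (π : Path n T) (τ : ℝ) : ∃ a ≤ τ, A.below π a = ∅ := by
  obtain ⟨b, hb⟩ := (Set.finite_range (A.S.commit π)).bddBelow
  refine ⟨min b τ, min_le_right _ _, ?_⟩
  rw [Finset.eq_empty_iff_forall_notMem]
  intro u hu
  rw [mem_below] at hu
  have := hb ⟨u, rfl⟩
  linarith [min_le_left b τ]

/-- `commit_step_le_eps_sq` telescoped over the commits before τ, starting from a time before every
commit. -/
lemma F_mem_le_Om (π : Path n T) (τ : ℝ) : A.F (A.mem π τ) ≤ A.Om π τ := by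
  obtain ⟨a, ha, hae⟩ := A.exists_below_eq_empty π τ
  have h := A.sum_increments π (fun s => A.F (A.memOf π s) - ∑ u ∈ s, A.eps π u ^ 2) ha
  simp only [hae, memOf_empty, Finset.sum_empty, sub_zero] at h
  have h2 : ∑ u with a ≤ A.S.commit π u ∧ A.S.commit π u < τ,
      (A.F (A.memOf π (insert u (A.below π (A.S.commit π u)))) -
        ∑ v ∈ insert u (A.below π (A.S.commit π u)), A.eps π v ^ 2 -
      (A.F (A.memOf π (A.below π (A.S.commit π u))) -
        ∑ v ∈ A.below π (A.S.commit π u), A.eps π v ^ 2)) ≤ 0 := by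
    refine Finset.sum_nonpos fun u _ => ?_
    rw [Finset.sum_insert (by simp [below]), ← mem_eq_memOf]
    linarith [A.commit_step_le_eps_sq π u]
  rw [mem_eq_memOf, Om]
  linarith

/-- F is nonnegative after the commit, so W ≤ F + 2√W·eps, and 2√W·eps ≤ W/3 + 3·eps². -/
lemma W_le (π : Path n T) (u : Fin T) :
    A.W π u ≤ 3 / 2 * A.F (A.mem π (A.S.commit π u)) + 9 / 2 * A.eps π u ^ 2 := by
  have h := A.commit_step_le π u
  have h0 := A.nonneg (A.memOf π (insert u (A.below π (A.S.commit π u))))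
  change 0 ≤ A.F _ at h0
  nlinarith [sq_nonneg (√(A.W π u) - 3 * A.eps π u), Real.sq_sqrt (A.W_nonneg π u)]

lemma W_sq_le (π : Path n T) (u : Fin T) :
    A.W π u ^ 2 ≤ 2 * A.F (A.mem π (A.S.commit π u)) * A.W π u + 27 * A.eps π u ^ 4 := by
  have h := A.W_le π u
  have h1 := mul_le_mul_of_nonneg_right h (A.W_nonneg π u)
  nlinarith [sq_nonneg (A.W π u - 9 * A.eps π u ^ 2)]

/-- Pathwise propagation: the value of a step at time `τ` along the coordinate of update `s`,
for a gradient assembled after the start of update `r`, in terms of the value of the best step at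
the start of `r` and of the steps made since. -/
lemma sqrt_proxMax_le_sum (π : Path n T) {s r : Fin T} (hsr : (s : ℕ) ≤ r + q)
    {τ : ℝ} (hrτ : A.S.start π r ≤ τ)
    {p : Pt n} {t : Fin n → ℝ} (hp : ∀ j, p j = A.mem π (t j) j)
    (ht : ∀ j, t j ∈ Set.Icc (A.S.start π r) τ) :
    √(proxMax A.Γ (A.Ψ (π s)) (A.g p (π s)) (A.mem π τ (π s))) ≤
      √(A.V (A.z π r) (π s) + ∑ w with π w = π s ∧ A.S.start π r ≤ A.S.commit π w ∧
        A.S.commit π w < τ, A.W π w) +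
      ∑ v : Fin T with (s : ℕ) ≤ Fin.val v + 3 * q ∧ A.S.commit π v < τ, A.ell (π v) (π s) * √(A.W π v) := by
  set k := π s
  set C := Finset.univ.filter fun w => π w = k ∧ A.S.start π r ≤ A.S.commit π w ∧
        A.S.commit π w < τ with hC
  have hmono : ∀ a : ℝ, (∀ v : Fin T, a ≤ A.S.commit π v → (s : ℕ) ≤ v + 3 * q) →
      ∑ v with a ≤ A.S.commit π v ∧ A.S.commit π v < τ, A.ell (π v) k * √(A.W π v) ≤
      ∑ v : Fin T with (s : ℕ) ≤ Fin.val v + 3 * q ∧ A.S.commit π v < τ, A.ell (π v) k * √(A.W π v) := by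
    intro a ha
    refine Finset.sum_le_sum_of_subset_of_nonneg ?_ fun _ _ _ =>
      mul_nonneg (A.ell_nonneg _ _) (Real.sqrt_nonneg _)
    intro v
    simp only [Finset.mem_filter, Finset.mem_univ, true_and]
    exact fun h => ⟨ha v h.1, h.2⟩
  have hr : ∀ v : Fin T, A.S.start π r ≤ A.S.commit π v → (s : ℕ) ≤ v + 3 * q := by
    intro v hv
    have := A.le_add_of_start_le hv
    omega
  have hW0 : ∀ w ∈ C, 0 ≤ A.W π w := fun w _ => A.W_nonneg π w
  -- If nobody has written coordinate k since the start of r, its value is the one at z_r and only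
  -- the gradient has to be exchanged.
  rcases C.eq_empty_or_nonempty with h | h
  · have h0 : A.mem π τ k = A.z π r k := by
      refine A.mem_coord_eq hrτ fun v h1 h2 h3 => ?_
      have : v ∈ C := by simp [hC, h1, h2, h3]
      rw [h] at this
      simp at this
    have h1 := A.abs_grad_sub_le_sum π k hp (p' := A.z π r) (fun _ => rfl) ht
      (fun _ => Set.left_mem_Icc.2 hrτ)
    have h2 := sqrt_proxMax_le (A.convexΨ k) A.Γ_pos (A.g (A.z π r) k) (A.g p k) (A.z π r k)
    rw [h0, h, Finset.sum_empty, add_zero]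
    exact h2.trans (add_le_add le_rfl (h1.trans (hmono _ hr)))
  -- Otherwise the last writer w of coordinate k is used: right after its step the value for the
  -- gradient of w is at most W of w, and then the gradient is exchanged.
  · obtain ⟨w, hw, hmax⟩ := C.exists_max_image (A.S.commit π) h
    have hw' : π w = k ∧ A.S.start π r ≤ A.S.commit π w ∧ A.S.commit π w < τ := by
      simpa [hC] using hw
    have hbw : A.memOf π (insert w (A.below π (A.S.commit π w))) k = A.mem π τ k := by
      rw [mem_eq_memOf]
      simp only [memOf]
      congr 1
      refine Finset.sum_congr ?_ fun _ _ => rfl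
      ext v
      simp only [Finset.mem_filter, Finset.mem_insert, mem_below]
      constructor
      · rintro ⟨rfl | h1, h2⟩
        · exact ⟨hw'.2.2, h2⟩
        · exact ⟨h1.trans hw'.2.2, h2⟩
      · rintro ⟨h1, h2⟩
        refine ⟨?_, h2⟩
        by_cases hv : v = w
        · exact Or.inl hv
        right
        refine lt_of_le_of_ne ?_ (fun h => hv (A.valid.commit_injective π h))
        by_cases ha : A.S.start π r ≤ A.S.commit π v
        · exact hmax v (by simp [hC, h1, h2, ha])
        · linarith [hw'.2.1]
    have h0 : A.mem π τ k = A.mem π (A.S.commit π w) k + A.Δ π w := by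
      rw [← hbw, memOf_insert_below, ← hw'.1]
      simp
    have hstep := A.isProxStep π w
    rw [hw'.1] at hstep
    have h3 := hstep.proxMax_add_le (A.convexΨ k) A.Γ_pos
    have hWw : proxMax A.Γ (A.Ψ k) (A.g (A.rd π w) k) (A.mem π (A.S.commit π w) k) = A.W π w := by
      rw [W, hw'.1]
    rw [hWw] at h3
    -- The two gradients are read after the earlier of the two starts. A commit v after the start of
    -- w has w ≤ v + q; with r ≤ w + q and s ≤ r + q this gives s ≤ v + 3q, the range of the last
    -- sum.
    set a := min (A.S.start π w) (A.S.start π r) with ha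
    have h1 := A.abs_grad_sub_le_sum π k (a := a) (b := τ) hp (p' := A.rd π w) (fun _ => rfl)
      (fun j => ⟨(min_le_right _ _).trans (ht j).1, (ht j).2⟩)
      (fun j => ⟨(min_le_left _ _).trans (A.valid.read_mem π w j).1,
        (A.valid.read_mem π w j).2.trans hw'.2.2.le⟩)
    have h2 := sqrt_proxMax_le (A.convexΨ k) A.Γ_pos (A.g (A.rd π w) k) (A.g p k) (A.mem π τ k)
    have h4 : √(proxMax A.Γ (A.Ψ k) (A.g (A.rd π w) k) (A.mem π τ k)) ≤
        √(A.V (A.z π r) k + ∑ w ∈ C, A.W π w) := by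
      refine Real.sqrt_le_sqrt ?_
      rw [h0]
      have := Finset.single_le_sum hW0 hw
      linarith [A.V_nonneg (A.z π r) k]
    refine h2.trans (add_le_add h4 (h1.trans (hmono _ fun v hv => ?_)))
    rcases min_le_iff.1 hv with h5 | h5
    · have h6 := A.le_add_of_start_le h5
      have h7 := A.le_add_of_start_le hw'.2.1
      omega
    · exact hr v h5

/-! ### Non-anticipation: what is determined by the earlier picks -/

/-- Two paths that agree before the pick of update `m`. -/
def Agree (m : Fin T) (π π' : Path n T) : Prop := ∀ i < m, π i = π' i

lemma Agree.symm {m : Fin T} {π π' : Path n T} (h : Agree m π π') : Agree m π' π :=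
  fun i hi => (h i hi).symm

lemma Agree.mono {m m' : Fin T} (hm : m' ≤ m) {π π' : Path n T} (h : Agree m π π') :
    Agree m' π π' :=
  fun i hi => h i (hi.trans_le hm)

variable {A} {m : Fin T} {π π' : Path n T}

lemma Agree.start_eq (h : Agree m π π') : A.S.start π' m = A.S.start π m :=
  (A.valid.nonanticipating π π' m h).1

lemma lt_of_commit_lt_start {t : Fin T} (ht : A.S.commit π t < A.S.start π m) : t < m := by
  by_contra hc
  have h1 := (A.valid.start_strictMono π).monotone (not_lt.1 hc)
  linarith [A.valid.start_lt_commit π t]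

lemma Agree.commit_eq (h : Agree m π π') {t : Fin T} (ht : A.S.commit π t < A.S.start π m) :
    A.S.commit π' t = A.S.commit π t :=
  ((A.valid.nonanticipating π π' m h).2 t (lt_of_commit_lt_start ht)).1 ht

lemma Agree.path_eq (h : Agree m π π') {t : Fin T} (ht : A.S.commit π t < A.S.start π m) :
    π t = π' t := h t (lt_of_commit_lt_start ht)

lemma Agree.below_eq (h : Agree m π π') {τ : ℝ} (hτ : τ ≤ A.S.start π m) :
    A.below π' τ = A.below π τ := by
  ext u
  rw [mem_below, mem_below]
  constructor
  · intro hu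
    have h1 : A.S.commit π' u < A.S.start π' m := by rw [h.start_eq]; linarith
    rw [h.symm.commit_eq h1]; exact hu
  · intro hu
    rw [h.commit_eq (by linarith)]; exact hu

lemma memOf_congr {s : Finset (Fin T)} (h1 : ∀ t ∈ s, π t = π' t)
    (h2 : ∀ t ∈ s, A.Δ π' t = A.Δ π t) : A.memOf π' s = A.memOf π s := by
  ext j
  simp only [memOf]
  congr 1
  refine Finset.sum_congr (Finset.filter_congr fun t ht => by rw [h1 t ht]) fun t ht => ?_
  exact h2 t (Finset.mem_filter.1 ht).1

lemma Agree.rd_mem_eq (h : Agree m π π') {t : Fin T} (ht : A.S.commit π t < A.S.start π m)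
    (hΔ : ∀ s, A.S.commit π s < A.S.commit π t → A.Δ π' s = A.Δ π s) :
    A.rd π' t = A.rd π t ∧
      A.mem π' (A.S.commit π' t) = A.mem π (A.S.commit π t) := by
  have hmem : ∀ τ ≤ A.S.commit π t, A.mem π' τ = A.mem π τ := by
    intro τ hτ
    rw [mem_eq_memOf, mem_eq_memOf, h.below_eq (by linarith)]
    refine memOf_congr (fun s hs => ?_) (fun s hs => ?_) <;> rw [mem_below] at hs
    · exact h.path_eq (by linarith)
    · exact hΔ s (by linarith)
  constructor
  · ext j
    have h1 := (A.valid.read_mem π t j).2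
    have h2 := ((A.valid.nonanticipating π π' m h).2 t (lt_of_commit_lt_start ht)).2 j
      (by linarith)
    change A.mem π' (A.S.read π' t j) j = A.mem π (A.S.read π t j) j
    rw [h2, hmem _ h1]
  · rw [h.commit_eq ht, hmem _ le_rfl]

/-- Strong induction along the commit order: equal earlier increments give equal reads and memory,
hence the same proximal problem, and its maximizer is unique. -/
lemma Agree.Δ_eq (h : Agree m π π') {t : Fin T} (ht : A.S.commit π t < A.S.start π m) :
    A.Δ π' t = A.Δ π t := by
  generalize hN : (A.below π (A.S.commit π t)).card = N
  induction N using Nat.strong_induction_on generalizing t with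
  | _ N ih =>
    have h1 := h.rd_mem_eq ht fun s hs => ih _ (by
      rw [← hN]
      refine Finset.card_lt_card ⟨A.below_subset hs.le, fun hc => ?_⟩
      have := hc ((A.mem_below).2 hs)
      rw [mem_below] at this
      exact lt_irrefl _ this) (hs.trans ht) rfl
    have h2 := A.isProxStep π t
    have h3 := A.isProxStep π' t
    rw [h1.1, h1.2, ← h.path_eq ht] at h3
    exact h3.eq_of_isProxStep (A.convexΨ _) A.Γ_pos h2

lemma Agree.mem_eq (h : Agree m π π') {τ : ℝ} (hτ : τ ≤ A.S.start π m) :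
    A.mem π' τ = A.mem π τ := by
  rw [mem_eq_memOf, mem_eq_memOf, h.below_eq hτ]
  refine memOf_congr (fun s hs => ?_) (fun s hs => ?_) <;> rw [mem_below] at hs
  · exact h.path_eq (by linarith)
  · exact h.Δ_eq (by linarith)

lemma Agree.z_eq (h : Agree m π π') : A.z π' m = A.z π m := by
  rw [z, h.start_eq, h.mem_eq le_rfl]

lemma Agree.W_eq (h : Agree m π π') {t : Fin T} (ht : A.S.commit π t < A.S.start π m) :
    A.W π' t = A.W π t := by
  have h1 := h.rd_mem_eq ht fun s hs => h.Δ_eq (hs.trans ht)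
  rw [W, W, h1.1, h1.2, h.path_eq ht]

lemma Agree.start_eq_of_lt (h : Agree m π π') {t : Fin T} (ht : t < m) :
    A.S.start π' t = A.S.start π t := (h.mono ht.le).start_eq

lemma Agree.eps_eq (h : Agree m π π') {t : Fin T} (ht : A.S.commit π t < A.S.start π m) :
    A.eps π' t = A.eps π t := by
  rw [eps, eps, h.commit_eq ht, h.start_eq_of_lt (lt_of_commit_lt_start ht)]
  have hb := h.below_eq ht.le
  refine Finset.sum_congr ?_ fun v hv => ?_
  · ext v
    simp only [Finset.mem_filter, Finset.mem_univ, true_and]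
    have h1 : A.S.commit π' v < A.S.commit π t ↔ A.S.commit π v < A.S.commit π t := by
      rw [← mem_below, ← mem_below, hb]
    constructor
    · rintro ⟨h2, h3⟩
      have h4 := h1.1 h3
      rw [h.commit_eq (h4.trans ht)] at h2
      exact ⟨h2, h4⟩
    · rintro ⟨h2, h3⟩
      rw [h.commit_eq (h3.trans ht)]
      exact ⟨h2, h3⟩
  · simp only [Finset.mem_filter, Finset.mem_univ, true_and] at hv
    rw [h.path_eq ht, h.path_eq (hv.2.trans ht), h.W_eq (hv.2.trans ht)]

lemma Agree.Om_eq (h : Agree m π π') {τ : ℝ} (hτ : τ ≤ A.S.start π m) :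
    A.Om π' τ = A.Om π τ := by
  rw [Om, Om, h.below_eq hτ]
  congr 1
  refine Finset.sum_congr rfl fun v hv => ?_
  rw [mem_below] at hv
  rw [h.eps_eq (by linarith)]

end AsyncRun

/-! ### Indicators and integer indices -/

section Indicator

open Classical in
/-- The indicator of a proposition. -/
def ind (p : Prop) : ℝ := if p then 1 else 0

lemma ind_nonneg (p : Prop) : 0 ≤ ind p := by unfold ind; split_ifs <;> norm_num
lemma ind_le_one (p : Prop) : ind p ≤ 1 := by unfold ind; split_ifs <;> norm_num
lemma ind_of {p : Prop} (h : p) : ind p = 1 := by simp [ind, h]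
lemma ind_of_not {p : Prop} (h : ¬p) : ind p = 0 := by simp [ind, h]
lemma of_ind_ne_zero {p : Prop} (h : ind p ≠ 0) : p := by
  by_contra hp; exact h (ind_of_not hp)

end Indicator

section Extension
variable {T : ℕ} {α : Type*}

/-- Extension of a sequence to integer indices. -/
def zx (d : α) (h : Fin T → α) (s : ℤ) : α :=
  if hs : 0 ≤ s ∧ s < T then h ⟨s.toNat, by omega⟩ else d

@[simp] lemma zx_coe (d : α) (h : Fin T → α) (i : Fin T) : zx d h (i : ℕ) = h i := by
  have : (0 : ℤ) ≤ (i : ℕ) ∧ ((i : ℕ) : ℤ) < T := by constructor <;> omega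
  simp [zx]

lemma zx_of_not (d : α) (h : Fin T → α) {s : ℤ} (hs : ¬(0 ≤ s ∧ s < T)) : zx d h s = d := by
  simp only [zx, dif_neg hs]

lemma index_cases (T : ℕ) (s : ℤ) : (∃ i : Fin T, s = ((i : ℕ) : ℤ)) ∨ ¬(0 ≤ s ∧ s < T) := by
  by_cases h : 0 ≤ s ∧ s < T
  · exact Or.inl ⟨⟨s.toNat, by omega⟩, by simp; omega⟩
  · exact Or.inr h

lemma zx_nonneg {h : Fin T → ℝ} (hh : ∀ i, 0 ≤ h i) (s : ℤ) : 0 ≤ zx 0 h s := by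
  unfold zx; split_ifs
  · exact hh _
  · exact le_rfl

/-- The range of indices. -/
abbrev rng (T : ℕ) : Finset ℤ := Finset.Ico 0 (T : ℤ)

lemma sum_zx (h : Fin T → ℝ) : ∑ s ∈ rng T, zx 0 h s = ∑ i, h i := by
  symm
  refine Finset.sum_bij (fun i _ => ((i : ℕ) : ℤ)) ?_ ?_ ?_ ?_
  · intro i _; simp
  · intro i _ j _ hij; exact Fin.ext (by exact_mod_cast hij)
  · intro s hs
    rcases index_cases T s with ⟨i, rfl⟩ | h
    · exact ⟨i, Finset.mem_univ _, rfl⟩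
    · exact absurd (by simpa using hs) h
  · intro i _; rw [zx_coe]

/-- Reindexing of a double family along a diagonal. -/
lemma sum_shift_le {g : ℤ → ℤ → ℝ} (h0 : ∀ s w, 0 ≤ g s w) (hz : ∀ s w, w ∉ rng T → g s w = 0)
    (j : ℤ) : ∑ s ∈ rng T, g s (s + j) ≤ ∑ w ∈ rng T, g (w - j) w := by
  calc ∑ s ∈ rng T, g s (s + j) = ∑ s ∈ rng T with s + j ∈ rng T, g s (s + j) := by
        rw [Finset.sum_filter]
        refine Finset.sum_congr rfl fun s _ => ?_
        split_ifs with h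
        · rfl
        · exact hz _ _ h
    _ = ∑ w ∈ ((rng T).filter fun s => s + j ∈ rng T).image (· + j), g (w - j) w := by
        rw [Finset.sum_image (fun a _ b _ h => by simpa using h)]
        exact Finset.sum_congr rfl fun s _ => by rw [add_sub_cancel_right]
    _ ≤ _ := by
        refine Finset.sum_le_sum_of_subset_of_nonneg ?_ fun _ _ _ => h0 _ _
        intro w hw
        obtain ⟨s, hs, rfl⟩ := Finset.mem_image.1 hw
        exact (Finset.mem_filter.1 hs).2

/-- Passage from sums over updates v to sums over offsets v - s, which later allow a translation of
the root. Distinct updates have distinct offsets, and the unused offsets only add nonnegative terms.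
-/
lemma sum_fin_le {P : Fin T → Prop} [DecidablePred P] {h : Fin T → ℝ} {H : ℤ → ℝ} {s : ℤ}
    {J : Finset ℤ} (hH : ∀ w, 0 ≤ H w) (hJ : ∀ v, P v → ((v : ℕ) : ℤ) - s ∈ J)
    (hle : ∀ v, P v → h v ≤ H (v : ℕ)) : ∑ v with P v, h v ≤ ∑ j ∈ J, H (s + j) := by
  calc ∑ v with P v, h v ≤ ∑ v with P v, H (s + (((v : ℕ) : ℤ) - s)) := by
        refine Finset.sum_le_sum fun v hv => ?_
        rw [add_sub_cancel]
        exact hle v (Finset.mem_filter.1 hv).2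
    _ = ∑ j ∈ (Finset.univ.filter P).image (fun v : Fin T => ((v : ℕ) : ℤ) - s), H (s + j) := by
        rw [Finset.sum_image]
        intro a _ b _ hab
        simp only [sub_left_inj, Nat.cast_inj] at hab
        exact Fin.ext hab
    _ ≤ _ := by
        refine Finset.sum_le_sum_of_subset_of_nonneg ?_ fun _ _ _ => hH _
        intro j hj
        obtain ⟨v, hv, rfl⟩ := Finset.mem_image.1 hj
        exact hJ v (Finset.mem_filter.1 hv).2

end Extension

/-! ### Expectations, means over single picks, normalized kernels -/

section Expectation
variable {n T : ℕ}

/-- Expectation over the uniformly random path. -/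
def Ex (X : Path n T → ℝ) : ℝ := 𝔼 π, X π

lemma Ex_add (X Y : Path n T → ℝ) : Ex (fun π => X π + Y π) = Ex X + Ex Y :=
  Finset.expect_add_distrib _ _ _

lemma Ex_sub (X Y : Path n T → ℝ) : Ex (fun π => X π - Y π) = Ex X - Ex Y :=
  Finset.expect_sub_distrib _ _ _

lemma Ex_sum {ι : Type*} (s : Finset ι) (X : ι → Path n T → ℝ) :
    Ex (fun π => ∑ i ∈ s, X i π) = ∑ i ∈ s, Ex (X i) :=
  Finset.expect_sum_comm _ _ _

lemma Ex_mul (c : ℝ) (X : Path n T → ℝ) : Ex (fun π => c * X π) = c * Ex X :=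
  (Finset.mul_expect _ _ _).symm

lemma Ex_mono {X Y : Path n T → ℝ} (h : ∀ π, X π ≤ Y π) : Ex X ≤ Ex Y :=
  Finset.expect_le_expect fun π _ => h π

lemma Ex_nonneg {X : Path n T → ℝ} (h : ∀ π, 0 ≤ X π) : 0 ≤ Ex X :=
  Finset.expect_nonneg fun π _ => h π

lemma Ex_const [NeZero n] (c : ℝ) : Ex (fun _ : Path n T => c) = c :=
  Finset.expect_const Finset.univ_nonempty c

lemma Ex_zero : Ex (fun _ : Path n T => (0 : ℝ)) = 0 := by simp [Ex]

/-- Replacement of the pick with a given index. -/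
def upd (π : Path n T) (i : ℤ) (k : Fin n) : Path n T :=
  fun j => if ((j : ℕ) : ℤ) = i then k else π j

/-- Mean over one pick. -/
def av (i : ℤ) (X : Path n T → ℝ) (π : Path n T) : ℝ := (1 / n : ℝ) * ∑ k, X (upd π i k)

/-- Independence of a quantity from one pick. -/
def Free (i : ℤ) (X : Path n T → ℝ) : Prop := ∀ π k, X (upd π i k) = X π

lemma upd_of_not {i : ℤ} (h : ¬(0 ≤ i ∧ i < T)) (π : Path n T) (k : Fin n) : upd π i k = π := by
  ext j
  simp only [upd]
  rw [if_neg]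
  rintro rfl
  exact h ⟨by omega, by omega⟩

lemma upd_coe (i : Fin T) (π : Path n T) (k : Fin n) :
    upd π (i : ℕ) k = Function.update π i k := by
  ext j
  simp only [upd, Function.update_apply, Nat.cast_inj, Fin.ext_iff]

lemma Ex_eq_sum (X : Path n T → ℝ) :
    Ex X = (∑ π, X π) / (Fintype.card (Path n T) : ℝ) := by
  rw [Ex, Fintype.expect_eq_sum_div_card]

lemma av_mono {i : ℤ} {X Y : Path n T → ℝ} (h : ∀ π, X π ≤ Y π) (π : Path n T) :
    av i X π ≤ av i Y π :=
  mul_le_mul_of_nonneg_left (Finset.sum_le_sum fun _ _ => h _) (by positivity)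

lemma av_mul_free {i : ℤ} {X Y : Path n T → ℝ} (h : Free i Y) (π : Path n T) :
    av i (fun π => X π * Y π) π = av i X π * Y π := by
  simp only [av, h π _, ← Finset.sum_mul, mul_assoc]

lemma av_of_not [NeZero n] {i : ℤ} (h : ¬(0 ≤ i ∧ i < T)) (X : Path n T → ℝ) (π : Path n T) :
    av i X π = X π := by
  have hn : (n : ℝ) ≠ 0 := by exact_mod_cast NeZero.ne n
  simp only [av, upd_of_not h, Finset.sum_const, Finset.card_univ, Fintype.card_fin, nsmul_eq_mul]
  field_simp

lemma Ex_av [NeZero n] (i : ℤ) (X : Path n T → ℝ) : Ex (av i X) = Ex X := by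
  have hn : (n : ℝ) ≠ 0 := by exact_mod_cast NeZero.ne n
  rcases index_cases T i with ⟨i, rfl⟩ | h
  · have key : ∑ π : Path n T, ∑ k, X (upd π (i : ℕ) k) = n * ∑ π, X π := by
      -- Exchanging the i-th pick with a fresh independent pick is an involution, so resampling
      -- preserves the uniform measure.
      let e : Path n T × Fin n ≃ Path n T × Fin n :=
        { toFun := fun p => (Function.update p.1 i p.2, p.1 i)
          invFun := fun p => (Function.update p.1 i p.2, p.1 i)
          left_inv := fun p => by simp
          right_inv := fun p => by simp }
      calc ∑ π : Path n T, ∑ k, X (upd π (i : ℕ) k)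
          = ∑ p : Path n T × Fin n, X (e p).1 := by
            rw [Fintype.sum_prod_type]
            simp only [upd_coe]
            rfl
        _ = ∑ p : Path n T × Fin n, X p.1 := Equiv.sum_comp e (fun p => X p.1)
        _ = _ := by
            rw [Fintype.sum_prod_type]
            simp [Finset.mul_sum]
    rw [Ex_eq_sum, Ex_eq_sum]
    congr 1
    simp only [av]
    rw [← Finset.mul_sum, key]
    field_simp
  · congr 1
    ext π
    exact av_of_not h X π

/-- Iterated mean over a list of picks; the head of the list is averaged last. -/
def avL : List ℤ → (Path n T → ℝ) → Path n T → ℝ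
  | [], X => X
  | d :: D, X => av d (avL D X)

lemma avL_mono {D : List ℤ} {X Y : Path n T → ℝ} (h : ∀ π, X π ≤ Y π) (π : Path n T) :
    avL D X π ≤ avL D Y π := by
  induction D generalizing π with
  | nil => exact h π
  | cons d D ih => exact av_mono ih π

lemma avL_mul_free {D : List ℤ} {X Y : Path n T → ℝ} (h : ∀ d ∈ D, Free d Y) (π : Path n T) :
    avL D (fun π => X π * Y π) π = avL D X π * Y π := by
  induction D generalizing π with
  | nil => rfl
  | cons d D ih =>
    have h1 : avL D (fun π => X π * Y π) = fun π => avL D X π * Y π :=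
      funext fun π => ih (fun d hd => h d (List.mem_cons_of_mem _ hd)) π
    simp only [avL]
    rw [h1, av_mul_free (h d List.mem_cons_self)]

lemma Ex_avL [NeZero n] (D : List ℤ) (X : Path n T → ℝ) : Ex (avL D X) = Ex X := by
  induction D with
  | nil => rfl
  | cons d D ih => simp only [avL]; rw [Ex_av, ih]

lemma avL_zero (D : List ℤ) (π : Path n T) : avL D (fun _ => 0) π = 0 := by
  induction D generalizing π with
  | nil => rfl
  | cons d D ih =>
    simp only [avL]
    have : avL D (fun _ : Path n T => (0 : ℝ)) = fun _ => 0 := funext ih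
    rw [this]; simp [av]

/-- A nonnegative factor whose mean over the picks in `D` is at most one. -/
def MeanLe (D : List ℤ) (K : Path n T → ℝ) : Prop := (∀ π, 0 ≤ K π) ∧ ∀ π, avL D K π ≤ 1

lemma MeanLe.of_eq_zero {D : List ℤ} {K : Path n T → ℝ} (h : ∀ π, K π = 0) : MeanLe D K := by
  have : K = fun _ => 0 := funext h
  subst this
  exact ⟨fun _ => le_rfl, fun π => by rw [avL_zero]; exact zero_le_one⟩

lemma MeanLe.mono {D : List ℤ} {K K' : Path n T → ℝ} (h : MeanLe D K) (h0 : ∀ π, 0 ≤ K' π)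
    (hle : ∀ π, K' π ≤ K π) : MeanLe D K' :=
  ⟨h0, fun π => (avL_mono hle π).trans (h.2 π)⟩

/-- The new factor is free of the old picks, so the inner means see only K and contribute at most 1.
The outer mean over x then sees g alone. -/
lemma MeanLe.mul {D : List ℤ} {K g : Path n T → ℝ} (h : MeanLe D K) {x : ℤ}
    (hg : ∀ π, 0 ≤ g π) (hf : ∀ d ∈ D, Free d g) (hx : ∀ π, av x g π ≤ 1) :
    MeanLe (x :: D) (fun π => K π * g π) := by
  refine ⟨fun π => mul_nonneg (h.1 π) (hg π), fun π => ?_⟩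
  refine le_trans (av_mono (Y := g) (fun π => ?_) π) (hx π)
  rw [avL_mul_free hf]
  exact mul_le_of_le_one_left (hg π) (h.2 π)

/-- Adding a leaf, when the new kernel vanishes unless a static condition `p` holds. -/
lemma MeanLe.cons {D : List ℤ} {K K' g : Path n T → ℝ} {p : Prop} (h : MeanLe D K) {x : ℤ}
    (h0 : ∀ π, 0 ≤ K' π) (hle : ∀ π, K' π ≤ K π * g π) (hp : ∀ π, K' π ≠ 0 → p)
    (hg : p → (∀ π, 0 ≤ g π) ∧ (∀ d ∈ D, Free d g) ∧ ∀ π, av x g π ≤ 1) :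
    MeanLe (x :: D) K' := by
  -- p does not depend on the path: either the independence needed for the product holds on all
  -- paths, or the kernel vanishes identically.
  by_cases hpp : p
  · obtain ⟨h1, h2, h3⟩ := hg hpp
    exact (h.mul h1 h2 h3).mono h0 hle
  · refine MeanLe.of_eq_zero fun π => ?_
    by_contra hc
    exact hpp (hp π hc)

lemma MeanLe.Ex_mul_le [NeZero n] {D : List ℤ} {K g : Path n T → ℝ} (h : MeanLe D K)
    (hg : ∀ π, 0 ≤ g π) (hf : ∀ d ∈ D, Free d g) : Ex (fun π => K π * g π) ≤ Ex g := by
  rw [← Ex_avL D]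
  refine Ex_mono fun π => ?_
  rw [avL_mul_free hf]
  exact mul_le_of_le_one_left (hg π) (h.2 π)

end Expectation

/-! ### The quantities of a run as random variables with integer indices -/

namespace AsyncRun
variable {n T q : ℕ} (A : AsyncRun n T q)

lemma neZero (A : AsyncRun n T q) : NeZero n := ⟨A.n_pos.ne'⟩

/-- The coordinate picked by an update. -/
def pk (π : Path n T) (s : ℤ) : Fin n := zx ⟨0, A.n_pos⟩ π s

def Wz (π : Path n T) (s : ℤ) : ℝ := zx 0 (A.W π) s
def ez (π : Path n T) (s : ℤ) : ℝ := zx 0 (A.eps π) s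
/-- The value of the best step along a coordinate at the start of an update. -/
def Vz (π : Path n T) (s : ℤ) (k : Fin n) : ℝ := zx 0 (fun t => A.V (A.z π t) k) s
def Vb (π : Path n T) (s : ℤ) : ℝ := zx 0 (fun t => A.Vbar (A.z π t)) s
/-- Accumulated errors at the commit of an update. -/
def Oc (π : Path n T) (s : ℤ) : ℝ := zx 0 (fun t => A.Om π (A.S.commit π t)) s
/-- Accumulated errors at the start of an update. -/
def Os (π : Path n T) (s : ℤ) : ℝ := zx 0 (fun t => A.Om π (A.S.start π t)) s

/-- The update `s` commits before the update `t`. -/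
def prec (π : Path n T) (s t : ℤ) : Prop :=
  ∃ i k : Fin T, s = (i : ℕ) ∧ t = (k : ℕ) ∧ A.S.commit π i < A.S.commit π k

/-- The update `x` does not commit before the start of update `r`. -/
def after (π : Path n T) (r x : ℤ) : Prop :=
  ∃ i k : Fin T, r = (i : ℕ) ∧ x = (k : ℕ) ∧ A.S.start π i ≤ A.S.commit π k

variable {A}

lemma coe_inj {i k : Fin T} : ((i : ℕ) : ℤ) = (k : ℕ) ↔ i = k := by
  rw [Nat.cast_inj, Fin.ext_iff]

lemma prec_coe {π : Path n T} {i k : Fin T} :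
    A.prec π (i : ℕ) (k : ℕ) ↔ A.S.commit π i < A.S.commit π k := by
  constructor
  · rintro ⟨i', k', h1, h2, h⟩
    rw [coe_inj] at h1 h2
    subst h1 h2
    exact h
  · exact fun h => ⟨i, k, rfl, rfl, h⟩

lemma prec.trans {π : Path n T} {s t u : ℤ} (h : A.prec π s t) (h' : A.prec π t u) :
    A.prec π s u := by
  obtain ⟨i, k, rfl, rfl, h1⟩ := h
  obtain ⟨k', l, h2, rfl, h3⟩ := h'
  rw [coe_inj] at h2
  subst h2
  exact ⟨i, l, rfl, rfl, h1.trans h3⟩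

lemma prec.ne {π : Path n T} {s t : ℤ} (h : A.prec π s t) : s ≠ t := by
  obtain ⟨i, k, rfl, rfl, h1⟩ := h
  intro h
  rw [coe_inj] at h
  subst h
  exact lt_irrefl _ h1

lemma prec.left_mem {π : Path n T} {s t : ℤ} (h : A.prec π s t) : 0 ≤ s ∧ s < T := by
  obtain ⟨i, k, rfl, rfl, h1⟩ := h
  constructor <;> omega

lemma prec.right_mem {π : Path n T} {s t : ℤ} (h : A.prec π s t) : 0 ≤ t ∧ t < T := by
  obtain ⟨i, k, rfl, rfl, h1⟩ := h
  constructor <;> omega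

lemma prec.le_add {π : Path n T} {s t : ℤ} (h : A.prec π s t) : s ≤ t + q := by
  obtain ⟨i, k, rfl, rfl, h1⟩ := h
  have := A.le_add_of_commit_lt h1
  omega

lemma prec_or {π : Path n T} {s t : ℤ} (hs : 0 ≤ s ∧ s < T) (ht : 0 ≤ t ∧ t < T) (h : s ≠ t) :
    A.prec π s t ∨ A.prec π t s := by
  rcases index_cases T s with ⟨i, rfl⟩ | h1
  · rcases index_cases T t with ⟨k, rfl⟩ | h2
    · rw [prec_coe, prec_coe]
      refine lt_or_gt_of_ne fun hc => h ?_
      rw [A.valid.commit_injective π hc]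
    · exact absurd ht h2
  · exact absurd hs h1

variable (A)

lemma Wz_nonneg (π : Path n T) (s : ℤ) : 0 ≤ A.Wz π s := zx_nonneg (A.W_nonneg π) s
lemma Vz_nonneg (π : Path n T) (s : ℤ) (k : Fin n) : 0 ≤ A.Vz π s k :=
  zx_nonneg (fun _ => A.V_nonneg _ _) s
lemma Vb_nonneg (π : Path n T) (s : ℤ) : 0 ≤ A.Vb π s := zx_nonneg (fun _ => A.Vbar_nonneg _) s
lemma Oc_nonneg (π : Path n T) (s : ℤ) : 0 ≤ A.Oc π s := zx_nonneg (fun _ => A.Om_nonneg _ _) s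
lemma Os_nonneg (π : Path n T) (s : ℤ) : 0 ≤ A.Os π s := zx_nonneg (fun _ => A.Om_nonneg _ _) s

lemma Wz_of_notMem (π : Path n T) {s : ℤ} (h : s ∉ rng T) : A.Wz π s = 0 :=
  zx_of_not _ _ (by simpa using h)

lemma Vb_eq (π : Path n T) (s : ℤ) : A.Vb π s = (1 / n : ℝ) * ∑ k, A.Vz π s k := by
  rcases index_cases T s with ⟨i, rfl⟩ | h
  · simp [Vb, Vz, Composite.Vbar]
  · simp [Vb, Vz, zx_of_not _ _ h]

/-- The upper bound of the mean value of the best steps. -/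
def om : ℝ := max (1 / (n : ℝ)) (√A.rho)

lemma Vb_le (π : Path n T) (s : ℤ) : A.Vb π s ≤ A.om * A.Os π s := by
  have hom : 0 ≤ A.om := le_max_of_le_right (Real.sqrt_nonneg _)
  rcases index_cases T s with ⟨i, rfl⟩ | h
  · simp only [Vb, Os, zx_coe]
    exact (A.Vbar_le _).trans (mul_le_mul_of_nonneg_left (A.F_mem_le_Om π _) hom)
  · simp [Vb, Os, zx_of_not _ _ h]

lemma Vz_eq_zero_of (π : Path n T) {s : ℤ} (h : A.Vb π s = 0) (k : Fin n) : A.Vz π s k = 0 := by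
  rw [Vb_eq] at h
  have hn := A.n_cast_pos
  have h1 : ∑ k, A.Vz π s k = 0 := by
    rcases mul_eq_zero.1 h with h2 | h2
    · exact absurd h2 (by positivity)
    · exact h2
  exact (Finset.sum_eq_zero_iff_of_nonneg fun k _ => A.Vz_nonneg π s k).1 h1 k (Finset.mem_univ k)

lemma pk_upd_of_ne {s i : ℤ} (h : s ≠ i) (π : Path n T) (k : Fin n) :
    A.pk (upd π i k) s = A.pk π s := by
  rcases index_cases T s with ⟨t, rfl⟩ | hs
  · simp only [pk, zx_coe, upd, if_neg h]
  · simp [pk, zx_of_not _ _ hs]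

lemma pk_upd_self {i : ℤ} (hi : 0 ≤ i ∧ i < T) (π : Path n T) (k : Fin n) :
    A.pk (upd π i k) i = k := by
  rcases index_cases T i with ⟨t, rfl⟩ | hs
  · simp [pk, upd]
  · exact absurd hi hs

lemma agree_upd {m : Fin T} {i : ℤ} (h : ((m : ℕ) : ℤ) ≤ i) (π : Path n T) (k : Fin n) :
    Agree m π (upd π i k) := by
  intro j hj
  rw [Fin.lt_def] at hj
  simp only [upd]
  rw [if_neg]
  omega

/-- The memory at the start of r is determined by the picks before r (`Agree.z_eq`). -/
lemma free_Vz {r i : ℤ} (h : r ≤ i) (k : Fin n) : Free i fun π => A.Vz π r k := by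
  intro π k'
  rcases index_cases T r with ⟨t, rfl⟩ | hs
  · simp only [Vz, zx_coe, (agree_upd h π k').z_eq]
  · simp [Vz, zx_of_not _ _ hs]

lemma free_Vb {r i : ℤ} (h : r ≤ i) : Free i fun π => A.Vb π r := by
  intro π k'
  simp only [Vb_eq]
  congr 1
  exact Finset.sum_congr rfl fun k _ => A.free_Vz h k π k'

lemma free_Os {r i : ℤ} (h : r ≤ i) : Free i fun π => A.Os π r := by
  intro π k'
  rcases index_cases T r with ⟨t, rfl⟩ | hs
  · simp only [Os, zx_coe, (agree_upd h π k').start_eq, (agree_upd h π k').Om_eq le_rfl]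
  · simp [Os, zx_of_not _ _ hs]

lemma free_Vz_pk {r s i : ℤ} (h : r ≤ i) (hs : s ≠ i) : Free i fun π => A.Vz π r (A.pk π s) := by
  intro π k'
  simp only [A.pk_upd_of_ne hs]
  exact A.free_Vz h _ π k'

lemma av_Vz_pk {r s : ℤ} (h : r ≤ s) (hs : 0 ≤ s ∧ s < T) (π : Path n T) :
    av s (fun π => A.Vz π r (A.pk π s)) π = A.Vb π r := by
  simp only [av, Vb_eq, A.pk_upd_self hs]
  congr 1
  exact Finset.sum_congr rfl fun k _ => A.free_Vz h k π k

end AsyncRun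

/-! ### The propagation inequality in terms of normalized kernels -/

namespace AsyncRun
variable {n T q : ℕ} (A : AsyncRun n T q)

/-- Nonzero offsets between `-a` and `b`. -/
def offs (a b : ℕ) : Finset ℤ := (Finset.Icc (-(a : ℤ)) b).erase 0

lemma mem_offs {a b : ℕ} {j : ℤ} : j ∈ offs a b ↔ j ≠ 0 ∧ -(a : ℤ) ≤ j ∧ j ≤ b := by
  simp [offs]

lemma card_offs (a b : ℕ) : (offs a b).card = a + b := by
  rw [offs, Finset.card_erase_of_mem (by simp), Int.card_Icc]
  omega

/-- The step-size condition squared: 640 = (8√10)², and √(n - q) ≤ √n. -/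
lemma q_sq_rho_le : (q : ℝ) ^ 2 * A.rho ≤ 1 / 640 := by
  have hn := A.n_cast_pos
  have hΓ := A.Γ_pos
  have hL : 0 ≤ Lres A.L := Real.iSup_nonneg fun j => Real.sqrt_nonneg _
  have h1 : (q : ℝ) * (8 * √10 * Lres A.L) ≤ A.Γ * √n :=
    A.q_lip.trans (mul_le_mul_of_nonneg_left (Real.sqrt_le_sqrt (by simp)) hΓ.le)
  have h2 := pow_le_pow_left₀ (by positivity) h1 2
  have h3 : (A.Γ * √n) ^ 2 = A.Γ ^ 2 * n := by rw [mul_pow, Real.sq_sqrt hn.le]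
  have h4 : ((q : ℝ) * (8 * √10 * Lres A.L)) ^ 2 = 640 * (q ^ 2 * Lres A.L ^ 2) := by
    rw [mul_pow, mul_pow, mul_pow, Real.sq_sqrt (by norm_num)]; ring
  rw [h3, h4] at h2
  unfold Composite.rho
  rw [← mul_div_assoc, div_le_iff₀ (by positivity)]
  linarith

/-- Bound for the mean square interaction. -/
def rbar (q : ℕ) : ℝ := 1 / (640 * (q : ℝ) ^ 2)

lemma rbar_pos (hq : 0 < q) : 0 < rbar q := by unfold rbar; positivity

lemma rho_le (hq : 0 < q) : A.rho ≤ rbar q := by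
  have h := A.q_sq_rho_le
  have hq' : (0 : ℝ) < q := by exact_mod_cast hq
  unfold rbar
  rw [le_div_iff₀ (by positivity)]
  linarith

lemma nu_le (A : AsyncRun n T q) : (q : ℝ) / n ≤ 9 / 100 := by
  rw [div_le_iff₀ A.n_cast_pos]; exact A.q_le

/-- Kernel forcing the equality of two picks. -/
def Gc (a b : Fin n) : ℝ := if a = b then n else 0

/-- Normalized square interaction of two picks. -/
def Gg (a b : Fin n) : ℝ := A.ell a b ^ 2 / rbar q

lemma Gc_nonneg (a b : Fin n) : 0 ≤ Gc a b := by unfold Gc; split_ifs <;> positivity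

lemma Gg_nonneg (a b : Fin n) : 0 ≤ A.Gg a b := by unfold Gg rbar; positivity

lemma mean_Gc (a : Fin n) : (1 / n : ℝ) * ∑ b, Gc a b ≤ 1 := by
  have : (0 : ℝ) < n := by exact_mod_cast a.pos
  simp [Gc, this.ne']

lemma mean_Gg (hq : 0 < q) (a : Fin n) : (1 / n : ℝ) * ∑ b, A.Gg a b ≤ 1 := by
  have hn := A.n_cast_pos
  have h1 := A.sum_ell_sq_le a
  have h2 := A.rho_le hq
  have h3 := rbar_pos hq
  simp only [Gg, ← Finset.sum_div]
  rw [← mul_div_assoc, div_le_one h3]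
  calc (1 / n : ℝ) * ∑ b, A.ell a b ^ 2 ≤ (1 / n) * (n * A.rho) :=
        mul_le_mul_of_nonneg_left h1 (by positivity)
    _ = A.rho := by field_simp
    _ ≤ _ := h2

/-- The contribution of offset `j` to the propagation inequality at `s`. -/
def edge (G : Fin n → Fin n → ℝ) (π : Path n T) (s w : ℤ) : ℝ :=
  G (A.pk π w) (A.pk π s) * ind (A.prec π w s) * A.Wz π w

variable {A} in
lemma edge_nonneg {G : Fin n → Fin n → ℝ} (hG : ∀ a b, 0 ≤ G a b) (π : Path n T) (s w : ℤ) :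
    0 ≤ A.edge G π s w :=
  mul_nonneg (mul_nonneg (hG _ _) (ind_nonneg _)) (A.Wz_nonneg _ _)

/-- The upper bound provided by the propagation inequality. -/
def Rz (π : Path n T) (r s : ℤ) : ℝ :=
  13 / 10 * A.Vz π r (A.pk π s) + 13 / 10 / n * ∑ j ∈ offs (2 * q) q, A.edge Gc π s (s + j) +
    52 / 3 * q * rbar q * ∑ j ∈ offs (3 * q) q, A.edge A.Gg π s (s + j)

/-- (√Y + S)² ≤ 13/10·Y + 13/3·S² by Young's inequality, and Cauchy–Schwarz over at most N terms for
S². -/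
lemma le_of_sqrt_le {ι : Type*} {X Y : ℝ} (hX : 0 ≤ X) (hY : 0 ≤ Y) (s : Finset ι) (a w : ι → ℝ)
    (hw : ∀ i ∈ s, 0 ≤ w i) {N : ℝ} (hN : (s.card : ℝ) ≤ N)
    (h : √X ≤ √Y + ∑ i ∈ s, a i * √(w i)) (ha : ∀ i ∈ s, 0 ≤ a i) :
    X ≤ 13 / 10 * Y + 13 / 3 * (N * ∑ i ∈ s, a i ^ 2 * w i) := by
  set S := ∑ i ∈ s, a i * √(w i) with hS
  have hS0 : 0 ≤ S := Finset.sum_nonneg fun i hi => mul_nonneg (ha i hi) (Real.sqrt_nonneg _)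
  have h1 : S ^ 2 ≤ N * ∑ i ∈ s, a i ^ 2 * w i := by
    have h2 := sq_sum_le_card_mul_sum_sq (s := s) (f := fun i => a i * √(w i))
    have h3 : ∑ i ∈ s, (a i * √(w i)) ^ 2 = ∑ i ∈ s, a i ^ 2 * w i :=
      Finset.sum_congr rfl fun i hi => by rw [mul_pow, Real.sq_sqrt (hw i hi)]
    rw [h3] at h2
    refine h2.trans (mul_le_mul_of_nonneg_right hN ?_)
    exact Finset.sum_nonneg fun i hi => mul_nonneg (sq_nonneg _) (hw i hi)
  have h4 : X ≤ (√Y + S) ^ 2 := by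
    rw [← Real.sq_sqrt hX]
    exact pow_le_pow_left₀ (Real.sqrt_nonneg _) h 2
  have h5 := Real.sq_sqrt hY
  nlinarith [sq_nonneg (3 * √Y - 10 * S)]

/-- The square of `sqrt_proxMax_le_sum`, written in offsets. Collisions enter linearly, with factor
1/n because `Gc` is normalized to the value n. Interactions run over at most 4q offsets, whence 52/3
= 13/3·4. The freedom in τ and p serves both for W at a commit and for V at the start of another
update. -/
lemma le_Rz_of_times (π : Path n T) {s r : Fin T} (hrs : r ≤ s) (hsr : (s : ℕ) ≤ r + q)
    {τ : ℝ} (hrτ : A.S.start π r ≤ τ) (hτs : τ ≤ A.S.commit π s)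
    {p : Pt n} {t : Fin n → ℝ} (hp : ∀ j, p j = A.mem π (t j) j)
    (ht : ∀ j, t j ∈ Set.Icc (A.S.start π r) τ) :
    proxMax A.Γ (A.Ψ (π s)) (A.g p (π s)) (A.mem π τ (π s)) ≤ A.Rz π (r : ℕ) (s : ℕ) := by
  have h := A.sqrt_proxMax_le_sum π hsr hrτ hp ht
  have hrs' : (r : ℕ) ≤ s := hrs
  have hn := A.n_cast_pos
  have hS : ∀ v : Fin T, (s : ℕ) ≤ Fin.val v + 3 * q ∧ A.S.commit π v < τ →
      ((v : ℕ) : ℤ) - (s : ℕ) ∈ offs (3 * q) q := by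
    rintro v ⟨h1, h2⟩
    have h3 := A.le_add_of_commit_lt (h2.trans_le hτs)
    have h4 : v ≠ s := by rintro rfl; linarith
    have h5 : (v : ℕ) ≠ s := fun hc => h4 (Fin.ext hc)
    rw [mem_offs]
    omega
  have hcard : ((Finset.univ.filter fun v : Fin T => (s : ℕ) ≤ Fin.val v + 3 * q ∧
      A.S.commit π v < τ).card : ℝ) ≤ 4 * q := by
    have h1 : (Finset.univ.filter fun v : Fin T => (s : ℕ) ≤ Fin.val v + 3 * q ∧
      A.S.commit π v < τ).card ≤ (offs (3 * q) q).card := by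
      refine Finset.card_le_card_of_injOn (fun v : Fin T => ((v : ℕ) : ℤ) - (s : ℕ))
        (fun v hv => hS v (by simpa using hv)) ?_
      intro a _ b _ hab
      simp only [sub_left_inj, Nat.cast_inj] at hab
      exact Fin.ext hab
    rw [card_offs] at h1
    have : ((3 * q + q : ℕ) : ℝ) = 4 * q := by push_cast; ring
    rw [← this]
    exact_mod_cast h1
  have h1 := le_of_sqrt_le (proxMax_nonneg (A.convexΨ _) A.Γ_pos _ _)
    (add_nonneg (A.V_nonneg _ _) (Finset.sum_nonneg fun w _ => A.W_nonneg π w)) _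
    (fun v => A.ell (π v) (π s)) (fun v => A.W π v)
    (fun v _ => A.W_nonneg π v) hcard h (fun v _ => A.ell_nonneg _ _)
  refine h1.trans ?_
  have hc : ∑ w with π w = π s ∧ A.S.start π r ≤ A.S.commit π w ∧ A.S.commit π w < τ, A.W π w ≤
      ∑ j ∈ offs (2 * q) q, 1 / n * A.edge Gc π (s : ℕ) ((s : ℕ) + j) := by
    refine sum_fin_le (H := fun w => 1 / n * A.edge Gc π (s : ℕ) w)
      (fun w => mul_nonneg (by positivity) (edge_nonneg Gc_nonneg _ _ _)) ?_ ?_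
    · rintro v ⟨h1, h2, h3⟩
      have h4 := A.le_add_of_commit_lt (h3.trans_le hτs)
      have h5 := A.le_add_of_start_le h2
      have h6 : v ≠ s := by rintro rfl; linarith
      have h7 : (v : ℕ) ≠ s := fun hc => h6 (Fin.ext hc)
      rw [mem_offs]
      omega
    · rintro v ⟨h1, h2, h3⟩
      have : A.prec π (v : ℕ) (s : ℕ) := prec_coe.2 (h3.trans_le hτs)
      simp only [edge, pk, Wz, zx_coe, ind_of this, Gc, if_pos h1]
      rw [mul_one, ← mul_assoc, one_div_mul_cancel hn.ne', one_mul]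
  have hg : ∑ v : Fin T with (s : ℕ) ≤ Fin.val v + 3 * q ∧ A.S.commit π v < τ,
      A.ell (π v) (π s) ^ 2 * A.W π v ≤
      ∑ j ∈ offs (3 * q) q, rbar q * A.edge A.Gg π (s : ℕ) ((s : ℕ) + j) := by
    refine sum_fin_le (H := fun w => rbar q * A.edge A.Gg π (s : ℕ) w)
      (fun w => mul_nonneg (by unfold rbar; positivity) (edge_nonneg A.Gg_nonneg _ _ _)) hS ?_
    rintro v ⟨h1, h2⟩
    have h3 : A.prec π (v : ℕ) (s : ℕ) := prec_coe.2 (h2.trans_le hτs)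
    have h4 := hS v ⟨h1, h2⟩
    have hq : 0 < q := by
      rw [mem_offs] at h4
      omega
    have h5 := rbar_pos hq
    simp only [edge, pk, Wz, zx_coe, ind_of h3, Gg]
    rw [mul_one, ← mul_assoc, mul_div_cancel₀ _ h5.ne']
  rw [← Finset.mul_sum] at hc hg
  have hg' := mul_le_mul_of_nonneg_left hg (show (0 : ℝ) ≤ 13 / 3 * (4 * q) by positivity)
  simp only [Rz, pk, Vz, zx_coe]
  have e : 13 / 10 / (n : ℝ) * ∑ j ∈ offs (2 * q) q, A.edge Gc π (s : ℕ) ((s : ℕ) + j) =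
    13 / 10 * (1 / n * ∑ j ∈ offs (2 * q) q, A.edge Gc π (s : ℕ) ((s : ℕ) + j)) := by ring
  rw [e]
  linarith

lemma Wz_le_Rz (π : Path n T) {s r : ℤ} (hr : 0 ≤ r) (hrs : r ≤ s) (hsr : s ≤ r + q) :
    A.Wz π s ≤ A.Rz π r s := by
  rcases index_cases T s with ⟨s, rfl⟩ | h
  · rcases index_cases T r with ⟨r, rfl⟩ | h'
    · have hrs' : r ≤ s := by rw [Fin.le_def]; omega
      have h1 := (A.valid.start_strictMono π).monotone hrs'
      simp only [Wz, zx_coe]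
      exact A.le_Rz_of_times π hrs' (by omega) (h1.trans (A.start_le_commit π s)) le_rfl
        (fun _ => rfl) (fun j => ⟨h1.trans (A.valid.read_mem π s j).1, (A.valid.read_mem π s j).2⟩)
    · exact absurd ⟨hr, by omega⟩ h'
  · rw [Wz, zx_of_not _ _ h, Rz]
    have hv := A.Vz_nonneg π r (A.pk π s)
    have h1 := Finset.sum_nonneg fun j (_ : j ∈ offs (2 * q) q) =>
      edge_nonneg (A := A) (Gc_nonneg) π s (s + j)
    have h2 := Finset.sum_nonneg fun j (_ : j ∈ offs (3 * q) q) =>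
      edge_nonneg (A := A) (A.Gg_nonneg) π s (s + j)
    have h3 : 0 ≤ rbar q := by unfold rbar; positivity
    positivity

/-- Update v is still pending when u starts, so its propagation bound also applies at that moment.
This handles collisions of u with earlier picks. -/
lemma Vz_le_Rz (π : Path n T) {u v : ℤ} (hvu : v < u) (h : A.after π u v) :
    A.Vz π u (A.pk π v) ≤ A.Rz π v v := by
  obtain ⟨u, v, rfl, rfl, h⟩ := h
  have hvu' : v ≤ u := by rw [Fin.le_def]; omega
  have h1 := (A.valid.start_strictMono π).monotone hvu'
  simp only [Vz, pk, zx_coe]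
  exact A.le_Rz_of_times π le_rfl (by omega) h1 h (fun _ => rfl)
    (fun j => Set.right_mem_Icc.2 h1)

lemma ez_sq_le (π : Path n T) (s : ℤ) :
    A.ez π s ^ 2 ≤ 2 * q * rbar q * ∑ j ∈ offs q q, A.edge A.Gg π s (s + j) := by
  rcases index_cases T s with ⟨s, rfl⟩ | h
  · simp only [ez, zx_coe, eps]
    set P := Finset.univ.filter fun v => A.S.start π s ≤ A.S.commit π v ∧
      A.S.commit π v < A.S.commit π s with hP
    have hS : ∀ v, A.S.start π s ≤ A.S.commit π v ∧ A.S.commit π v < A.S.commit π s →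
        ((v : ℕ) : ℤ) - (s : ℕ) ∈ offs q q := by
      rintro v ⟨h1, h2⟩
      have h3 := A.le_add_of_commit_lt h2
      have h4 := A.le_add_of_start_le h1
      have h5 : v ≠ s := by rintro rfl; linarith
      have h6 : (v : ℕ) ≠ s := fun hc => h5 (Fin.ext hc)
      rw [mem_offs]
      omega
    have hcard : (P.card : ℝ) ≤ 2 * q := by
      have h1 : P.card ≤ (offs q q).card := by
        refine Finset.card_le_card_of_injOn (fun v : Fin T => ((v : ℕ) : ℤ) - (s : ℕ))
          (fun v hv => hS v (by simpa [hP] using hv)) ?_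
        intro a _ b _ hab
        simp only [sub_left_inj, Nat.cast_inj] at hab
        exact Fin.ext hab
      rw [card_offs] at h1
      have : ((q + q : ℕ) : ℝ) = 2 * q := by push_cast; ring
      rw [← this]
      exact_mod_cast h1
    have h2 := sq_sum_le_card_mul_sum_sq (s := P) (f := fun v => A.ell (π v) (π s) * √(A.W π v))
    have h3 : ∑ v ∈ P, (A.ell (π v) (π s) * √(A.W π v)) ^ 2 =
        ∑ v ∈ P, A.ell (π v) (π s) ^ 2 * A.W π v :=
      Finset.sum_congr rfl fun v _ => by rw [mul_pow, Real.sq_sqrt (A.W_nonneg π v)]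
    rw [h3] at h2
    have hg : ∑ v ∈ P, A.ell (π v) (π s) ^ 2 * A.W π v ≤
        ∑ j ∈ offs q q, rbar q * A.edge A.Gg π (s : ℕ) ((s : ℕ) + j) := by
      refine sum_fin_le (H := fun w => rbar q * A.edge A.Gg π (s : ℕ) w)
        (fun w => mul_nonneg (by unfold rbar; positivity) (edge_nonneg A.Gg_nonneg _ _ _)) hS ?_
      rintro v h1
      have h3 : A.prec π (v : ℕ) (s : ℕ) := prec_coe.2 h1.2
      have h4 := hS v h1
      have hq : 0 < q := by
        rw [mem_offs] at h4
        omega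
      have h5 := rbar_pos hq
      simp only [edge, pk, Wz, zx_coe, ind_of h3, Gg]
      rw [mul_one, ← mul_assoc, mul_div_cancel₀ _ h5.ne']
    have h4 : 0 ≤ ∑ v ∈ P, A.ell (π v) (π s) ^ 2 * A.W π v :=
      Finset.sum_nonneg fun v _ => mul_nonneg (sq_nonneg _) (A.W_nonneg π v)
    rw [← Finset.mul_sum] at hg
    calc _ ≤ (P.card : ℝ) * ∑ v ∈ P, A.ell (π v) (π s) ^ 2 * A.W π v := h2
      _ ≤ 2 * q * ∑ v ∈ P, A.ell (π v) (π s) ^ 2 * A.W π v :=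
          mul_le_mul_of_nonneg_right hcard h4
      _ ≤ 2 * q * (rbar q * ∑ j ∈ offs q q, A.edge A.Gg π (s : ℕ) ((s : ℕ) + j)) :=
          mul_le_mul_of_nonneg_left hg (by positivity)
      _ = _ := by ring
  · have h1 := Finset.sum_nonneg fun j (_ : j ∈ offs q q) =>
      edge_nonneg (A := A) (A.Gg_nonneg) π s (s + j)
    have h3 : 0 ≤ rbar q := by unfold rbar; positivity
    rw [ez, zx_of_not _ _ h]
    have : (0 : ℝ) ≤ 2 * q * rbar q * ∑ j ∈ offs q q, A.edge A.Gg π s (s + j) := by positivity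
    simpa using this

/-! ### Kernels with a root and later committed leaves -/

/-- A family of kernels, one for each root, with lists of later leaves, normalized so that their
means over the picks of the leaves are at most one. The earliest index among the root and the
leaves is the root minus `δ`. -/
structure Fam (δ : ℤ) (D : ℤ → List ℤ) (K : ℤ → Path n T → ℝ) : Prop where
  mean : ∀ s, MeanLe (D s) (K s)
  prec : ∀ s π, K s π ≠ 0 → ∀ d ∈ D s, A.prec π s d
  nodup : ∀ s π, K s π ≠ 0 → (D s).Nodup
  δ_nonneg : 0 ≤ δ
  lower : ∀ s, ∀ d ∈ D s, s - δ ≤ d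
  attain : δ = 0 ∨ ∀ s, s - δ ∈ D s

variable {A} {δ : ℤ} {D : ℤ → List ℤ} {K : ℤ → Path n T → ℝ}

lemma Fam.nonneg (h : A.Fam δ D K) (s : ℤ) (π : Path n T) : 0 ≤ K s π := (h.mean s).1 π

lemma Fam.δ_le (h : A.Fam δ D K) {s : ℤ} {π : Path n T} (hK : K s π ≠ 0) : δ ≤ q := by
  rcases h.attain with h1 | h1
  · rw [h1]; positivity
  · have := (h.prec s π hK _ (h1 s)).le_add
    omega

lemma Fam.zero_le (h : A.Fam δ D K) {s : ℤ} {π : Path n T} (hK : K s π ≠ 0) (hs : 0 ≤ s) :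
    0 ≤ s - δ := by
  rcases h.attain with h1 | h1
  · omega
  · exact (h.prec s π hK _ (h1 s)).right_mem.1

lemma Fam.notMem (h : A.Fam δ D K) {s : ℤ} {π : Path n T} (hK : K s π ≠ 0) : s ∉ D s :=
  fun hc => (h.prec s π hK s hc).ne rfl

lemma length_le_of_nodup {l : List ℤ} (h : l.Nodup) (hl : ∀ d ∈ l, 0 ≤ d ∧ d < T) :
    l.length ≤ T := by
  have h1 : l.toFinset ⊆ rng T := fun d hd => by simpa using hl d (by simpa using hd)
  have h2 := Finset.card_le_card h1
  rw [List.toFinset_card_of_nodup h] at h2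
  simpa using h2

/-- Leaves of a nonzero kernel are distinct updates. This bound is what terminates the recursions.
-/
lemma Fam.length_le (h : A.Fam δ D K) {s : ℤ} {π : Path n T} (hK : K s π ≠ 0) :
    (D s).length ≤ T :=
  length_le_of_nodup (h.nodup s π hK) fun d hd => (h.prec s π hK d hd).right_mem

lemma Fam.one : A.Fam 0 (fun _ => []) (fun _ _ => 1) where
  mean s := ⟨fun _ => zero_le_one, fun _ => le_rfl⟩
  prec s π _ d hd := by simp at hd
  nodup s π _ := List.nodup_nil
  δ_nonneg := le_rfl
  lower s d hd := by simp at hd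
  attain := Or.inl rfl

lemma free_pk_pk {G : Fin n → Fin n → ℝ} {w s d : ℤ} (hw : w ≠ d) (hs : s ≠ d) :
    Free d fun π => G (A.pk π w) (A.pk π s) := by
  intro π k
  simp only [A.pk_upd_of_ne hw, A.pk_upd_of_ne hs]

lemma av_pk_pk {G : Fin n → Fin n → ℝ} (hG : ∀ a, (1 / n : ℝ) * ∑ b, G a b ≤ 1) {w s : ℤ}
    (hw : w ≠ s) (hs : 0 ≤ s ∧ s < T) (π : Path n T) :
    av s (fun π => G (A.pk π w) (A.pk π s)) π ≤ 1 := by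
  simp only [av, A.pk_upd_of_ne hw, A.pk_upd_self hs]
  exact hG _

/-- Replacement of the root `w - j` by an earlier root `w`. -/
lemma Fam.edge (h : A.Fam δ D K) {G : Fin n → Fin n → ℝ} (hG0 : ∀ a b, 0 ≤ G a b)
    (hG : ∀ a, (1 / n : ℝ) * ∑ b, G a b ≤ 1) (j : ℤ) :
    A.Fam (max 0 (j + δ)) (fun w => (w - j) :: D (w - j))
      (fun w π => K (w - j) π * (G (A.pk π w) (A.pk π (w - j)) * ind (A.prec π w (w - j)))) := by
  have hne : ∀ w π, K (w - j) π * (G (A.pk π w) (A.pk π (w - j)) *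
      ind (A.prec π w (w - j))) ≠ 0 → K (w - j) π ≠ 0 ∧ A.prec π w (w - j) := by
    intro w π h1
    exact ⟨left_ne_zero_of_mul h1, of_ind_ne_zero (right_ne_zero_of_mul (right_ne_zero_of_mul h1))⟩
  have h0 := h.δ_nonneg
  refine ⟨fun w => ?_, fun w π h1 d hd => ?_, fun w π h1 => ?_, le_max_left _ _, fun w d hd => ?_,
    ?_⟩
  · refine (h.mean (w - j)).cons
      (g := fun π => G (A.pk π w) (A.pk π (w - j)))
      -- These static facts hold as soon as the kernel is nonzero on one path, because there w
      -- commits before w - j, which commits before all the old leaves.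
      (p := w ∉ D (w - j) ∧ w - j ∉ D (w - j) ∧ w ≠ w - j ∧ 0 ≤ w - j ∧ w - j < T)
      (fun π => mul_nonneg (h.nonneg _ _) (mul_nonneg (hG0 _ _) (ind_nonneg _)))
      (fun π => mul_le_mul_of_nonneg_left (mul_le_of_le_one_right (hG0 _ _) (ind_le_one _))
        (h.nonneg _ _)) (fun π h1 => ?_) (fun hp => ?_)
    · obtain ⟨h2, h3⟩ := hne w π h1
      exact ⟨fun hc => (h3.trans (h.prec _ π h2 _ hc)).ne rfl, h.notMem h2, h3.ne,
        h3.right_mem.1, h3.right_mem.2⟩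
    · obtain ⟨h2, h3, h4, h5⟩ := hp
      refine ⟨fun π => hG0 _ _, fun d hd => free_pk_pk ?_ ?_, av_pk_pk hG h4 h5⟩
      · rintro rfl; exact h2 hd
      · rintro rfl; exact h3 hd
  · obtain ⟨h2, h3⟩ := hne w π h1
    rcases List.mem_cons.1 hd with rfl | hd
    · exact h3
    · exact h3.trans (h.prec _ π h2 d hd)
  · obtain ⟨h2, h3⟩ := hne w π h1
    exact List.nodup_cons.2 ⟨h.notMem h2, h.nodup _ π h2⟩
  · rcases List.mem_cons.1 hd with rfl | hd
    · omega
    · have := h.lower _ d hd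
      omega
  -- The lowest leaf is now w - (j + δ), unless this is not below the root w; then the root itself
  -- is the earliest index.
  · rcases le_or_gt (j + δ) 0 with h1 | h1
    · exact Or.inl (max_eq_left h1)
    · refine Or.inr fun w => ?_
      rw [max_eq_right h1.le]
      rcases h.attain with h2 | h2
      · rw [h2]; simp
      · refine List.mem_cons_of_mem _ ?_
        have := h2 (w - j)
        rwa [show w - (j + δ) = w - j - δ by ring]

/-- Mean of the value of the best step along the coordinate of the root. -/
lemma Fam.base_le (h : A.Fam δ D K) {s : ℤ} (hs : s ∈ rng T) {X : Path n T → ℝ}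
    (hX : ∀ π, 0 ≤ X π) (hf : ∀ i, s - δ ≤ i → Free i X) :
    Ex (fun π => K s π * (X π * A.Vz π (s - δ) (A.pk π s))) ≤
      Ex fun π => X π * A.Vb π (s - δ) := by
  have := A.neZero
  have h0 := h.δ_nonneg
  have hs' : 0 ≤ s ∧ s < T := by simpa using hs
  by_cases hD : s ∈ D s
  · have : ∀ π, K s π = 0 := fun π => by
      by_contra hc
      exact h.notMem hc hD
    simp only [this, zero_mul, Ex_zero]
    exact Ex_nonneg fun π => mul_nonneg (hX π) (A.Vb_nonneg _ _)
  -- The picks of the leaves are averaged out first: V at the start of s - δ does not depend on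
  -- them. The pick of the root follows and turns V into its mean.
  · refine ((h.mean s).Ex_mul_le (fun π => mul_nonneg (hX π) (A.Vz_nonneg _ _ _)) ?_).trans ?_
    · intro d hd π k
      have h1 := h.lower s d hd
      have h2 := A.free_Vz_pk h1 (s := s) (by rintro rfl; exact hD hd) π k
      simp only [hf d h1 π k, h2]
    · rw [← Ex_av s]
      refine Ex_mono fun π => le_of_eq ?_
      have h1 := av_mul_free (Y := X) (X := fun π => A.Vz π (s - δ) (A.pk π s))
        (hf s (by omega)) π
      rw [A.av_Vz_pk (by omega) hs'] at h1
      rw [mul_comm (X π), ← h1]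
      simp only [mul_comm]

/-- Summation of the contributions of an offset. -/
lemma Fam.sum_edge_le (h : A.Fam δ D K) {G : Fin n → Fin n → ℝ} (hG0 : ∀ a b, 0 ≤ G a b)
    {X : ℤ → Path n T → ℝ} (hX : ∀ s π, 0 ≤ X s π) (j : ℤ) :
    ∑ s ∈ rng T, Ex (fun π => K s π * (X s π * A.edge G π s (s + j))) ≤
      ∑ w ∈ rng T, Ex fun π => K (w - j) π * (G (A.pk π w) (A.pk π (w - j)) *
        ind (A.prec π w (w - j))) * (X (w - j) π * A.Wz π w) := by
  refine (sum_shift_le (g := fun s w => Ex fun π => K s π * (X s π * A.edge G π s w))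
    (fun s w => Ex_nonneg fun π => mul_nonneg (h.nonneg _ _)
      (mul_nonneg (hX _ _) (edge_nonneg hG0 _ _ _)))
    (fun s w hw => ?_) j).trans ?_
  · simp only [AsyncRun.edge, A.Wz_of_notMem _ hw, mul_zero, Ex_zero]
  · refine Finset.sum_le_sum fun w _ => Ex_mono fun π => le_of_eq ?_
    simp only [AsyncRun.edge]
    ring

end AsyncRun

/-! ### First moments -/

namespace AsyncRun
variable {n T q : ℕ} {A : AsyncRun n T q} {δ : ℤ} {D : ℤ → List ℤ} {K : ℤ → Path n T → ℝ}

lemma q_sq_rbar_le (q : ℕ) : (q : ℝ) ^ 2 * rbar q ≤ 1 / 640 := by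
  rcases Nat.eq_zero_or_pos q with rfl | h
  · norm_num
  · have : (0 : ℝ) < q := by exact_mod_cast h
    unfold rbar
    apply le_of_eq
    field_simp

lemma rbar_nonneg (q : ℕ) : 0 ≤ rbar q := by unfold rbar; positivity

lemma q_pos_of_mem_offs {a b : ℕ} {j : ℤ} (h : j ∈ offs (a * q) (b * q)) : 0 < q := by
  rw [mem_offs] at h
  by_contra hc
  have : q = 0 := by omega
  subst this
  simp at h
  omega

/-- The total of the right-hand sides of the propagation inequality over a family. -/
lemma sum_Rz_le_of_sums {X : ℤ → Path n T → ℝ} {b C C' : ℝ}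
    (hb : ∑ s ∈ rng T, Ex (fun π => K s π * (X s π * A.Vz π (s - δ) (A.pk π s))) ≤ b)
    (hC : ∑ j ∈ offs (2 * q) q, ∑ s ∈ rng T,
      Ex (fun π => K s π * (X s π * A.edge Gc π s (s + j))) ≤ C)
    (hC' : ∑ j ∈ offs (3 * q) q, ∑ s ∈ rng T,
      Ex (fun π => K s π * (X s π * A.edge A.Gg π s (s + j))) ≤ C') :
    ∑ s ∈ rng T, Ex (fun π => K s π * (X s π * A.Rz π (s - δ) s)) ≤
      13 / 10 * b + 13 / 10 / n * C + 52 / 3 * q * rbar q * C' := by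
  have hn := A.n_cast_pos
  have hr := rbar_nonneg q
  have e : ∀ s, Ex (fun π => K s π * (X s π * A.Rz π (s - δ) s)) =
      13 / 10 * Ex (fun π => K s π * (X s π * A.Vz π (s - δ) (A.pk π s))) +
      13 / 10 / n * ∑ j ∈ offs (2 * q) q, Ex (fun π => K s π * (X s π * A.edge Gc π s (s + j))) +
      52 / 3 * q * rbar q * ∑ j ∈ offs (3 * q) q,
        Ex (fun π => K s π * (X s π * A.edge A.Gg π s (s + j))) := by
    intro s
    rw [← Ex_sum, ← Ex_sum, ← Ex_mul, ← Ex_mul, ← Ex_mul, ← Ex_add, ← Ex_add]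
    congr 1
    ext π
    simp only [Rz, Finset.mul_sum, mul_add]
    congr 1
    · congr 1
      · ring
      · exact Finset.sum_congr rfl fun j _ => by ring
    · exact Finset.sum_congr rfl fun j _ => by ring
  rw [Finset.sum_congr rfl fun s _ => e s, Finset.sum_add_distrib, Finset.sum_add_distrib,
    ← Finset.mul_sum, ← Finset.mul_sum, ← Finset.mul_sum,
    Finset.sum_comm (s := rng T) (t := offs (2 * q) q),
    Finset.sum_comm (s := rng T) (t := offs (3 * q) q)]
  have h4 := mul_le_mul_of_nonneg_left hC (show (0 : ℝ) ≤ 13 / 10 / n by positivity)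
  have h5 := mul_le_mul_of_nonneg_left hC' (show (0 : ℝ) ≤ 52 / 3 * q * rbar q by positivity)
  linarith

/-- The total weight of the kernels: 3q collision offsets give 39/10·q/n ≤ 0.351, and 4q interaction
offsets give 208/3·q²·rbar ≤ 13/120. The sum is below 0.46, hence the recursion contracts. -/
lemma sum_Rz_le {X : ℤ → Path n T → ℝ} {b c : ℝ} (hc : 0 ≤ c)
    (hb : ∑ s ∈ rng T, Ex (fun π => K s π * (X s π * A.Vz π (s - δ) (A.pk π s))) ≤ b)
    (he : ∀ (G : Fin n → Fin n → ℝ), (∀ a b, 0 ≤ G a b) →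
      (∀ a, (1 / n : ℝ) * ∑ b, G a b ≤ 1) → ∀ j ∈ offs (3 * q) q,
      ∑ s ∈ rng T, Ex (fun π => K s π * (X s π * A.edge G π s (s + j))) ≤ c) :
    ∑ s ∈ rng T, Ex (fun π => K s π * (X s π * A.Rz π (s - δ) s)) ≤
      13 / 10 * b + 46 / 100 * c := by
  have hn := A.n_cast_pos
  have h1 : ∑ j ∈ offs (2 * q) q, ∑ s ∈ rng T,
      Ex (fun π => K s π * (X s π * A.edge Gc π s (s + j))) ≤ 3 * q * c := by
    refine (Finset.sum_le_card_nsmul _ _ c fun j hj => ?_).trans ?_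
    · refine he Gc Gc_nonneg mean_Gc j ?_
      rw [mem_offs] at hj ⊢
      push_cast at hj ⊢
      omega
    · rw [card_offs, nsmul_eq_mul]
      push_cast
      apply le_of_eq; ring
  have h2 : ∑ j ∈ offs (3 * q) q, ∑ s ∈ rng T,
      Ex (fun π => K s π * (X s π * A.edge A.Gg π s (s + j))) ≤ 4 * q * c := by
    refine (Finset.sum_le_card_nsmul _ _ c fun j hj => ?_).trans ?_
    · refine he A.Gg A.Gg_nonneg (A.mean_Gg ?_) j hj
      exact q_pos_of_mem_offs (a := 3) (b := 1) (by simpa using hj)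
    · rw [card_offs, nsmul_eq_mul]
      push_cast
      apply le_of_eq; ring
  refine (sum_Rz_le_of_sums hb h1 h2).trans ?_
  have h6 : 13 / 10 / (n : ℝ) * (3 * q * c) ≤ 351 / 1000 * c := by
    have : 13 / 10 / (n : ℝ) * (3 * q * c) = 39 / 10 * c * (q / n) := by ring
    rw [this]
    nlinarith [A.nu_le]
  have h7 : 52 / 3 * q * rbar q * (4 * q * c) ≤ 13 / 120 * c := by
    have : 52 / 3 * q * rbar q * (4 * q * c) = 208 / 3 * c * (q ^ 2 * rbar q) := by ring
    rw [this]
    nlinarith [q_sq_rbar_le q]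
  linarith

lemma Fam.mul_Wz_le (h : A.Fam δ D K) {s : ℤ} (hs : s ∈ rng T) (π : Path n T) :
    K s π * A.Wz π s ≤ K s π * A.Rz π (s - δ) s := by
  by_cases hK : K s π = 0
  · simp [hK]
  · have hs' : 0 ≤ s ∧ s < T := by simpa using hs
    have h1 := h.δ_le hK
    have h2 := h.δ_nonneg
    exact mul_le_mul_of_nonneg_left
      (A.Wz_le_Rz π (h.zero_le hK hs'.1) (by omega) (by omega)) (h.nonneg _ _)

lemma Fam.sum_Wz_le_sum_Rz (h : A.Fam δ D K) {X : ℤ → Path n T → ℝ} (hX : ∀ s π, 0 ≤ X s π) :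
    ∑ s ∈ rng T, Ex (fun π => K s π * (X s π * A.Wz π s)) ≤
      ∑ s ∈ rng T, Ex (fun π => K s π * (X s π * A.Rz π (s - δ) s)) := by
  refine Finset.sum_le_sum fun s hs => Ex_mono fun π => ?_
  have := mul_le_mul_of_nonneg_left (h.mul_Wz_le hs π) (hX s π)
  calc _ = X s π * (K s π * A.Wz π s) := by ring
    _ ≤ _ := this
    _ = _ := by ring

/-- Nonnegative weights that vary slowly. -/
structure Weight (q : ℕ) (Θ : ℝ) (w : ℤ → ℝ) : Prop where
  nonneg : ∀ s, 0 ≤ w s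
  le : ∀ s t : ℤ, s ≤ t + 3 * (q : ℤ) → w s ≤ Θ * w t

variable {Θ : ℝ} {w : ℤ → ℝ}

/-- The weighted sum of the mean values of the best steps. -/
def base (A : AsyncRun n T q) (w : ℤ → ℝ) : ℝ := ∑ s ∈ rng T, w s * Ex fun π => A.Vb π s

lemma base_nonneg (hw : Weight q Θ w) : 0 ≤ A.base w :=
  Finset.sum_nonneg fun s _ => mul_nonneg (hw.nonneg s) (Ex_nonneg fun _ => A.Vb_nonneg _ _)

lemma Fam.sum_base_le (h : A.Fam δ D K) (hw : Weight q Θ w) :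
    ∑ s ∈ rng T, Ex (fun π => K s π * (w s * A.Vz π (s - δ) (A.pk π s))) ≤ Θ * A.base w := by
  have h1 : ∀ s ∈ rng T, Ex (fun π => K s π * (w s * A.Vz π (s - δ) (A.pk π s))) ≤
      Θ * w (s - δ) * Ex fun π => A.Vb π (s - δ) := by
    intro s hs
    by_cases hq : δ ≤ q
    · have h2 := h.base_le hs (X := fun _ => w s) (fun _ => hw.nonneg s) (fun i _ π k => rfl)
      rw [Ex_mul] at h2
      refine h2.trans (mul_le_mul_of_nonneg_right (hw.le _ _ ?_)
        (Ex_nonneg fun _ => A.Vb_nonneg _ _))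
      omega
    · have : ∀ π, K s π = 0 := fun π => by
        by_contra hc
        exact hq (h.δ_le hc)
      simp only [this, zero_mul, Ex_zero]
      have h3 := (hw.nonneg (s - δ)).trans (hw.le (s - δ) (s - δ) (by omega))
      exact mul_nonneg h3 (Ex_nonneg fun _ => A.Vb_nonneg _ _)
  refine (Finset.sum_le_sum h1).trans ?_
  have h2 := sum_shift_le (T := T) (g := fun _ r => Θ * w r * Ex fun π => A.Vb π r)
    (fun _ r => mul_nonneg ((hw.nonneg r).trans (hw.le r r (by omega)))
      (Ex_nonneg fun _ => A.Vb_nonneg _ _))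
    (fun _ r hr => by
      have : ∀ π, A.Vb π r = 0 := fun π => zx_of_not _ _ (by simpa using hr)
      simp only [this, Ex_zero, mul_zero]) (-δ)
  refine h2.trans (le_of_eq ?_)
  rw [base, Finset.mul_sum]
  exact Finset.sum_congr rfl fun r _ => by ring

/-- Weighted first moments of a family. -/
lemma Fam.first_moment (hw : Weight q Θ w) (hΘ0 : 0 ≤ Θ) (hΘ : Θ ≤ 1095 / 1000) (N : ℕ) :
    ∀ {δ : ℤ} {D : ℤ → List ℤ} {K : ℤ → Path n T → ℝ}, A.Fam δ D K →
      (∀ s, T + 1 ≤ N + (D s).length) →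
      ∑ s ∈ rng T, Ex (fun π => K s π * (w s * A.Wz π s)) ≤ 29 / 10 * A.base w ∧
      ∑ s ∈ rng T, Ex (fun π => K s π * (w s * A.Rz π (s - δ) s)) ≤ 29 / 10 * A.base w := by
  have hB := base_nonneg (A := A) hw
  induction N with
  | zero =>
    intro δ D K h hl
    -- More than T leaves: the kernel is zero.
    have : ∀ s π, K s π = 0 := fun s π => by
      by_contra hc
      have := h.length_le hc
      have := hl s
      omega
    simp only [this, zero_mul, Ex_zero, Finset.sum_const_zero]
    exact ⟨by positivity, by positivity⟩
  | succ N ih =>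
    intro δ D K h hl
    have h2 : ∑ s ∈ rng T, Ex (fun π => K s π * (w s * A.Rz π (s - δ) s)) ≤
        13 / 10 * (Θ * A.base w) + 46 / 100 * (Θ * (29 / 10 * A.base w)) := by
      refine sum_Rz_le (X := fun s _ => w s) (by positivity)
        (h.sum_base_le hw) fun G hG0 hG j hj => ?_
      refine (h.sum_edge_le hG0 (X := fun s _ => w s) (fun s _ => hw.nonneg s) j).trans ?_
      have h3 := h.edge hG0 hG j
      have h4 := (ih h3 fun s => by
        have := hl (s - j)
        simp only [List.length_cons]
        omega).1
      refine le_trans ?_ (mul_le_mul_of_nonneg_left h4 hΘ0)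
      rw [Finset.mul_sum]
      refine Finset.sum_le_sum fun s _ => ?_
      rw [← Ex_mul]
      refine Ex_mono fun π => ?_
      have h5 : w (s - j) ≤ Θ * w s := hw.le _ _ (by
        rw [mem_offs] at hj
        omega)
      have h6 := mul_le_mul_of_nonneg_left
        (mul_le_mul_of_nonneg_right h5 (A.Wz_nonneg π s)) (h3.nonneg s π)
      linarith
    -- 1.095·(1.3 + 0.46·2.9) ≤ 2.9, so the constant reproduces itself.
    have h3 : 13 / 10 * (Θ * A.base w) + 46 / 100 * (Θ * (29 / 10 * A.base w)) ≤
        29 / 10 * A.base w := by nlinarith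
    exact ⟨(h.sum_Wz_le_sum_Rz fun s _ => hw.nonneg s).trans (h2.trans h3), h2.trans h3⟩

/-- One interaction edge is attached to the trivial family. The 2q offsets and the factor 2q·rbar
give 4q²·rbar ≤ 1/160 times a first moment. -/
lemma sum_ez_sq_le (hw : Weight q Θ w) (hΘ0 : 0 ≤ Θ) (hΘ : Θ ≤ 1095 / 1000) :
    ∑ s ∈ rng T, w s * Ex (fun π => A.ez π s ^ 2) ≤ 2 / 100 * A.base w := by
  have hB := base_nonneg (A := A) hw
  have hr := rbar_nonneg q
  have h1 : ∀ s, w s * Ex (fun π => A.ez π s ^ 2) ≤ 2 * q * rbar q * ∑ j ∈ offs q q,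
      Ex (fun π => (fun _ _ => (1 : ℝ)) s π * (w s * A.edge A.Gg π s (s + j))) := by
    intro s
    rw [← Ex_mul, ← Ex_sum, ← Ex_mul]
    refine Ex_mono fun π => ?_
    have := mul_le_mul_of_nonneg_left (A.ez_sq_le π s) (hw.nonneg s)
    refine this.trans (le_of_eq ?_)
    simp only [Finset.mul_sum]
    exact Finset.sum_congr rfl fun j _ => by ring
  refine (Finset.sum_le_sum fun s _ => h1 s).trans ?_
  rw [← Finset.mul_sum, Finset.sum_comm]
  have h2 : ∀ j ∈ offs q q, ∑ s ∈ rng T,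
      Ex (fun π => (fun _ _ => (1 : ℝ)) s π * (w s * A.edge A.Gg π s (s + j))) ≤
      Θ * (29 / 10 * A.base w) := by
    intro j hj
    have hq := q_pos_of_mem_offs (q := q) (a := 1) (b := 1) (by simpa using hj)
    have h := Fam.one (A := A)
    refine (h.sum_edge_le A.Gg_nonneg (X := fun s _ => w s) (fun s _ => hw.nonneg s) j).trans ?_
    have h3 := h.edge A.Gg_nonneg (A.mean_Gg hq) j
    have h4 := (h3.first_moment hw hΘ0 hΘ (T + 1) (by intro s; omega)).1
    refine le_trans ?_ (mul_le_mul_of_nonneg_left h4 hΘ0)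
    rw [Finset.mul_sum]
    refine Finset.sum_le_sum fun s _ => ?_
    rw [← Ex_mul]
    refine Ex_mono fun π => ?_
    have h5 : w (s - j) ≤ Θ * w s := hw.le _ _ (by
      rw [mem_offs] at hj
      omega)
    have h6 := mul_le_mul_of_nonneg_left
      (mul_le_mul_of_nonneg_right h5 (A.Wz_nonneg π s)) (h3.nonneg s π)
    linarith
  have h3 := Finset.sum_le_card_nsmul _ _ _ h2
  rw [card_offs, nsmul_eq_mul] at h3
  refine (mul_le_mul_of_nonneg_left h3 (by positivity)).trans ?_
  push_cast
  have h4 : 2 * (q : ℝ) * rbar q * ((q + q) * (Θ * (29 / 10 * A.base w))) =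
    4 * (q ^ 2 * rbar q) * (Θ * (29 / 10 * A.base w)) := by ring
  rw [h4]
  have h5 : Θ * (29 / 10 * A.base w) ≤ 1095 / 1000 * (29 / 10 * A.base w) :=
    mul_le_mul_of_nonneg_right hΘ (by positivity)
  have h6 : 4 * ((q : ℝ) ^ 2 * rbar q) ≤ 1 / 160 := by linarith [q_sq_rbar_le q]
  have h7 : 0 ≤ 4 * ((q : ℝ) ^ 2 * rbar q) := by positivity
  calc _ ≤ 1 / 160 * (1095 / 1000 * (29 / 10 * A.base w)) :=
        mul_le_mul h6 h5 (by positivity) (by norm_num)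
    _ ≤ _ := by linarith

end AsyncRun

/-! ### Collisions and the weighted progress inequality -/

lemma sum_rng {T : ℕ} (g : ℤ → ℝ) : ∑ s ∈ rng T, g s = ∑ i : Fin T, g (i : ℕ) := by
  rw [← sum_zx]
  refine Finset.sum_congr rfl fun s hs => ?_
  rcases index_cases T s with ⟨i, rfl⟩ | h
  · rw [zx_coe]
  · exact absurd (by simpa using hs) h

/-- Backward differences, starting with the initial value. -/
def bdiff (w : ℤ → ℝ) (t : ℕ) : ℝ := if t = 0 then w 0 else w t - w (t - 1)

lemma sum_bdiff (w : ℤ → ℝ) (N : ℕ) : ∑ t ∈ Finset.range (N + 1), bdiff w t = w N := by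
  induction N with
  | zero => simp [bdiff]
  | succ N ih =>
    rw [Finset.sum_range_succ, ih, bdiff, if_neg (Nat.succ_ne_zero N)]
    push_cast
    rw [add_sub_cancel_right]
    ring

lemma bdiff_nonneg {w : ℤ → ℝ} (h0 : 0 ≤ w 0) (hw : Monotone w) (t : ℕ) : 0 ≤ bdiff w t := by
  unfold bdiff
  split_ifs
  · exact h0
  · exact sub_nonneg.2 (hw (by omega))

namespace AsyncRun
variable {n T q : ℕ} (A : AsyncRun n T q)

/-- The final value of the objective. -/
def Ffin (π : Path n T) : ℝ := A.F (finalPoint A.x₀ π (A.Δ π))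

/-- The change of the objective made by an update. -/
def inc (π : Path n T) (u : Fin T) : ℝ :=
  A.F (A.memOf π (insert u (A.below π (A.S.commit π u)))) - A.F (A.mem π (A.S.commit π u))

lemma exists_below_eq_univ (π : Path n T) (b : ℝ) : ∃ τ, b ≤ τ ∧ A.below π τ = Finset.univ := by
  obtain ⟨c, hc⟩ := (Set.finite_range (A.S.commit π)).bddAbove
  refine ⟨max b (c + 1), le_max_left _ _, ?_⟩
  rw [Finset.eq_univ_iff_forall]
  intro u
  rw [mem_below]
  have := hc ⟨u, rfl⟩
  linarith [le_max_right b (c + 1)]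

lemma memOf_univ (π : Path n T) : A.memOf π Finset.univ = finalPoint A.x₀ π (A.Δ π) := rfl

lemma final_eq_add_sum (π : Path n T) (H : Finset (Fin T) → ℝ) (a : ℝ) :
    H Finset.univ = H (A.below π a) + ∑ u with a ≤ A.S.commit π u,
      (H (insert u (A.below π (A.S.commit π u))) - H (A.below π (A.S.commit π u))) := by
  obtain ⟨τ, h1, h2⟩ := A.exists_below_eq_univ π a
  rw [← h2, A.sum_increments π H h1]
  congr 2
  ext u
  have : u ∈ A.below π τ := by rw [h2]; exact Finset.mem_univ _
  rw [mem_below] at this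
  simp [h2, this]

lemma Ffin_eq (π : Path n T) (a : ℝ) :
    A.Ffin π = A.F (A.mem π a) + ∑ u with a ≤ A.S.commit π u, A.inc π u := by
  rw [Ffin, ← memOf_univ, A.final_eq_add_sum π (fun s => A.F (A.memOf π s)) a, mem_eq_memOf]
  simp only [inc, mem_eq_memOf]

lemma start_zero_le (π : Path n T) (u : Fin T) : A.S.start π ⟨0, A.T_pos⟩ ≤ A.S.commit π u :=
  ((A.valid.start_strictMono π).monotone (Fin.mk_le_of_le_val (Nat.zero_le _))).trans
    (A.start_le_commit π u)

lemma below_start_zero (π : Path n T) : A.below π (A.S.start π ⟨0, A.T_pos⟩) = ∅ := by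
  rw [Finset.eq_empty_iff_forall_notMem]
  intro u hu
  rw [mem_below] at hu
  exact absurd (A.start_zero_le π u) (not_le.2 hu)

lemma z_zero (π : Path n T) : A.z π ⟨0, A.T_pos⟩ = A.x₀ := by
  rw [z, mem_eq_memOf, below_start_zero, memOf_empty]

/-- The loss of progress of update `u` because update `u + j` writes the same coordinate. -/
def coll (π : Path n T) (u j : ℤ) : ℝ :=
  A.Vz π u (A.pk π u) * (ind (A.pk π (u + j) = A.pk π u) *
    (ind (A.after π u (u + j)) * ind (A.prec π (u + j) u)))

lemma coll_nonneg (π : Path n T) (u j : ℤ) : 0 ≤ A.coll π u j :=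
  mul_nonneg (A.Vz_nonneg _ _ _)
    (mul_nonneg (ind_nonneg _) (mul_nonneg (ind_nonneg _) (ind_nonneg _)))

/-- Progress with the losses caused by collisions. -/
def prog (π : Path n T) (u : ℤ) : ℝ := A.Vz π u (A.pk π u) - ∑ j ∈ offs q q, A.coll π u j

/-- After a collision some `coll` term equals V, so `prog` is at most 0 and nothing beyond
`commit_step_le_eps_sq` is claimed. -/
lemma inc_le (π : Path n T) (u : Fin T) :
    A.inc π u ≤ -(4 / 5) * A.prog π (u : ℕ) + 6 * A.eps π u ^ 2 := by
  have hc0 : 0 ≤ ∑ j ∈ offs q q, A.coll π (u : ℕ) j :=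
    Finset.sum_nonneg fun j _ => A.coll_nonneg _ _ _
  have hV : A.Vz π (u : ℕ) (A.pk π (u : ℕ)) = A.V (A.z π u) (π u) := by simp [Vz, pk]
  by_cases h : ∀ v, A.S.start π u ≤ A.S.commit π v → A.S.commit π v < A.S.commit π u → π v ≠ π u
  · have := A.commit_step_le_of_no_collision π u h
    rw [prog, hV, inc]
    linarith
  · push Not at h
    obtain ⟨v, h1, h2, h3⟩ := h
    have h4 := A.le_add_of_commit_lt h2
    have h5 := A.le_add_of_start_le h1
    have h6 : v ≠ u := by rintro rfl; linarith
    have h7 : (v : ℕ) ≠ u := fun hc => h6 (Fin.ext hc)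
    have h7' : ((v : ℕ) : ℤ) - (u : ℕ) ∈ offs q q := by rw [mem_offs]; omega
    have h8 : A.coll π (u : ℕ) ((v : ℕ) - (u : ℕ)) ≤ ∑ j ∈ offs q q, A.coll π (u : ℕ) j :=
      Finset.single_le_sum (f := fun j => A.coll π (u : ℕ) j) (fun j _ => A.coll_nonneg _ _ _) h7'
    have h9 : A.pk π (v : ℕ) = A.pk π (u : ℕ) := by simp [pk, h3]
    have h10 : A.after π (u : ℕ) (v : ℕ) := ⟨u, v, rfl, rfl, h1⟩
    rw [coll, add_sub_cancel, ind_of h9, ind_of h10, ind_of (prec_coe.2 h2)] at h8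
    have := A.commit_step_le_eps_sq π u
    rw [prog, inc]
    nlinarith [sq_nonneg (A.eps π u)]

variable {A}

/-- Whether v is still pending at the start of u is settled before u picks. A replaced pick can be
put back, so one implication is enough. -/
lemma free_after {u v i : ℤ} (h : u ≤ i) : Free i fun π => ind (A.after π u v) := by
  have key : ∀ π k, A.after π u v → A.after (upd π i k) u v := by
    rintro π k ⟨a, b, rfl, rfl, h1⟩
    refine ⟨a, b, rfl, rfl, ?_⟩
    have h2 : Agree a π (upd π i k) := agree_upd h π k
    by_contra hc
    push Not at hc
    have h3 := h2.symm.commit_eq hc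
    rw [h2.start_eq, ← h3] at hc
    linarith
  have hinv : ∀ (π : Path n T) (k : Fin n), ∃ k' : Fin n, upd (upd π i k) i k' = π := by
    intro π k
    rcases index_cases T i with ⟨a, rfl⟩ | h
    · exact ⟨π a, by rw [upd_coe, upd_coe]; simp⟩
    · exact ⟨k, by rw [upd_of_not h, upd_of_not h]⟩
  intro π k
  have : A.after (upd π i k) u v ↔ A.after π u v := by
    refine ⟨fun h1 => ?_, key π k⟩
    obtain ⟨k', hk'⟩ := hinv π k
    rw [← hk']
    exact key _ k' h1
  simp only [this]

lemma av_collision {u v : ℤ} (hu : 0 ≤ u ∧ u < T) (hv : v ≠ u) {g : Path n T → Fin n → ℝ}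
    (hg : ∀ k, Free u fun π => g π k) (π : Path n T) :
    av u (fun π => g π (A.pk π u) * ind (A.pk π v = A.pk π u)) π = 1 / n * g π (A.pk π v) := by
  simp only [av, A.pk_upd_of_ne hv, A.pk_upd_self hu]
  congr 1
  rw [Finset.sum_eq_single (A.pk π v)]
  · rw [ind_of rfl, mul_one]
    exact hg _ π _
  · intro k _ hk
    rw [ind_of_not fun h => hk h.symm, mul_zero]
  · intro h; exact absurd (Finset.mem_univ _) h

lemma Ex_mul_Vz_pk {X : Path n T → ℝ} {u : ℤ} (hu : u ∈ rng T) (hf : Free u X) :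
    Ex (fun π => X π * A.Vz π u (A.pk π u)) = Ex fun π => X π * A.Vb π u := by
  have := A.neZero
  have hu' : 0 ≤ u ∧ u < T := by simpa using hu
  rw [← Ex_av u]
  congr 1
  ext π
  rw [mul_comm, ← A.av_Vz_pk le_rfl hu', ← av_mul_free hf]
  simp only [mul_comm]

/-- The mean is taken over the later pick u + j, which hits the coordinate of u with probability
1/n; V at the start of u is independent of it. -/
lemma Ex_coll_le_of_pos {X : Path n T → ℝ} (hX : ∀ π, 0 ≤ X π) {u j : ℤ} (hu : u ∈ rng T)
    (hj : 0 < j) (hf : ∀ i, u ≤ i → Free i X) :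
    Ex (fun π => X π * A.coll π u j) ≤ 1 / n * Ex (fun π => X π * A.Vb π u) := by
  have := A.neZero
  have hu' : 0 ≤ u ∧ u < T := by simpa using hu
  by_cases hr : 0 ≤ u + j ∧ u + j < T
  · calc Ex (fun π => X π * A.coll π u j)
        ≤ Ex fun π => (1 * ind (A.pk π u = A.pk π (u + j))) * (X π * A.Vz π u (A.pk π u)) := by
          refine Ex_mono fun π => ?_
          rw [one_mul, mul_comm, coll, mul_comm, ← mul_assoc, eq_comm (a := A.pk π u), mul_comm]
          refine mul_le_mul_of_nonneg_right ?_ (mul_nonneg (hX π) (A.Vz_nonneg _ _ _))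
          refine mul_le_of_le_one_right (ind_nonneg _) ?_
          exact mul_le_one₀ (ind_le_one _) (ind_nonneg _) (ind_le_one _)
      _ = Ex fun π => 1 / n * (X π * A.Vz π u (A.pk π u)) := by
          rw [← Ex_av (u + j)]
          congr 1
          ext π
          rw [av_mul_free (i := u + j) (X := fun π => 1 * ind (A.pk π u = A.pk π (u + j)))
            (Y := fun π => X π * A.Vz π u (A.pk π u)), av_collision (A := A) hr (by omega)
              (g := fun _ _ => 1) (fun _ _ _ => rfl), mul_one]
          intro π k
          have h1 := hf (u + j) (by omega) π k
          have h2 := A.free_Vz_pk (r := u) (s := u) (i := u + j) (by omega) (by omega) π k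
          simp only [h1, h2]
      _ = _ := by rw [Ex_mul, Ex_mul_Vz_pk hu (hf u le_rfl)]
  · have : ∀ π, A.coll π u j = 0 := fun π => by
      rw [coll, ind_of_not fun h : A.prec π (u + j) u => hr h.left_mem]
      simp
    simp only [this, mul_zero, Ex_zero]
    exact mul_nonneg (by positivity) (Ex_nonneg fun π => mul_nonneg (hX π) (A.Vb_nonneg _ _))

/-- Here the mean is over the pick of u itself. It leaves 1/n times V along the coordinate of the
earlier update u + j, still pending at the start of u, to which `Vz_le_Rz` applies. -/
lemma Ex_coll_le_of_neg {X : Path n T → ℝ} (hX : ∀ π, 0 ≤ X π) {u j : ℤ} (hu : u ∈ rng T)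
    (hj : j < 0) (hf : ∀ i, u ≤ i → Free i X) :
    Ex (fun π => X π * A.coll π u j) ≤
      1 / n * Ex (fun π => X π * (ind (A.after π u (u + j)) * A.Rz π (u + j) (u + j))) := by
  have := A.neZero
  have hu' : 0 ≤ u ∧ u < T := by simpa using hu
  calc Ex (fun π => X π * A.coll π u j)
      ≤ Ex fun π => (A.Vz π u (A.pk π u) * ind (A.pk π (u + j) = A.pk π u)) *
          (X π * ind (A.after π u (u + j))) := by
        refine Ex_mono fun π => ?_
        have h1 := mul_le_of_le_one_right (ind_nonneg (A.after π u (u + j)))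
          (ind_le_one (A.prec π (u + j) u))
        have h2 : 0 ≤ X π * (A.Vz π u (A.pk π u) * ind (A.pk π (u + j) = A.pk π u)) :=
          mul_nonneg (hX π) (mul_nonneg (A.Vz_nonneg _ _ _) (ind_nonneg _))
        have h3 := mul_le_mul_of_nonneg_left h1 h2
        rw [coll]
        linarith
    _ = Ex fun π => 1 / n * A.Vz π u (A.pk π (u + j)) * (X π * ind (A.after π u (u + j))) := by
        rw [← Ex_av u]
        congr 1
        ext π
        rw [av_mul_free (i := u)
          (X := fun π => A.Vz π u (A.pk π u) * ind (A.pk π (u + j) = A.pk π u))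
          (Y := fun π => X π * ind (A.after π u (u + j))), av_collision (A := A) hu' (by omega)
            (g := fun π k => A.Vz π u k) fun k => A.free_Vz le_rfl k]
        intro π k
        have h1 := hf u le_rfl π k
        have h2 := free_after (A := A) (u := u) (v := u + j) le_rfl π k
        simp only [h1, h2]
    _ ≤ Ex fun π => 1 / n * (X π * (ind (A.after π u (u + j)) * A.Rz π (u + j) (u + j))) := by
        refine Ex_mono fun π => ?_
        by_cases h : A.after π u (u + j)
        · have h1 := A.Vz_le_Rz π (by omega) h
          have h2 := mul_le_mul_of_nonneg_left h1 (mul_nonneg (by positivity) (hX π) : 0 ≤ 1 / (n : ℝ) * X π)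
          rw [ind_of h]
          linarith
        · simp [ind_of_not h]
    _ = _ := Ex_mul _ _

lemma sum_offs_ite (a b : ℕ) (x y : ℝ) :
    ∑ j ∈ offs a b, (if 0 < j then x else y) = b * x + a * y := by
  have h1 : (offs a b).filter (fun j => 0 < j) = Finset.Icc 1 (b : ℤ) := by
    ext j; rw [Finset.mem_filter, mem_offs, Finset.mem_Icc]; omega
  have h2 : (offs a b).filter (fun j => ¬0 < j) = Finset.Icc (-(a : ℤ)) (-1) := by
    ext j; rw [Finset.mem_filter, mem_offs, Finset.mem_Icc]; omega
  rw [Finset.sum_ite, h1, h2, Finset.sum_const, Finset.sum_const, Int.card_Icc, Int.card_Icc]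
  simp

lemma Rz_nonneg_of_after {π : Path n T} {u v : ℤ} (h : A.after π u v) : 0 ≤ A.Rz π v v := by
  obtain ⟨u, v, rfl, rfl, h⟩ := h
  exact (A.Wz_nonneg π _).trans (A.Wz_le_Rz π (by omega) le_rfl (by omega))

/-- Mean progress, for a family of weights. -/
lemma sum_prog_ge {X Y : ℤ → Path n T → ℝ} (hX : ∀ s π, 0 ≤ X s π) (hY : ∀ s π, 0 ≤ Y s π)
    (hf : ∀ u i, u ≤ i → Free i (X u))
    (hXY : ∀ π (u v : ℤ), u ≤ v + (q : ℤ) → A.after π u v → X u π ≤ Y v π) {b c : ℝ}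
    (hb : ∑ s ∈ rng T, Ex (fun π => X s π * A.Vb π s) ≤ b)
    (hc : ∑ s ∈ rng T, Ex (fun π => Y s π * A.Rz π s s) ≤ c) (hbc : 0 ≤ b + c) :
    ∑ s ∈ rng T, Ex (fun π => X s π * A.Vz π s (A.pk π s)) - 9 / 100 * (b + c) ≤
      ∑ s ∈ rng T, Ex (fun π => X s π * A.prog π s) := by
  have hn := A.n_cast_pos
  have h1 : ∑ s ∈ rng T, Ex (fun π => X s π * A.prog π s) =
      ∑ s ∈ rng T, Ex (fun π => X s π * A.Vz π s (A.pk π s)) -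
      ∑ j ∈ offs q q, ∑ s ∈ rng T, Ex (fun π => X s π * A.coll π s j) := by
    rw [Finset.sum_comm, ← Finset.sum_sub_distrib]
    refine Finset.sum_congr rfl fun s _ => ?_
    rw [← Ex_sum, ← Ex_sub]
    congr 1
    ext π
    rw [prog, mul_sub, Finset.mul_sum]
  have h2 : ∀ j ∈ offs q q, ∑ s ∈ rng T, Ex (fun π => X s π * A.coll π s j) ≤
      if 0 < j then 1 / n * b else 1 / n * c := by
    intro j hj
    rw [mem_offs] at hj
    split_ifs with h
    · refine (Finset.sum_le_sum fun s hs => Ex_coll_le_of_pos (hX s) hs h (hf s)).trans ?_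
      rw [← Finset.mul_sum]
      exact mul_le_mul_of_nonneg_left hb (by positivity)
    · refine (Finset.sum_le_sum fun s hs =>
        Ex_coll_le_of_neg (hX s) hs (by omega) (hf s)).trans ?_
      rw [← Finset.mul_sum]
      refine mul_le_mul_of_nonneg_left (le_trans ?_ hc) (by positivity)
      refine (sum_shift_le (g := fun u v => Ex fun π => X u π *
        (ind (A.after π u v) * A.Rz π v v)) (fun u v => Ex_nonneg fun π => ?_)
        (fun u v hv => ?_) j).trans (Finset.sum_le_sum fun v hv => Ex_mono fun π => ?_)
      · by_cases ha : A.after π u v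
        · exact mul_nonneg (hX _ _) (mul_nonneg (ind_nonneg _) (Rz_nonneg_of_after ha))
        · simp [ind_of_not ha]
      · have : ∀ π, ind (A.after π u v) = 0 := fun π => ind_of_not fun h => hv (by
          obtain ⟨a, b, -, rfl, -⟩ := h
          simp)
        simp [this, Ex_zero]
      · have hv' : 0 ≤ v ∧ v < T := by simpa using hv
        have hR := (A.Wz_nonneg π _).trans (A.Wz_le_Rz π hv'.1 le_rfl (by omega))
        by_cases ha : A.after π (v - j) v
        · rw [ind_of ha, one_mul]
          exact mul_le_mul_of_nonneg_right (hXY π _ v (by omega) ha) hR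
        · rw [ind_of_not ha, zero_mul, mul_zero]
          exact mul_nonneg (hY _ _) hR
  have h3 := Finset.sum_le_sum h2
  rw [sum_offs_ite] at h3
  have h4 : (q : ℝ) * (1 / n * b) + q * (1 / n * c) = q / n * (b + c) := by ring
  rw [h4] at h3
  have h5 := mul_le_mul_of_nonneg_right A.nu_le hbc
  linarith

/-- Weighted progress of the mean of the objective. -/
lemma main_inequality {Θ : ℝ} {w : ℤ → ℝ} (hw : Weight q Θ w) (hm : Monotone w) (hΘ0 : 0 ≤ Θ)
    (hΘ : Θ ≤ 1095 / 1000) :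
    w (T - 1 : ℕ) * Ex A.Ffin ≤ ∑ t : Fin T, bdiff w t * Ex (fun π => A.F (A.z π t)) -
      1 / 4 * ∑ t : Fin T, w (t : ℕ) * Ex (fun π => A.Vbar (A.z π t)) := by
  have hB := base_nonneg (A := A) hw
  have hb0 : ∀ t, 0 ≤ bdiff w t := bdiff_nonneg (hw.nonneg 0) hm
  have hbase : A.base w = ∑ t : Fin T, w (t : ℕ) * Ex (fun π => A.Vbar (A.z π t)) := by
    rw [base, sum_rng]
    simp only [Vb, zx_coe]
  have hpath : ∀ π, w (T - 1 : ℕ) * A.Ffin π ≤ ∑ t : Fin T, bdiff w t * A.F (A.z π t) +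
      ∑ s ∈ rng T, (-(4 / 5) * (w s * A.prog π s) + 6 * Θ * (w s * A.ez π s ^ 2)) := by
    intro π
    -- For each t the final value is F(z_t) plus the increments committed after the start of t.
    -- Weighting these identities by the differences of w gives increment u the weight ω u, which
    -- lies between w u and w (u + q).
    set ω : Fin T → ℝ := fun u => ∑ t : Fin T with A.S.start π t ≤ A.S.commit π u, bdiff w t with hω
    have e1 : ∑ t : Fin T, bdiff w t = w (T - 1 : ℕ) := by
      rw [Fin.sum_univ_eq_sum_range (bdiff w), ← sum_bdiff w, Nat.sub_add_cancel A.T_pos]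
    have e2 : w (T - 1 : ℕ) * A.Ffin π =
        ∑ t : Fin T, bdiff w t * A.F (A.z π t) + ∑ u, ω u * A.inc π u := by
      rw [← e1, Finset.sum_mul]
      have : ∀ t : Fin T, bdiff w t * A.Ffin π = bdiff w t * A.F (A.z π t) +
          ∑ u with A.S.start π t ≤ A.S.commit π u, bdiff w t * A.inc π u := fun t => by
        rw [A.Ffin_eq π (A.S.start π t), mul_add, Finset.mul_sum]
      simp only [this, hω]
      rw [Finset.sum_add_distrib]
      congr 1
      simp only [Finset.sum_filter, Finset.sum_mul]
      rw [Finset.sum_comm]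
      refine Finset.sum_congr rfl fun u _ => Finset.sum_congr rfl fun t _ => ?_
      split_ifs <;> simp
    have e3' : ∀ u, ω u = ∑ t ∈ (Finset.univ.filter fun t : Fin T =>
        A.S.start π t ≤ A.S.commit π u).image Fin.val, bdiff w t := fun u => by
      rw [Finset.sum_image fun a _ b _ h => Fin.ext h]
    have e3 : ∀ u : Fin T, w (u : ℕ) ≤ ω u := by
      intro u
      rw [← sum_bdiff w, e3']
      refine Finset.sum_le_sum_of_subset_of_nonneg (fun t ht => ?_) fun t _ _ => hb0 t
      have ht' : t ≤ u := by rw [Finset.mem_range] at ht; omega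
      refine Finset.mem_image.2 ⟨⟨t, ht'.trans_lt u.2⟩, Finset.mem_filter.2
        ⟨Finset.mem_univ _, ?_⟩, rfl⟩
      exact ((A.valid.start_strictMono π).monotone (Fin.mk_le_of_le_val ht')).trans
        (A.start_le_commit π u)
    have e4 : ∀ u : Fin T, ω u ≤ Θ * w (u : ℕ) := by
      intro u
      refine le_trans ?_ (hw.le (((u : ℕ) + q : ℕ) : ℤ) (u : ℕ) (by push_cast; omega))
      rw [← sum_bdiff w, e3']
      refine Finset.sum_le_sum_of_subset_of_nonneg (fun t ht => ?_) fun t _ _ => hb0 t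
      obtain ⟨t, ht', rfl⟩ := Finset.mem_image.1 ht
      have := A.le_add_of_start_le (Finset.mem_filter.1 ht').2
      rw [Finset.mem_range]
      omega
    rw [e2, sum_rng]
    refine add_le_add le_rfl (Finset.sum_le_sum fun u _ => ?_)
    have h1 := A.inc_le π u
    have h2 : A.inc π u ≤ A.eps π u ^ 2 := by
      have := A.commit_step_le_eps_sq π u
      rw [inc]; linarith
    simp only [ez, zx_coe]
    have h3 := hw.nonneg (u : ℕ)
    have h4 := h3.trans (e3 u)
    have h5 := sq_nonneg (A.eps π u)
    have h6 := mul_le_mul_of_nonneg_right (e4 u) h5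
    -- True progress gets the smaller weight w u. If `prog` is negative, the bound by eps² is used
    -- with the larger weight, and the term with `prog` helps.
    rcases le_total 0 (A.prog π (u : ℕ)) with hp | hp
    · have h7 := mul_le_mul_of_nonneg_right (e3 u) hp
      have h8 := mul_le_mul_of_nonneg_left h1 h4
      linarith
    · have h7 := mul_le_mul_of_nonneg_left h2 h4
      have h8 := mul_nonneg h3 (neg_nonneg.2 hp)
      have h9 := mul_nonneg (mul_nonneg hΘ0 h3) h5
      linarith
  have h1 := Ex_mono hpath
  simp only [Ex_add, Ex_sum, Ex_mul] at h1
  rw [Finset.sum_add_distrib, ← Finset.mul_sum, ← Finset.mul_sum] at h1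
  have h2 := sum_ez_sq_le (A := A) hw hΘ0 hΘ
  have h3 := (Fam.one (A := A)).first_moment hw hΘ0 hΘ (T + 1) (by intro s; omega)
  have h4 := sum_prog_ge (A := A) (X := fun s _ => w s) (Y := fun s _ => Θ * w s)
    (b := A.base w) (c := Θ * (29 / 10 * A.base w)) (fun s _ => hw.nonneg s)
    (fun s _ => mul_nonneg hΘ0 (hw.nonneg s)) (fun _ _ _ _ _ => rfl)
    (fun π u v h _ => hw.le u v (by omega)) (le_of_eq (by simp only [Ex_mul, base])) (by
      refine le_trans (le_of_eq ?_) (mul_le_mul_of_nonneg_left h3.2 hΘ0)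
      rw [Finset.mul_sum]
      refine Finset.sum_congr rfl fun s _ => ?_
      rw [← Ex_mul, sub_zero]
      congr 1
      ext π
      ring) (by positivity)
  have h5 : ∑ s ∈ rng T, Ex (fun π => w s * A.Vz π s (A.pk π s)) = A.base w := by
    rw [base]
    exact Finset.sum_congr rfl fun s hs => by
      rw [Ex_mul_Vz_pk (X := fun _ => w s) hs (fun _ _ => rfl), Ex_mul]
  rw [h5] at h4
  simp only [Ex_mul] at h4
  rw [← hbase]
  have h6 : Θ * (29 / 10 * A.base w) ≤ 1095 / 1000 * (29 / 10 * A.base w) :=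
    mul_le_mul_of_nonneg_right hΘ (by positivity)
  have h7 : 6 * Θ * ∑ s ∈ rng T, w s * Ex (fun π => A.ez π s ^ 2) ≤
      6 * (1095 / 1000) * (2 / 100 * A.base w) :=
    mul_le_mul (by linarith) h2 (Finset.sum_nonneg fun s _ => mul_nonneg (hw.nonneg s)
      (Ex_nonneg fun _ => sq_nonneg _)) (by norm_num)
  -- 0.8·(1 - 0.09·(1 + 1.095·2.9)) - 6·1.095·0.02 exceeds 1/4.
  linarith

end AsyncRun

/-! ### The linear rate -/

namespace AsyncRun
variable {n T q : ℕ} (A : AsyncRun n T q)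

lemma Ex_F_z_zero (X : Pt n → ℝ) : Ex (fun π => X (A.z π ⟨0, A.T_pos⟩)) = X A.x₀ := by
  have := A.neZero
  simp only [A.z_zero]
  exact Ex_const _

lemma exp_nu_le (A : AsyncRun n T q) : Real.exp ((q : ℝ) / n) ≤ 1095 / 1000 := by
  have h1 : Real.exp (1 / 100) ≤ 100 / 99 := by
    have h2 := Real.add_one_le_exp (-(1 / 100 : ℝ))
    rw [Real.exp_neg, le_inv_comm₀ (by norm_num) (Real.exp_pos _)] at h2
    exact h2.trans (by norm_num)
  calc Real.exp ((q : ℝ) / n) ≤ Real.exp ((9 : ℕ) * (1 / 100)) :=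
        Real.exp_le_exp.2 (A.nu_le.trans (by norm_num))
    _ = Real.exp (1 / 100) ^ 9 := Real.exp_nat_mul _ _
    _ ≤ (100 / 99) ^ 9 := pow_le_pow_left₀ (Real.exp_pos _).le h1 9
    _ ≤ _ := by norm_num

lemma weight_pow (A : AsyncRun n T q) {x : ℝ} (h1 : 1 ≤ x) (h2 : x ≤ 1 + 1 / (3 * n)) :
    Weight q (1095 / 1000) fun s => x ^ s.toNat := by
  have hn := A.n_cast_pos
  refine ⟨fun s => by positivity, fun s t h => ?_⟩
  have h3 : x ^ (3 * q) ≤ 1095 / 1000 := by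
    refine le_trans ?_ A.exp_nu_le
    calc x ^ (3 * q) ≤ Real.exp (1 / (3 * n)) ^ (3 * q) := by
          refine pow_le_pow_left₀ (by linarith) (h2.trans ?_) _
          linarith [Real.add_one_le_exp (1 / (3 * (n : ℝ)))]
      _ = _ := by
          rw [← Real.exp_nat_mul]
          congr 1
          push_cast
          field_simp
  calc x ^ s.toNat ≤ x ^ (3 * q + t.toNat) := pow_le_pow_right₀ h1 (by omega)
    _ = x ^ (3 * q) * x ^ t.toNat := pow_add _ _ _
    _ ≤ _ := mul_le_mul_of_nonneg_right h3 (by positivity)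

/-- Linear convergence, when the best steps are bounded below by the objective. -/
lemma linear_rate {c : ℝ} (h0 : 0 ≤ c) (h1 : c ≤ 1)
    (hV : ∀ z, c * A.F z ≤ ∑ k, A.V z k) :
    Ex A.Ffin ≤ (1 - c / (4 * n)) ^ (T - 1) * A.F A.x₀ := by
  have hn := A.n_cast_pos
  have hn1 : (1 : ℝ) ≤ n := by exact_mod_cast A.n_pos
  -- For the weights y⁻ᵗ the relative backward difference is 1 - y = c/(4n), exactly the progress
  -- guaranteed by 1/4·`Vbar`. The terms with t ≥ 1 are therefore nonpositive, and t = 0 leaves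
  -- F(x₀).
  set y := 1 - c / (4 * n) with hy
  have hc : c / (4 * n) ≤ 1 / (3 * n + 1) := by
    rw [div_le_div_iff₀ (by positivity) (by positivity)]
    nlinarith
  have hc0 : 0 ≤ c / (4 * n) := by positivity
  have hy1 : 1 - 1 / (3 * (n : ℝ) + 1) ≤ y := by linarith
  have hy0 : 0 < y := by
    refine lt_of_lt_of_le ?_ hy1
    rw [sub_pos, div_lt_one (by positivity)]
    linarith
  have hx1 : 1 ≤ y⁻¹ := (one_le_inv₀ hy0).2 (by linarith)
  have hx2 : y⁻¹ ≤ 1 + 1 / (3 * n) := by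
    rw [inv_le_comm₀ hy0 (by positivity)]
    refine le_trans (le_of_eq ?_) hy1
    field_simp
    ring
  have hw := A.weight_pow hx1 hx2
  have hm : Monotone fun s : ℤ => y⁻¹ ^ s.toNat := fun s t h =>
    pow_le_pow_right₀ hx1 (Int.toNat_le_toNat h)
  have h := main_inequality (A := A) hw hm (by norm_num) le_rfl
  simp only [Int.toNat_natCast] at h
  have h2 : ∀ t : Fin T, bdiff (fun s => y⁻¹ ^ s.toNat) t * Ex (fun π => A.F (A.z π t)) -
      1 / 4 * (y⁻¹ ^ (t : ℕ) * Ex (fun π => A.Vbar (A.z π t))) ≤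
      if t = ⟨0, A.T_pos⟩ then A.F A.x₀ else 0 := by
    intro t
    have h3 : c / (4 * n) * Ex (fun π => A.F (A.z π t)) ≤
        1 / 4 * Ex fun π => A.Vbar (A.z π t) := by
      rw [← Ex_mul, ← Ex_mul]
      refine Ex_mono fun π => ?_
      have h4 := mul_le_mul_of_nonneg_left (hV (A.z π t)) (show 0 ≤ 1 / (4 * (n : ℝ)) by positivity)
      rw [Composite.Vbar]
      calc _ = 1 / (4 * (n : ℝ)) * (c * A.F (A.z π t)) := by ring
        _ ≤ _ := h4
        _ = _ := by ring
    have hF0 : 0 ≤ Ex fun π => A.F (A.z π t) := Ex_nonneg fun π => A.nonneg _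
    split_ifs with ht
    · subst ht
      rw [A.Ex_F_z_zero A.F] at h3 ⊢
      simp only [bdiff, if_pos, Int.toNat_zero, pow_zero, one_mul]
      have := mul_nonneg hc0 (A.nonneg A.x₀)
      change 0 ≤ c / (4 * n) * A.F A.x₀ at this
      linarith
    · have ht' : (t : ℕ) ≠ 0 := fun hc => ht (Fin.ext hc)
      have e : bdiff (fun s => y⁻¹ ^ s.toNat) t = c / (4 * n) * y⁻¹ ^ (t : ℕ) := by
        obtain ⟨m, hm⟩ := Nat.exists_eq_succ_of_ne_zero ht'
        rw [hm, bdiff, if_neg (Nat.succ_ne_zero m)]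
        have e1 : (((m.succ : ℕ) : ℤ) - 1).toNat = m := by omega
        simp only [e1, Int.toNat_natCast]
        have e2 : c / (4 * n) = 1 - y := by rw [hy]; ring
        rw [e2, pow_succ]
        field_simp
      rw [e]
      have := mul_le_mul_of_nonneg_left h3 (show 0 ≤ y⁻¹ ^ (t : ℕ) by positivity)
      linarith
  have h5 := Finset.sum_le_sum fun t (_ : t ∈ Finset.univ) => h2 t
  rw [Finset.sum_ite_eq' , if_pos (Finset.mem_univ _), Finset.sum_sub_distrib,
    ← Finset.mul_sum] at h5
  have h6 := h.trans h5
  rw [inv_pow, inv_mul_le_iff₀ (by positivity)] at h6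
  exact h6

end AsyncRun

/-! ### The sublinear rate, given the second moment of the errors -/

namespace AsyncRun
variable {n T q : ℕ} (A : AsyncRun n T q)

/-- The initial value of the objective plus all the squared errors. -/
def Ofin (π : Path n T) : ℝ := A.F A.x₀ + ∑ u, A.eps π u ^ 2

lemma Om_le_Ofin (π : Path n T) (τ : ℝ) : A.Om π τ ≤ A.Ofin π :=
  add_le_add le_rfl (Finset.sum_le_univ_sum_of_nonneg fun _ => sq_nonneg _)

lemma x₀_le_Ofin (π : Path n T) : A.F A.x₀ ≤ A.Ofin π :=
  le_add_of_nonneg_right (Finset.sum_nonneg fun _ _ => sq_nonneg _)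

lemma weight_sq (A : AsyncRun n T q) {a : ℝ} (h0 : 0 ≤ a) (h1 : a ≤ 1 / (16 * n)) :
    Weight q (1095 / 1000) fun s => (1 + a * s.toNat) ^ 2 := by
  have hn := A.n_cast_pos
  refine ⟨fun s => by positivity, fun s t h => ?_⟩
  have h2 : 3 * q * a ≤ 17 / 1000 := by
    have h3 := mul_le_mul_of_nonneg_left h1 (show (0 : ℝ) ≤ 3 * q by positivity)
    have h4 : 3 * (q : ℝ) * (1 / (16 * n)) = 3 / 16 * (q / n) := by field_simp
    linarith [A.nu_le]
  have h3 : ((s.toNat : ℕ) : ℝ) ≤ t.toNat + 3 * q := by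
    have : s.toNat ≤ t.toNat + 3 * q := by omega
    exact_mod_cast this
  have h4 : 1 + a * s.toNat ≤ 1017 / 1000 * (1 + a * t.toNat) := by
    have := mul_le_mul_of_nonneg_left h3 h0
    have h5 : 0 ≤ a * t.toNat := by positivity
    linarith
  calc (1 + a * (s.toNat : ℝ)) ^ 2 ≤ (1017 / 1000 * (1 + a * t.toNat)) ^ 2 :=
        pow_le_pow_left₀ (by positivity) h4 2
    _ ≤ _ := by
        rw [mul_pow]
        exact mul_le_mul_of_nonneg_right (by norm_num) (by positivity)

/-- Mean best step, in terms of the mean objective. -/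
lemma Ex_Vbar_ge (hM : Ex (fun π => A.Ofin π ^ 2) ≤ 4 * A.F A.x₀ ^ 2) (hF : 0 < A.F A.x₀)
    {R : ℝ} (hR : levelRadius A.F A.x₀ ≤ ENNReal.ofReal R) (hR0 : 0 ≤ R) (t : Fin T) {l : ℝ}
    (hl0 : 0 ≤ l) (hl1 : l ≤ 1) :
    l * Ex (fun π => A.F (A.z π t)) - l ^ 2 * (2 * (A.Γ * R ^ 2)) ≤
      n * Ex fun π => A.Vbar (A.z π t) := by
  have hn := A.n_cast_pos
  have h1 : ∀ π, l * A.F (A.z π t) ≤ n * A.Vbar (A.z π t) +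
      l ^ 2 * (A.Γ * R ^ 2) / (2 * A.F A.x₀ ^ 2) * A.Ofin π ^ 2 := by
    intro π
    obtain ⟨x, hx, hd⟩ := A.exists_minimizer_dist_le hF hR hR0 (A.z π t)
    have h2 := A.sum_V_ge_convex (A.z π t) x hl0 hl1 hx
    have h3 : max (A.F A.x₀) (A.F (A.z π t)) ≤ A.Ofin π :=
      max_le (A.x₀_le_Ofin π) ((A.F_mem_le_Om π _).trans (A.Om_le_Ofin π _))
    have h4 := hd.trans (mul_le_mul_of_nonneg_left h3 hR0)
    have h5 := pow_le_pow_left₀ (by positivity) h4 2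
    have h6 : n * A.Vbar (A.z π t) = ∑ k, A.V (A.z π t) k := by
      rw [Composite.Vbar]; field_simp
    have h7 : dist (A.z π t) x ^ 2 ≤ R ^ 2 / A.F A.x₀ ^ 2 * A.Ofin π ^ 2 := by
      rw [div_mul_eq_mul_div, le_div_iff₀ (by positivity)]
      linarith
    have h8 := mul_le_mul_of_nonneg_left h7 (mul_nonneg (sq_nonneg l) (by linarith [A.Γ_pos] :
      0 ≤ A.Γ / 2))
    rw [h6]
    calc l * A.F (A.z π t) ≤ ∑ k, A.V (A.z π t) k + l ^ 2 * (A.Γ / 2) * dist (A.z π t) x ^ 2 := by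
          linarith
      _ ≤ ∑ k, A.V (A.z π t) k + l ^ 2 * (A.Γ / 2) * (R ^ 2 / A.F A.x₀ ^ 2 * A.Ofin π ^ 2) := by
          linarith
      _ = _ := by ring
  have h2 := Ex_mono h1
  rw [Ex_add, Ex_mul, Ex_mul, Ex_mul] at h2
  have h3 := mul_le_mul_of_nonneg_left hM (show 0 ≤ l ^ 2 * (A.Γ * R ^ 2) / (2 * A.F A.x₀ ^ 2) by
    have := A.Γ_pos
    positivity)
  have h4 : l ^ 2 * (A.Γ * R ^ 2) / (2 * A.F A.x₀ ^ 2) * (4 * A.F A.x₀ ^ 2) =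
      l ^ 2 * (2 * (A.Γ * R ^ 2)) := by
    field_simp
    norm_num
  linarith

/-- Sublinear convergence, given a bound for the second moment of the accumulated errors. -/
lemma sublinear_rate (hM : Ex (fun π => A.Ofin π ^ 2) ≤ 4 * A.F A.x₀ ^ 2) (hF : 0 < A.F A.x₀)
    {R a : ℝ} (hR : levelRadius A.F A.x₀ ≤ ENNReal.ofReal R) (hR0 : 0 < R) (h0 : 0 ≤ a)
    (h1 : a ≤ 1 / (16 * n)) (h2 : a * (32 * n * A.Γ * R ^ 2) ≤ A.F A.x₀) :
    Ex A.Ffin ≤ A.F A.x₀ / (1 + a * ((T : ℝ) - 1)) := by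
  have hn := A.n_cast_pos
  have hΓ := A.Γ_pos
  have hw := A.weight_sq h0 h1
  have hm : Monotone fun s : ℤ => (1 + a * (s.toNat : ℝ)) ^ 2 := fun s t h => by
    have : ((s.toNat : ℕ) : ℝ) ≤ t.toNat := by exact_mod_cast Int.toNat_le_toNat h
    exact pow_le_pow_left₀ (by positivity) (by nlinarith) 2
  have h := main_inequality (A := A) hw hm (by norm_num) le_rfl
  simp only [Int.toNat_natCast] at h
  have h3 : ∀ t : Fin T, bdiff (fun s => (1 + a * (s.toNat : ℝ)) ^ 2) t *
      Ex (fun π => A.F (A.z π t)) -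
      1 / 4 * ((1 + a * ((t : ℕ) : ℝ)) ^ 2 * Ex (fun π => A.Vbar (A.z π t))) ≤
      (if t = ⟨0, A.T_pos⟩ then A.F A.x₀ - a * A.F A.x₀ else 0) + a * A.F A.x₀ := by
    intro t
    have hV0 : 0 ≤ Ex fun π => A.Vbar (A.z π t) := Ex_nonneg fun π => A.Vbar_nonneg _
    split_ifs with ht
    · subst ht
      rw [A.Ex_F_z_zero A.F]
      simp only [bdiff, if_pos, Int.toNat_zero, Nat.cast_zero, mul_zero, add_zero, one_pow, one_mul]
      linarith
    · have ht' : (t : ℕ) ≠ 0 := fun hc => ht (Fin.ext hc)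
      set f := Ex fun π => A.F (A.z π t) with hf
      set s := 1 + a * ((t : ℕ) : ℝ) with hs
      have hs1 : 1 ≤ s := by rw [hs]; linarith [mul_nonneg h0 (Nat.cast_nonneg (α := ℝ) (t : ℕ))]
      have hf0 : 0 ≤ f := Ex_nonneg fun π => A.nonneg _
      have e : bdiff (fun s => (1 + a * (s.toNat : ℝ)) ^ 2) t ≤ 2 * a * s := by
        obtain ⟨m, hm⟩ := Nat.exists_eq_succ_of_ne_zero ht'
        rw [hs, hm, bdiff, if_neg (Nat.succ_ne_zero m)]
        have e1 : (((m.succ : ℕ) : ℤ) - 1).toNat = m := by omega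
        simp only [e1, Int.toNat_natCast]
        push_cast
        nlinarith [sq_nonneg a]
      have e2 := mul_le_mul_of_nonneg_right e hf0
      have key := fun l => A.Ex_Vbar_ge hM hF hR hR0.le t (l := l)
      rw [zero_add]
      set B := A.Γ * R ^ 2 with hB
      have hB0 : 0 < B := by positivity
      set v := Ex fun π => A.Vbar (A.z π t)
      have h16 : 16 * n * a ≤ 1 := by
        rw [le_div_iff₀ (by positivity)] at h1
        linarith
      -- l·f - 2B·l² is maximal at l = f/(4B), which is admissible when f ≤ 4B; otherwise l = 1.
      rcases le_total f (4 * B) with hfB | hfB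
      · have k1 := key (f / (4 * B)) (by positivity) ((div_le_one (by positivity)).2 hfB)
        have k2 : f / (4 * B) * f - (f / (4 * B)) ^ 2 * (2 * B) = f ^ 2 / (8 * B) := by
          field_simp
          ring
        rw [k2] at k1
        have k3 : (s * f) ^ 2 / (32 * n * B) ≤ 1 / 4 * (s ^ 2 * v) := by
          rw [div_le_iff₀ (by positivity)] at k1 ⊢
          have := mul_le_mul_of_nonneg_left k1 (sq_nonneg s)
          linarith
        -- Young's inequality matches the growth of the weight with the quadratic progress. Since
        -- 32nB·a ≤ F(x₀), each index costs at most a·F(x₀).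
        have k4 : 2 * a * (s * f) ≤ (s * f) ^ 2 / (32 * n * B) + 32 * n * B * a ^ 2 := by
          rw [← sub_le_iff_le_add, le_div_iff₀ (by positivity)]
          nlinarith [sq_nonneg (s * f - 32 * n * B * a)]
        have k5 := mul_le_mul_of_nonneg_left h2 h0
        have k6 : a * (32 * n * A.Γ * R ^ 2) = 32 * n * B * a := by rw [hB]; ring
        rw [k6] at k5
        linarith
      · have k1 := key 1 zero_le_one le_rfl
        have k2 : f / 2 ≤ n * v := by linarith
        have k3 := mul_le_mul_of_nonneg_left k2 (show 0 ≤ a * s ^ 2 by positivity)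
        have k4 := mul_le_mul_of_nonneg_right h16 (mul_nonneg (sq_nonneg s) hV0)
        have k5 : s * f ≤ s ^ 2 * f := by
          have := mul_le_mul_of_nonneg_right hs1 (mul_nonneg (zero_le_one.trans hs1) hf0)
          linarith
        have k6 := mul_le_mul_of_nonneg_left k5 h0
        have k7 : 0 ≤ a * A.F A.x₀ := by positivity
        linarith
  have h5 := Finset.sum_le_sum fun t (_ : t ∈ Finset.univ) => h3 t
  rw [Finset.sum_add_distrib, Finset.sum_ite_eq' , if_pos (Finset.mem_univ _),
    Finset.sum_sub_distrib, ← Finset.mul_sum, Finset.sum_const, Finset.card_univ,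
    Fintype.card_fin, nsmul_eq_mul] at h5
  have h6 := h.trans h5
  have e : (((T - 1 : ℕ) : ℕ) : ℝ) = (T : ℝ) - 1 := by
    rw [Nat.cast_sub A.T_pos, Nat.cast_one]
  rw [e] at h6
  have h7 : (0 : ℝ) ≤ (T : ℝ) - 1 := by
    rw [← e]; positivity
  have h8 : 0 < 1 + a * ((T : ℝ) - 1) := by positivity
  -- The left side carries (1 + a(T - 1))², the right side F(x₀)·(1 + a(T - 1)), so one factor
  -- cancels.
  rw [le_div_iff₀ h8]
  refine le_of_mul_le_mul_left ?_ h8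
  linarith

end AsyncRun

/-! ### Translation invariant kernels -/

namespace AsyncRun
variable {n T q : ℕ} (A : AsyncRun n T q)

/-- A translation invariant system of leaves, with kernels normalized as in `Fam`. -/
structure Kern (D : ℤ → List ℤ) (K : ℤ → Path n T → ℝ) : Prop where
  mean : ∀ s, MeanLe (D s) (K s)
  prec : ∀ s π, K s π ≠ 0 → ∀ d ∈ D s, A.prec π s d
  nodup : ∀ s π, K s π ≠ 0 → (D s).Nodup
  shift : ∃ E : List ℤ, ∀ s, D s = E.map (s + ·)

variable {A} {D : ℤ → List ℤ} {K K' : ℤ → Path n T → ℝ}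

lemma exists_depth (E : List ℤ) :
    ∃ δ : ℤ, 0 ≤ δ ∧ (∀ e ∈ E, -δ ≤ e) ∧ (δ = 0 ∨ -δ ∈ E) := by
  induction E with
  | nil => exact ⟨0, le_rfl, by simp, Or.inl rfl⟩
  | cons e E ih =>
    obtain ⟨δ, h0, h1, h2⟩ := ih
    by_cases he : e < -δ
    · refine ⟨-e, by omega, fun e' h => ?_, Or.inr (by simp)⟩
      rcases List.mem_cons.1 h with rfl | h
      · simp
      · have := h1 e' h
        omega
    · refine ⟨δ, h0, fun e' h => ?_, h2.imp id fun h => List.mem_cons_of_mem _ h⟩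
      rcases List.mem_cons.1 h with rfl | h
      · omega
      · exact h1 e' h

/-- By translation invariance the lowest leaf sits at a fixed offset from the root. -/
lemma Kern.fam (h : A.Kern D K) : ∃ δ, A.Fam δ D K := by
  obtain ⟨E, hE⟩ := h.shift
  obtain ⟨δ, h0, h1, h2⟩ := exists_depth E
  refine ⟨δ, h.mean, h.prec, h.nodup, h0, fun s d hd => ?_, h2.imp id fun h s => ?_⟩
  · rw [hE] at hd
    obtain ⟨e, he, rfl⟩ := List.mem_map.1 hd
    have := h1 e he
    omega
  · rw [hE]
    exact List.mem_map.2 ⟨-δ, h, by ring⟩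

lemma Kern.one : A.Kern (fun _ => []) (fun _ _ => 1) where
  mean s := ⟨fun _ => zero_le_one, fun _ => le_rfl⟩
  prec s π _ d hd := by simp at hd
  nodup s π _ := List.nodup_nil
  shift := ⟨[], fun _ => rfl⟩

lemma Kern.nonneg (h : A.Kern D K) (s : ℤ) (π : Path n T) : 0 ≤ K s π := (h.mean s).1 π

/-- Change of the root by `m` and addition of a leaf. -/
lemma Kern.extend (h : A.Kern D K) (m : ℤ) {X : ℤ → ℤ} (hX : ∃ x, ∀ w, X w = w + x)
    {g : ℤ → Path n T → ℝ} (h0 : ∀ w π, 0 ≤ K' w π)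
    (hle : ∀ w π, K' w π ≤ K (w - m) π * g w π)
    (hx : ∀ w π, K' w π ≠ 0 → A.prec π w (X w) ∧
      ∀ d ∈ D (w - m), A.prec π w d ∧ d ≠ X w)
    (hg : ∀ w π, K' w π ≠ 0 → (∀ π, 0 ≤ g w π) ∧ (∀ d ∈ D (w - m), Free d (g w)) ∧
      ∀ π, av (X w) (g w) π ≤ 1) :
    A.Kern (fun w => X w :: D (w - m)) K' := by
  have hK : ∀ w π, K' w π ≠ 0 → K (w - m) π ≠ 0 := by
    intro w π h1 h2
    have h3 := hle w π
    rw [h2, zero_mul] at h3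
    exact h1 (le_antisymm h3 (h0 w π))
  refine ⟨fun w => ?_, fun w π h1 d hd => ?_, fun w π h1 => ?_, ?_⟩
  · exact (h.mean (w - m)).cons (p := ∃ π, K' w π ≠ 0) (h0 w) (hle w) (fun π h1 => ⟨π, h1⟩)
      fun ⟨π, h1⟩ => hg w π h1
  · rcases List.mem_cons.1 hd with rfl | hd
    · exact (hx w π h1).1
    · exact ((hx w π h1).2 d hd).1
  · exact List.nodup_cons.2 ⟨fun hc => ((hx w π h1).2 _ hc).2 rfl, h.nodup _ π (hK w π h1)⟩
  · obtain ⟨E, hE⟩ := h.shift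
    obtain ⟨x, hx⟩ := hX
    refine ⟨x :: E.map (· - m), fun w => ?_⟩
    rw [hx, hE, List.map_cons, List.map_map]
    congr 1
    exact List.map_congr_left fun e _ => by simp only [Function.comp]; ring

lemma pair_factor {G : Fin n → Fin n → ℝ} (hG0 : ∀ a b, 0 ≤ G a b)
    (hG : ∀ a, (1 / n : ℝ) * ∑ b, G a b ≤ 1) {a b : ℤ} (hab : a ≠ b) (hb : 0 ≤ b ∧ b < T)
    {L : List ℤ} (hL : ∀ d ∈ L, d ≠ a ∧ d ≠ b) :
    (∀ π, 0 ≤ G (A.pk π a) (A.pk π b)) ∧ (∀ d ∈ L, Free d fun π => G (A.pk π a) (A.pk π b)) ∧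
      ∀ π, av b (fun π => G (A.pk π a) (A.pk π b)) π ≤ 1 :=
  ⟨fun _ => hG0 _ _, fun d hd => free_pk_pk (hL d hd).1.symm (hL d hd).2.symm,
    av_pk_pk hG hab hb⟩

variable (A) in
/-- The value of the best step along the coordinate of `s`, relative to the mean. -/
def rat (π : Path n T) (r s : ℤ) : ℝ := A.Vz π r (A.pk π s) * (1 / A.Vb π r)

lemma rat_nonneg (π : Path n T) (r s : ℤ) : 0 ≤ A.rat π r s :=
  mul_nonneg (A.Vz_nonneg _ _ _) (one_div_nonneg.2 (A.Vb_nonneg _ _))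

lemma rat_mul (π : Path n T) (r s : ℤ) : A.rat π r s * A.Vb π r = A.Vz π r (A.pk π s) := by
  by_cases h : A.Vb π r = 0
  · rw [h, mul_zero, A.Vz_eq_zero_of π h]
  · rw [rat, mul_assoc, one_div_mul_cancel h, mul_one]

/-- V/`Vbar` has mean at most 1 over the pick of s, so a best-step value can itself become the
normalized factor of a leaf. If `Vbar` is 0, so is the quotient. -/
lemma rat_factor {r s : ℤ} (hrs : r ≤ s) (hs : 0 ≤ s ∧ s < T)
    {L : List ℤ} (hL : ∀ d ∈ L, r ≤ d ∧ d ≠ s) :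
    (∀ π, 0 ≤ A.rat π r s) ∧ (∀ d ∈ L, Free d fun π => A.rat π r s) ∧
      ∀ π, av s (fun π => A.rat π r s) π ≤ 1 := by
  refine ⟨fun π => rat_nonneg _ _ _, fun d hd π k => ?_, fun π => ?_⟩
  · have h1 := A.free_Vz_pk (hL d hd).1 (hL d hd).2.symm π k
    have h2 := A.free_Vb (hL d hd).1 π k
    simp only at h1 h2
    simp only [rat, h1, h2]
  · simp only [rat]
    rw [av_mul_free (Y := fun π => 1 / A.Vb π r) fun π k => by
      have := A.free_Vb hrs π k
      simp only [this], A.av_Vz_pk hrs hs]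
    by_cases h : A.Vb π r = 0
    · simp [h]
    · rw [mul_one_div_cancel h]

/-- Change of the summation index along a diagonal. -/
lemma sum_reroot {g : ℤ → ℤ → Path n T → ℝ} (h0 : ∀ s w π, 0 ≤ g s w π)
    (hz : ∀ s w π, w ∉ rng T → g s w π = 0) (j : ℤ) :
    ∑ s ∈ rng T, Ex (g s (s + j)) ≤ ∑ w ∈ rng T, Ex (g (w - j) w) :=
  sum_shift_le (g := fun s w => Ex (g s w)) (fun s w => Ex_nonneg (h0 s w)) (fun s w hw => by
    have : g s w = fun _ => 0 := funext fun π => hz s w π hw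
    rw [this, Ex_zero]) j

lemma Kern.edge (h : A.Kern D K) {G : Fin n → Fin n → ℝ} (hG0 : ∀ a b, 0 ≤ G a b)
    (hG : ∀ a, (1 / n : ℝ) * ∑ b, G a b ≤ 1) (j : ℤ) :
    A.Kern (fun w => (w - j) :: D (w - j))
      (fun w π => K (w - j) π * (G (A.pk π w) (A.pk π (w - j)) * ind (A.prec π w (w - j)))) := by
  have hne : ∀ w π, K (w - j) π * (G (A.pk π w) (A.pk π (w - j)) *
      ind (A.prec π w (w - j))) ≠ 0 → K (w - j) π ≠ 0 ∧ A.prec π w (w - j) := by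
    intro w π h1
    exact ⟨left_ne_zero_of_mul h1, of_ind_ne_zero (right_ne_zero_of_mul (right_ne_zero_of_mul h1))⟩
  refine h.extend j (g := fun w π => G (A.pk π w) (A.pk π (w - j))) ⟨-j, fun w => rfl⟩
    (fun w π => mul_nonneg (h.nonneg _ _) (mul_nonneg (hG0 _ _) (ind_nonneg _)))
    (fun w π => mul_le_mul_of_nonneg_left (mul_le_of_le_one_right (hG0 _ _) (ind_le_one _))
      (h.nonneg _ _)) (fun w π h1 => ?_) (fun w π h1 => ?_)
  · obtain ⟨h2, h3⟩ := hne w π h1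
    exact ⟨h3, fun d hd => ⟨h3.trans (h.prec _ π h2 d hd), (h.prec _ π h2 d hd).ne.symm⟩⟩
  · obtain ⟨h2, h3⟩ := hne w π h1
    exact pair_factor hG0 hG h3.ne h3.right_mem fun d hd =>
      ⟨(h3.trans (h.prec _ π h2 d hd)).ne.symm, (h.prec _ π h2 d hd).ne.symm⟩

end AsyncRun

/-! ### Fourth powers of ordered sums -/

/-- Weight of a fourth power in a sum of ordered terms. -/
def quartC (l : ℝ) : ℝ := l * (1 + 5 * l) ^ 3 / 125

/-- Relative growth of the fourth power of a sum when a term is added. -/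
def quartD (l : ℝ) : ℝ := (1 + 5 * l) ^ 3 - 1

lemma quartC_nonneg {l : ℝ} (h : 0 ≤ l) : 0 ≤ quartC l := by unfold quartC; positivity

lemma quartD_nonneg {l : ℝ} (h : 0 ≤ l) : 0 ≤ quartD l := by
  unfold quartD
  have : (1 : ℝ) ≤ (1 + 5 * l) ^ 3 := one_le_pow₀ (by linarith)
  linarith

/-- Convexity of x⁴ with weights 1/(1 + 5l) and 5l/(1 + 5l). The parameter 5 trades the growth of S⁴
for the factor 1/125 in front of y⁴. -/
lemma add_mul_pow_four_le {S l y : ℝ} (hl : 0 ≤ l) :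
    (S + l * y) ^ 4 ≤ (1 + quartD l) * S ^ 4 + quartC l * y ^ 4 := by
  have hc : ConvexOn ℝ Set.univ fun x : ℝ => x ^ 4 := Even.convexOn_pow (by decide)
  have h := hc.2 (Set.mem_univ ((1 + 5 * l) * S)) (Set.mem_univ ((1 + 5 * l) * y / 5))
    (show 0 ≤ 1 / (1 + 5 * l) by positivity) (show 0 ≤ 5 * l / (1 + 5 * l) by positivity)
    (by field_simp)
  simp only [smul_eq_mul] at h
  have e1 : 1 / (1 + 5 * l) * ((1 + 5 * l) * S) + 5 * l / (1 + 5 * l) * ((1 + 5 * l) * y / 5) =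
      S + l * y := by field_simp
  have e2 : 1 / (1 + 5 * l) * ((1 + 5 * l) * S) ^ 4 +
      5 * l / (1 + 5 * l) * ((1 + 5 * l) * y / 5) ^ 4 =
      (1 + quartD l) * S ^ 4 + quartC l * y ^ 4 := by
    unfold quartC quartD
    field_simp
    ring
  rw [e1, e2] at h
  exact h

/-- The terms are added in increasing order of c, so the i-th one is multiplied only by the growth
factors of later terms. With c the commit time, i can serve as a root and all the other factors
belong to leaves. -/
lemma sum_pow_four_le {ι : Type*} [DecidableEq ι] (s : Finset ι) (c : ι → ℝ)
    (hc : Function.Injective c) (l w : ι → ℝ) (hl : ∀ i, 0 ≤ l i) (hw : ∀ i, 0 ≤ w i) :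
    (∑ i ∈ s, l i * √(w i)) ^ 4 ≤
      ∑ i ∈ s, quartC (l i) * w i ^ 2 * ∏ k ∈ s with c i < c k, (1 + quartD (l k)) := by
  induction s using Finset.induction_on_max_value c with
  | empty => simp
  | insert a s ha hmax ih =>
    have hw4 : √(w a) ^ 4 = w a ^ 2 := by
      rw [show 4 = 2 * 2 by norm_num, pow_mul, Real.sq_sqrt (hw a)]
    have hlt : ∀ x ∈ s, c x < c a := fun x hx =>
      lt_of_le_of_ne (hmax x hx) fun h => ha (hc h ▸ hx)
    rw [Finset.sum_insert ha, Finset.sum_insert ha, add_comm (l a * _)]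
    refine (add_mul_pow_four_le (hl a)).trans ?_
    rw [hw4, add_comm]
    refine add_le_add (le_of_eq ?_) ?_
    · rw [Finset.prod_eq_one, mul_one]
      intro k hk
      rw [Finset.mem_filter, Finset.mem_insert] at hk
      rcases hk with ⟨rfl | hk, h⟩
      · exact absurd h (lt_irrefl _)
      · exact absurd h (hlt k hk).not_gt
    · refine (mul_le_mul_of_nonneg_left ih (by linarith [quartD_nonneg (hl a)])).trans
        (le_of_eq ?_)
      rw [Finset.mul_sum]
      refine Finset.sum_congr rfl fun i hi => ?_
      rw [Finset.filter_insert, if_pos (hlt i hi), Finset.prod_insert (by simp [ha])]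
      ring

/-- Products of factors of mean at most one, with respect to distinct picks. -/
lemma MeanLe.prod {n T : ℕ} {D : List ℤ} {K : Path n T → ℝ} (h : MeanLe D K)
    {a : ℤ → Path n T → ℝ} (l : List ℤ) (hl : l.Nodup)
    (ha : ∀ x ∈ l, (∀ π, 0 ≤ a x π) ∧ (∀ d ∈ D, Free d (a x)) ∧
      (∀ y ∈ l, y ≠ x → Free y (a x)) ∧ ∀ π, av x (a x) π ≤ 1) :
    MeanLe (l ++ D) fun π => K π * (l.map (a · π)).prod := by
  induction l with
  | nil => simpa using h
  | cons x l ih =>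
    have hx := ha x List.mem_cons_self
    have hl' := List.nodup_cons.1 hl
    have h1 := ih hl'.2 fun y hy => by
      have h2 := ha y (List.mem_cons_of_mem _ hy)
      exact ⟨h2.1, h2.2.1, fun w hw => h2.2.2.1 w (List.mem_cons_of_mem _ hw), h2.2.2.2⟩
    have h2 := h1.mul (x := x) (g := a x) hx.1 (fun d hd => by
      rcases List.mem_append.1 hd with hd | hd
      · exact hx.2.2.1 d (List.mem_cons_of_mem _ hd) (by rintro rfl; exact hl'.1 hd)
      · exact hx.2.1 d hd) hx.2.2.2
    rw [List.cons_append]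
    convert h2 using 2
    rw [List.map_cons, List.prod_cons]
    ring

/-! ### Means of the fourth-moment kernels -/

namespace AsyncRun
variable {n T q : ℕ} (A : AsyncRun n T q)

/-- Bounds for the means of `quartC` and `quartD` of the interactions. -/
def meanC (q : ℕ) : ℝ := (396 / 10000 / q + 215 * rbar q) / 125
def meanD (q : ℕ) : ℝ := 15 * (396 / 10000 / q) + 200 * rbar q

/-- Normalized kernels of the fourth moments. -/
def Hc (a b : Fin n) : ℝ := quartC (A.ell a b) / meanC q
def Hd (a b : Fin n) : ℝ := quartD (A.ell a b) / meanD q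

lemma meanC_pos (hq : 0 < q) : 0 < meanC q := by
  have := rbar_pos hq
  unfold meanC; positivity

lemma meanD_pos (hq : 0 < q) : 0 < meanD q := by
  have := rbar_pos hq
  unfold meanD; positivity

lemma Hc_nonneg (a b : Fin n) : 0 ≤ A.Hc a b := by
  have := rbar_nonneg q
  have := quartC_nonneg (A.ell_nonneg a b)
  unfold Hc meanC; positivity

lemma Hd_nonneg (a b : Fin n) : 0 ≤ A.Hd a b := by
  have := rbar_nonneg q
  have := quartD_nonneg (A.ell_nonneg a b)
  unfold Hd meanD; positivity

lemma mean_ell_sq_le (hq : 0 < q) (a : Fin n) : 1 / n * ∑ b, A.ell a b ^ 2 ≤ rbar q := by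
  have hn := A.n_cast_pos
  calc (1 / n : ℝ) * ∑ b, A.ell a b ^ 2 ≤ (1 / n) * (n * A.rho) :=
        mul_le_mul_of_nonneg_left (A.sum_ell_sq_le a) (by positivity)
    _ = A.rho := by field_simp
    _ ≤ _ := A.rho_le hq

/-- Cauchy–Schwarz from the mean square; 0.0396 exceeds 1/√640. -/
lemma mean_ell_le (hq : 0 < q) (a : Fin n) : 1 / n * ∑ b, A.ell a b ≤ 396 / 10000 / q := by
  have hn := A.n_cast_pos
  have hq' : (0 : ℝ) < q := by exact_mod_cast hq
  refine le_of_pow_le_pow_left₀ two_ne_zero (by positivity) ?_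
  have h1 := sq_sum_le_card_mul_sum_sq (s := Finset.univ) (f := fun b => A.ell a b)
  rw [Finset.card_univ, Fintype.card_fin] at h1
  calc (1 / n * ∑ b, A.ell a b) ^ 2 = (1 / n) ^ 2 * (∑ b, A.ell a b) ^ 2 := by ring
    _ ≤ (1 / n) ^ 2 * (n * ∑ b, A.ell a b ^ 2) := mul_le_mul_of_nonneg_left h1 (by positivity)
    _ = 1 / n * ∑ b, A.ell a b ^ 2 := by field_simp
    _ ≤ rbar q := A.mean_ell_sq_le hq a
    _ ≤ _ := by
      unfold rbar
      rw [div_pow, div_le_div_iff₀ (by positivity) (by positivity)]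
      nlinarith [sq_nonneg (q : ℝ)]

lemma mean_le_of_pointwise (hq : 0 < q) {h : ℝ → ℝ} {x y : ℝ} (hx : 0 ≤ x) (hy : 0 ≤ y)
    (hh : ∀ l, 0 ≤ l → l ≤ 1 → h l ≤ x * l + y * l ^ 2) (a : Fin n) :
    1 / n * ∑ b, h (A.ell a b) ≤ x * (396 / 10000 / q) + y * rbar q := by
  have hn := A.n_cast_pos
  calc 1 / n * ∑ b, h (A.ell a b) ≤ 1 / n * ∑ b, (x * A.ell a b + y * A.ell a b ^ 2) :=
        mul_le_mul_of_nonneg_left (Finset.sum_le_sum fun b _ =>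
          hh _ (A.ell_nonneg _ _) (A.ell_le_one _ _)) (by positivity)
    _ = x * (1 / n * ∑ b, A.ell a b) + y * (1 / n * ∑ b, A.ell a b ^ 2) := by
        rw [Finset.sum_add_distrib, ← Finset.mul_sum, ← Finset.mul_sum]; ring
    _ ≤ _ := add_le_add (mul_le_mul_of_nonneg_left (A.mean_ell_le hq a) hx)
        (mul_le_mul_of_nonneg_left (A.mean_ell_sq_le hq a) hy)

lemma mean_Hc (hq : 0 < q) (a : Fin n) : 1 / n * ∑ b, A.Hc a b ≤ 1 := by
  simp only [Hc, ← Finset.sum_div]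
  rw [← mul_div_assoc, div_le_one (meanC_pos hq)]
  refine (A.mean_le_of_pointwise hq (h := quartC) (x := 1 / 125) (y := 215 / 125) (by norm_num)
    (by norm_num) (fun l h0 h1 => ?_) a).trans (le_of_eq ?_)
  · unfold quartC
    have h2 : l ^ 3 ≤ l ^ 2 := pow_le_pow_of_le_one h0 h1 (by norm_num)
    have h3 : l ^ 4 ≤ l ^ 2 := pow_le_pow_of_le_one h0 h1 (by norm_num)
    nlinarith
  · unfold meanC; ring

lemma mean_Hd (hq : 0 < q) (a : Fin n) : 1 / n * ∑ b, A.Hd a b ≤ 1 := by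
  simp only [Hd, ← Finset.sum_div]
  rw [← mul_div_assoc, div_le_one (meanD_pos hq)]
  refine (A.mean_le_of_pointwise hq (h := quartD) (x := 15) (y := 200) (by norm_num)
    (by norm_num) (fun l h0 h1 => ?_) a).trans (le_of_eq ?_)
  · unfold quartD
    have h2 : l ^ 3 ≤ l ^ 2 := pow_le_pow_of_le_one h0 h1 (by norm_num)
    nlinarith
  · unfold meanD; ring

/-- The numerical bound of the total weight of the fourth moments. -/
lemma quart_total_le (hq : 0 < q) :
    2 * q * (meanC q * (1 + meanD q) ^ (2 * q - 1)) ≤ 115 / 10000 := by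
  have hq' : (0 : ℝ) < q := by exact_mod_cast hq
  set u := 1 / (q : ℝ) with hu
  have hqu : (q : ℝ) * u = 1 := by rw [hu]; field_simp
  have hC : 2 * q * meanC q = 2 / 125 * (396 / 10000 + 215 / 640 * u) := by
    unfold meanC rbar
    rw [hu]
    field_simp
  have hD : meanD q = 594 / 1000 * u + 3125 / 10000 * u ^ 2 := by
    unfold meanD rbar
    rw [hu]
    field_simp
    ring
  have hu0 : 0 < u := by positivity
  rw [← mul_assoc, hC]
  -- For q ≥ 2 the power is at most exp((2q - 1)·meanD) ≤ e^{1.19}. For q = 1 an exponential bound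
  -- would be too weak, and the value is computed.
  rcases Nat.lt_or_ge 1 q with h | h
  · have h2 : (2 : ℝ) ≤ q := by exact_mod_cast h
    have hu2 : u ≤ 1 / 2 := by
      rw [hu]; exact one_div_le_one_div_of_le (by norm_num) h2
    have e1 : (1 + meanD q) ^ (2 * q - 1) ≤ Real.exp (119 / 100) := by
      calc (1 + meanD q) ^ (2 * q - 1) ≤ Real.exp (meanD q) ^ (2 * q - 1) := by
            refine pow_le_pow_left₀ (by linarith [meanD_pos hq]) ?_ _
            linarith [Real.add_one_le_exp (meanD q)]
        _ = Real.exp ((2 * q - 1) * meanD q) := by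
            rw [← Real.exp_nat_mul, Nat.cast_sub (by omega)]
            push_cast
            rfl
        _ ≤ _ := by
            refine Real.exp_le_exp.2 ?_
            have : (2 * (q : ℝ) - 1) * meanD q = (2 - u) * (594 / 1000 + 3125 / 10000 * u) := by
              rw [hD]
              linear_combination (2 * (594 / 1000 + 3125 / 10000 * u)) * hqu
            rw [this]
            nlinarith [sq_nonneg (u - 5 / 100)]
    have e2 : Real.exp (119 / 100) ≤ 34 / 10 := by
      have h1 : Real.exp (19 / 100) ≤ 100 / 81 := by
        have h2 := Real.add_one_le_exp (-(19 / 100 : ℝ))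
        rw [Real.exp_neg, le_inv_comm₀ (by norm_num) (Real.exp_pos _)] at h2
        exact h2.trans (by norm_num)
      rw [show (119 / 100 : ℝ) = 1 + 19 / 100 by norm_num, Real.exp_add]
      have h3 := Real.exp_one_lt_d9
      calc _ ≤ (2.7182818286 : ℝ) * (100 / 81) :=
            mul_le_mul h3.le h1 (Real.exp_pos _).le (by norm_num)
        _ ≤ _ := by norm_num
    calc _ ≤ 2 / 125 * (396 / 10000 + 215 / 640 * (1 / 2)) * (34 / 10) :=
          mul_le_mul (by linarith) (e1.trans e2) (pow_nonneg (by linarith [meanD_pos hq]) _)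
            (by norm_num)
      _ ≤ _ := by norm_num
  · have : q = 1 := by omega
    subst this
    have : u = 1 := by rw [hu]; norm_num
    rw [hD, this]
    norm_num

end AsyncRun

/-! ### Fourth moments of the errors -/

namespace AsyncRun
variable {n T q : ℕ} (A : AsyncRun n T q)

/-- The kernel of a term of the expansion of the fourth power of an error. -/
def quartK (π : Path n T) (s v : ℤ) (B : Finset ℤ) : ℝ :=
  A.Hc (A.pk π v) (A.pk π s) * ind (A.prec π v s) *
    ∏ b ∈ B, ind (A.prec π v (s + b)) * ind (A.prec π (s + b) s) *
      A.Hd (A.pk π s) (A.pk π (s + b))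

lemma quartK_nonneg (π : Path n T) (s v : ℤ) (B : Finset ℤ) : 0 ≤ A.quartK π s v B :=
  mul_nonneg (mul_nonneg (A.Hc_nonneg _ _) (ind_nonneg _)) (Finset.prod_nonneg fun _ _ =>
    mul_nonneg (mul_nonneg (ind_nonneg _) (ind_nonneg _)) (A.Hd_nonneg _ _))

/-- The product of growth factors in `sum_pow_four_le` is expanded over the set B of offsets whose
updates contribute `quartD`. They commit between the distinguished update s + j and s. -/
lemma ez_pow_four_le (π : Path n T) (s : ℤ) :
    A.ez π s ^ 4 ≤ ∑ j ∈ offs q q, ∑ B ∈ ((offs q q).erase j).powerset,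
      meanC q * meanD q ^ B.card * (A.quartK π s (s + j) B * A.Wz π (s + j) ^ 2) := by
  have hr := rbar_nonneg q
  have hC0 : 0 ≤ meanC q := by unfold meanC; positivity
  have hD0 : 0 ≤ meanD q := by unfold meanD; positivity
  have hterm : ∀ w (B : Finset ℤ), 0 ≤
      meanC q * meanD q ^ B.card * (A.quartK π s w B * A.Wz π w ^ 2) := fun w B =>
    mul_nonneg (by positivity) (mul_nonneg (A.quartK_nonneg _ _ _ _) (sq_nonneg _))
  rcases index_cases T s with ⟨s, rfl⟩ | h
  · set P : Fin T → Prop := fun v => A.S.start π s ≤ A.S.commit π v ∧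
      A.S.commit π v < A.S.commit π s with hP
    have hS : ∀ v, P v → ((v : ℕ) : ℤ) - (s : ℕ) ∈ offs q q := by
      rintro v ⟨h1, h2⟩
      have h3 := A.le_add_of_commit_lt h2
      have h4 := A.le_add_of_start_le h1
      have h5 : v ≠ s := by rintro rfl; linarith
      have h6 : (v : ℕ) ≠ s := fun hc => h5 (Fin.ext hc)
      rw [mem_offs]
      omega
    simp only [ez, zx_coe, eps]
    refine (sum_pow_four_le (Finset.univ.filter P) (A.S.commit π) (A.valid.commit_injective π)
      (fun v => A.ell (π v) (π s)) (A.W π) (fun v => A.ell_nonneg _ _) (A.W_nonneg π)).trans ?_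
    have key := sum_fin_le (P := P) (J := offs q q) (s := ((s : ℕ) : ℤ))
      (h := fun v => quartC (A.ell (π v) (π s)) * A.W π v ^ 2 *
        ∏ k ∈ (Finset.univ.filter P) with A.S.commit π v < A.S.commit π k,
          (1 + quartD (A.ell (π k) (π s))))
      (H := fun w => ∑ B ∈ ((offs q q).erase (w - (s : ℕ))).powerset,
        meanC q * meanD q ^ B.card * (A.quartK π (s : ℕ) w B * A.Wz π w ^ 2))
      (fun w => Finset.sum_nonneg fun B _ => hterm w B) hS ?_
    · simpa only [add_sub_cancel_left] using key
    intro v hv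
    have hv' := hS v hv
    have hq : 0 < q := by
      rw [mem_offs] at hv'
      omega
    have hCp := meanC_pos hq
    have hDp := meanD_pos hq
    set a : ℤ → ℝ := fun k => ind (A.prec π (v : ℕ) ((s : ℕ) + k)) *
      ind (A.prec π ((s : ℕ) + k) (s : ℕ)) * A.Hd (A.pk π (s : ℕ)) (A.pk π ((s : ℕ) + k)) with ha
    have ha0 : ∀ k, 0 ≤ a k := fun k =>
      mul_nonneg (mul_nonneg (ind_nonneg _) (ind_nonneg _)) (A.Hd_nonneg _ _)
    have h1 : ∏ k ∈ (Finset.univ.filter P) with A.S.commit π v < A.S.commit π k,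
          (1 + quartD (A.ell (π k) (π s))) ≤
        ∏ k ∈ (offs q q).erase ((v : ℕ) - (s : ℕ)), (1 + meanD q * a k) := by
      set Q := (Finset.univ.filter P).filter fun k => A.S.commit π v < A.S.commit π k
      calc ∏ k ∈ Q, (1 + quartD (A.ell (π k) (π s)))
          = ∏ k ∈ Q, (1 + meanD q * a ((k : ℕ) - (s : ℕ))) := by
            refine Finset.prod_congr rfl fun k hk => ?_
            have hk' : P k ∧ A.S.commit π v < A.S.commit π k := by simpa [Q] using hk
            have e1 := prec_coe.2 hk'.2
            have e2 := prec_coe.2 hk'.1.2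
            simp only [ha, add_sub_cancel, ind_of e1, ind_of e2, Hd, pk, zx_coe]
            rw [A.ell_symm (π k), one_mul, one_mul, mul_div_cancel₀ _ hDp.ne']
        _ = ∏ k ∈ Q.image fun k : Fin T => ((k : ℕ) : ℤ) - (s : ℕ), (1 + meanD q * a k) := by
            rw [Finset.prod_image]
            intro a _ b _ hab
            simp only [sub_left_inj, Nat.cast_inj] at hab
            exact Fin.ext hab
        _ ≤ _ := by
            refine Finset.prod_le_prod_of_subset_of_one_le (fun j hj => ?_)
              (fun k _ => by have := ha0 k; positivity)
              fun k _ _ => by have := mul_nonneg hD0 (ha0 k); linarith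
            obtain ⟨k, hk, rfl⟩ := Finset.mem_image.1 hj
            have hk' : P k ∧ A.S.commit π v < A.S.commit π k := by simpa [Q] using hk
            refine Finset.mem_erase.2 ⟨fun hc => ?_, hS k hk'.1⟩
            have : (k : ℕ) = v := by omega
            rw [Fin.ext this] at hk'
            exact lt_irrefl _ hk'.2
    refine (mul_le_mul_of_nonneg_left h1 (mul_nonneg (quartC_nonneg (A.ell_nonneg _ _))
      (sq_nonneg _))).trans (le_of_eq ?_)
    rw [Finset.prod_one_add, Finset.mul_sum]
    refine Finset.sum_congr rfl fun B _ => ?_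
    have e1 := prec_coe.2 hv.2
    rw [Finset.prod_mul_distrib, Finset.prod_const]
    simp only [quartK, Wz, zx_coe, ind_of e1, Hc, pk]
    field_simp
    simp only [ha, pk, zx_coe]
  · rw [ez, zx_of_not _ _ h]
    have : 0 ≤ ∑ j ∈ offs q q, ∑ B ∈ ((offs q q).erase j).powerset,
      meanC q * meanD q ^ B.card * (A.quartK π s (s + j) B * A.Wz π (s + j) ^ 2) :=
      Finset.sum_nonneg fun j _ => Finset.sum_nonneg fun B _ => hterm _ B
    simpa using this

variable {A} {D : ℤ → List ℤ} {K : ℤ → Path n T → ℝ}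

/-- On a nonzero path the commit order is: new root w, the updates of B, the old root w - j, the old
leaves. The means are taken over the old leaves, then over B, where `Hd` is averaged against the
pick of w - j, and finally over w - j, where `Hc` is averaged against the pick of w. -/
lemma Kern.quart (h : A.Kern D K) (hq : 0 < q) (j : ℤ) (B : Finset ℤ) :
    A.Kern (fun w => (w - j) :: (B.toList.map (w - j + ·) ++ D (w - j)))
      (fun w π => K (w - j) π * A.quartK π (w - j) w B) := by
  have hne : ∀ w π, K (w - j) π * A.quartK π (w - j) w B ≠ 0 → K (w - j) π ≠ 0 ∧
      A.prec π w (w - j) ∧ ∀ b ∈ B, A.prec π w (w - j + b) ∧ A.prec π (w - j + b) (w - j) := by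
    intro w π h1
    have h2 := right_ne_zero_of_mul h1
    have h3 := Finset.prod_ne_zero_iff.1 (right_ne_zero_of_mul h2)
    refine ⟨left_ne_zero_of_mul h1, of_ind_ne_zero (right_ne_zero_of_mul (left_ne_zero_of_mul h2)),
      fun b hb => ?_⟩
    have h4 := left_ne_zero_of_mul (h3 b hb)
    exact ⟨of_ind_ne_zero (left_ne_zero_of_mul h4), of_ind_ne_zero (right_ne_zero_of_mul h4)⟩
  have hBnd : ∀ s : ℤ, (B.toList.map (s + ·)).Nodup := fun s =>
    B.nodup_toList.map fun a b hab => by simpa using hab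
  have h0 : ∀ w π, 0 ≤ K (w - j) π * A.quartK π (w - j) w B := fun w π =>
    mul_nonneg (h.nonneg _ _) (A.quartK_nonneg _ _ _ _)
  refine ⟨fun w => ?_, fun w π h1 d hd => ?_, fun w π h1 => ?_, ?_⟩
  · by_cases hp : ∃ π, K (w - j) π * A.quartK π (w - j) w B ≠ 0
    · obtain ⟨π₀, h1⟩ := hp
      obtain ⟨h2, h3, h4⟩ := hne w π₀ h1
      have h5 := h.prec _ π₀ h2
      have h6 := (h.mean (w - j)).prod (a := fun x π => A.Hd (A.pk π (w - j)) (A.pk π x))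
        (B.toList.map (w - j + ·)) (hBnd _) (by
          intro x hx
          obtain ⟨b, hb, rfl⟩ := List.mem_map.1 hx
          have h7 := (h4 b (Finset.mem_toList.1 hb)).2
          have h8 := pair_factor (A := A) A.Hd_nonneg (A.mean_Hd hq) h7.ne.symm h7.left_mem
            (L := D (w - j)) fun d hd => ⟨(h5 d hd).ne.symm, (h7.trans (h5 d hd)).ne.symm⟩
          refine ⟨h8.1, h8.2.1, fun y hy hyx => ?_, h8.2.2⟩
          obtain ⟨b', hb', rfl⟩ := List.mem_map.1 hy
          exact free_pk_pk (h4 b' (Finset.mem_toList.1 hb')).2.ne.symm hyx.symm)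
      have h7 := h6.mul (x := w - j) (g := fun π => A.Hc (A.pk π w) (A.pk π (w - j)))
        (fun π => A.Hc_nonneg _ _) (fun d hd => by
          refine free_pk_pk ?_ ?_
          · rcases List.mem_append.1 hd with hd | hd
            · obtain ⟨b, hb, rfl⟩ := List.mem_map.1 hd
              exact (h4 b (Finset.mem_toList.1 hb)).1.ne
            · exact (h3.trans (h5 d hd)).ne
          · rcases List.mem_append.1 hd with hd | hd
            · obtain ⟨b, hb, rfl⟩ := List.mem_map.1 hd
              exact (h4 b (Finset.mem_toList.1 hb)).2.ne.symm
            · exact (h5 d hd).ne) (av_pk_pk (A.mean_Hc hq) h3.ne h3.right_mem)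
      refine h7.mono (h0 w) fun π => ?_
      rw [mul_assoc]
      refine mul_le_mul_of_nonneg_left ?_ (h.nonneg _ _)
      rw [quartK, List.map_map, mul_comm]
      have e : (B.toList.map ((fun x => A.Hd (A.pk π (w - j)) (A.pk π x)) ∘ (w - j + ·))).prod =
          ∏ b ∈ B, A.Hd (A.pk π (w - j)) (A.pk π (w - j + b)) := Finset.prod_map_toList B _
      rw [e]
      refine mul_le_mul (Finset.prod_le_prod (fun b _ => ?_) fun b _ => ?_)
        (mul_le_of_le_one_right (A.Hc_nonneg _ _) (ind_le_one _))
        (mul_nonneg (A.Hc_nonneg _ _) (ind_nonneg _))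
        (Finset.prod_nonneg fun _ _ => A.Hd_nonneg _ _)
      · exact mul_nonneg (mul_nonneg (ind_nonneg _) (ind_nonneg _)) (A.Hd_nonneg _ _)
      · exact mul_le_of_le_one_left (A.Hd_nonneg _ _)
          (mul_le_one₀ (ind_le_one _) (ind_nonneg _) (ind_le_one _))
    · push Not at hp
      exact MeanLe.of_eq_zero hp
  · obtain ⟨h2, h3, h4⟩ := hne w π h1
    rcases List.mem_cons.1 hd with rfl | hd
    · exact h3
    rcases List.mem_append.1 hd with hd | hd
    · obtain ⟨b, hb, rfl⟩ := List.mem_map.1 hd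
      exact (h4 b (Finset.mem_toList.1 hb)).1
    · exact h3.trans (h.prec _ π h2 d hd)
  · obtain ⟨h2, h3, h4⟩ := hne w π h1
    refine List.nodup_cons.2 ⟨fun hc => ?_, List.Nodup.append (hBnd _) (h.nodup _ π h2) ?_⟩
    · rcases List.mem_append.1 hc with hd | hd
      · obtain ⟨b, hb, hb'⟩ := List.mem_map.1 hd
        exact (h4 b (Finset.mem_toList.1 hb)).2.ne hb'
      · exact (h.prec _ π h2 _ hd).ne rfl
    · intro d hd hd'
      obtain ⟨b, hb, rfl⟩ := List.mem_map.1 hd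
      exact ((h4 b (Finset.mem_toList.1 hb)).2.trans (h.prec _ π h2 _ hd')).ne rfl
  · obtain ⟨E, hE⟩ := h.shift
    refine ⟨-j :: (B.toList.map (· - j) ++ E.map (· - j)), fun w => ?_⟩
    rw [hE, List.map_cons, List.map_append, List.map_map, List.map_map]
    congr 2
    · exact List.map_congr_left fun e _ => by simp only [Function.comp]; ring
    · exact List.map_congr_left fun e _ => by simp only [Function.comp]; ring

/-- Fourth moments of the errors, from the second moments of the steps. -/
lemma Kern.sum_ez_pow_four_le (h : A.Kern D K) {c : ℝ} (hc : 0 ≤ c)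
    (hS : ∀ D' K', A.Kern D' K' → (∀ s, ∃ t, (D t).length < (D' s).length) →
      ∑ s ∈ rng T, Ex (fun π => K' s π * A.Wz π s ^ 2) ≤ c) :
    ∑ s ∈ rng T, Ex (fun π => K s π * A.ez π s ^ 4) ≤ 115 / 10000 * c := by
  rcases Nat.eq_zero_or_pos q with rfl | hq
  · have : ∀ π s, A.ez π s ^ 4 ≤ 0 := fun π s => by
      refine (A.ez_pow_four_le π s).trans (le_of_eq ?_)
      have : offs 0 0 = ∅ := by simp [← Finset.card_eq_zero, card_offs]
      rw [this, Finset.sum_empty]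
    refine (Finset.sum_nonpos fun s _ => ?_).trans (by positivity)
    rw [← Ex_zero (n := n) (T := T)]
    exact Ex_mono fun π => mul_nonpos_of_nonneg_of_nonpos (h.nonneg _ _) (this π s)
  have hCp := meanC_pos hq
  have hDp := meanD_pos hq
  have h1 : ∀ s, Ex (fun π => K s π * A.ez π s ^ 4) ≤
      ∑ j ∈ offs q q, ∑ B ∈ ((offs q q).erase j).powerset, meanC q * meanD q ^ B.card *
        Ex fun π => K s π * (A.quartK π s (s + j) B * A.Wz π (s + j) ^ 2) := by
    intro s
    simp only [← Ex_mul, ← Ex_sum]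
    refine Ex_mono fun π => ?_
    refine (mul_le_mul_of_nonneg_left (A.ez_pow_four_le π s) (h.nonneg s π)).trans (le_of_eq ?_)
    simp only [Finset.mul_sum]
    exact Finset.sum_congr rfl fun j _ => Finset.sum_congr rfl fun B _ => by ring
  refine (Finset.sum_le_sum fun s _ => h1 s).trans ?_
  rw [Finset.sum_comm]
  have h2 : ∀ j ∈ offs q q, ∑ s ∈ rng T, ∑ B ∈ ((offs q q).erase j).powerset,
      meanC q * meanD q ^ B.card *
        Ex (fun π => K s π * (A.quartK π s (s + j) B * A.Wz π (s + j) ^ 2)) ≤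
      meanC q * (1 + meanD q) ^ (2 * q - 1) * c := by
    intro j hj
    rw [Finset.sum_comm]
    have h3 : ∀ B ∈ ((offs q q).erase j).powerset, ∑ s ∈ rng T, meanC q * meanD q ^ B.card *
        Ex (fun π => K s π * (A.quartK π s (s + j) B * A.Wz π (s + j) ^ 2)) ≤
        meanC q * meanD q ^ B.card * c := by
      intro B _
      rw [← Finset.mul_sum]
      refine mul_le_mul_of_nonneg_left ?_ (by positivity)
      refine (sum_reroot (g := fun s w π => K s π * (A.quartK π s w B * A.Wz π w ^ 2))
        (fun s w π => mul_nonneg (h.nonneg _ _)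
          (mul_nonneg (A.quartK_nonneg _ _ _ _) (sq_nonneg _)))
        (fun s w π hw => by rw [A.Wz_of_notMem π hw]; ring) j).trans ?_
      refine le_trans (le_of_eq ?_) (hS _ _ (h.quart hq j B) fun s => ⟨s - j, ?_⟩)
      · refine Finset.sum_congr rfl fun w _ => ?_
        congr 1
        ext π
        ring
      · simp only [List.length_cons, List.length_append]
        omega
    refine (Finset.sum_le_sum h3).trans (le_of_eq ?_)
    have h4 : ((offs q q).erase j).card = 2 * q - 1 := by
      rw [Finset.card_erase_of_mem hj, card_offs]
      omega
    -- The sum of meanD^|B| over all subsets of the 2q - 1 remaining offsets is (1 + meanD)^(2q -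
    -- 1).
    have h5 := Finset.prod_one_add (f := fun _ : ℤ => meanD q) ((offs q q).erase j)
    simp only [Finset.prod_const, h4] at h5
    rw [h5, Finset.mul_sum, Finset.sum_mul]
  refine (Finset.sum_le_card_nsmul _ _ _ h2).trans ?_
  rw [card_offs, nsmul_eq_mul]
  push_cast
  have h3 := mul_le_mul_of_nonneg_right (quart_total_le hq) hc
  linarith

end AsyncRun

/-! ### Second moments weighted by accumulated errors -/

namespace AsyncRun
variable {n T q : ℕ} (A : AsyncRun n T q)

lemma Om_eq_add (π : Path n T) {a b : ℝ} (h : a ≤ b) :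
    A.Om π b = A.Om π a + ∑ u with a ≤ A.S.commit π u ∧ A.S.commit π u < b, A.eps π u ^ 2 := by
  rw [Om, Om, add_assoc]
  congr 1
  rw [← Finset.sum_union]
  · congr 1
    ext u
    simp only [Finset.mem_union, mem_below, Finset.mem_filter, Finset.mem_univ, true_and]
    constructor
    · intro hu
      rcases lt_or_ge (A.S.commit π u) a with h1 | h1
      · exact Or.inl h1
      · exact Or.inr ⟨h1, hu⟩
    · rintro (h1 | h1)
      · exact h1.trans_le h
      · exact h1.2
  · rw [Finset.disjoint_left]
    intro u hu hu'
    rw [mem_below] at hu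
    simp only [Finset.mem_filter, Finset.mem_univ, true_and] at hu'
    linarith [hu'.1]

lemma Oc_le_Os_add (π : Path n T) {r s : ℤ} (hr : 0 ≤ r) (hrs : r ≤ s) (hsr : s ≤ r + q)
    (hs : s < T) : A.Oc π s ≤ A.Os π r + ∑ j ∈ offs (2 * q) q,
      ind (A.prec π (s + j) s) * ind (A.after π r (s + j)) * A.ez π (s + j) ^ 2 := by
  rcases index_cases T s with ⟨s, rfl⟩ | h
  · rcases index_cases T r with ⟨r, rfl⟩ | h'
    · have hrs' : r ≤ s := by rw [Fin.le_def]; omega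
      have h1 := ((A.valid.start_strictMono π).monotone hrs').trans (A.start_le_commit π s)
      simp only [Oc, Os, zx_coe]
      rw [A.Om_eq_add π h1]
      refine add_le_add le_rfl (sum_fin_le (s := ((s : ℕ) : ℤ))
        (H := fun w => ind (A.prec π w (s : ℕ)) * ind (A.after π (r : ℕ) w) * A.ez π w ^ 2)
        (fun w => mul_nonneg (mul_nonneg (ind_nonneg _) (ind_nonneg _)) (sq_nonneg _)) ?_ ?_)
      · rintro v ⟨h2, h3⟩
        have h4 := A.le_add_of_commit_lt h3
        have h5 := A.le_add_of_start_le h2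
        have h6 : v ≠ s := by rintro rfl; linarith
        have h7 : (v : ℕ) ≠ s := fun hc => h6 (Fin.ext hc)
        rw [mem_offs]
        omega
      · rintro v ⟨h2, h3⟩
        have h4 : A.after π (r : ℕ) (v : ℕ) := ⟨r, v, rfl, rfl, h2⟩
        rw [ind_of h4, ind_of (prec_coe.2 h3), one_mul, one_mul, ez, zx_coe]
    · exact absurd ⟨hr, by omega⟩ h'
  · exact absurd ⟨by omega, hs⟩ h

lemma Os_le_Oc {π : Path n T} {r x : ℤ} (h : A.after π r x) : A.Os π r ≤ A.Oc π x := by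
  obtain ⟨r, x, rfl, rfl, h⟩ := h
  simp only [Os, Oc, zx_coe]
  exact A.Om_mono h

lemma om_nonneg : 0 ≤ A.om := le_max_of_le_right (Real.sqrt_nonneg _)

lemma q_om_le : q * A.om ≤ 9 / 100 := by
  have hq : (0 : ℝ) ≤ q := Nat.cast_nonneg q
  unfold om
  rw [mul_max_of_nonneg _ _ hq]
  refine max_le ?_ ?_
  · have := A.nu_le
    rwa [mul_one_div]
  · refine le_of_pow_le_pow_left₀ two_ne_zero (by norm_num) ?_
    have hρ : 0 ≤ A.rho := A.rho_nonneg
    rw [mul_pow, Real.sq_sqrt hρ]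
    exact A.q_sq_rho_le.trans (by norm_num)

/-- The sum of the mean values of the best steps, weighted by the accumulated errors. -/
def base₂ : ℝ := ∑ s ∈ rng T, Ex fun π => A.Os π s * A.Vb π s

lemma base₂_nonneg : 0 ≤ A.base₂ := Finset.sum_nonneg fun _ _ => Ex_nonneg fun _ =>
  mul_nonneg (A.Os_nonneg _ _) (A.Vb_nonneg _ _)

/-- Bounds of second moments for kernels with many leaves. -/
structure Bounds (L : ℕ) : Prop where
  head : ∀ {D : ℤ → List ℤ} {K : ℤ → Path n T → ℝ}, A.Kern D K → (∀ s, L ≤ (D s).length) →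
    ∀ hd : ℤ → ℤ, (∀ s, hd s ∈ D s) →
    (∀ s π, K s π ≠ 0 → ∀ d ∈ D s, d = hd s ∨ A.prec π (hd s) d) →
    (∀ s, ∃ d ∈ D s, d ≤ s + 3 * q) →
    ∑ s ∈ rng T, Ex (fun π => K s π * (A.Oc π (hd s) * A.Wz π s)) ≤ 49 / 10 * A.base₂
  square : ∀ {D : ℤ → List ℤ} {K : ℤ → Path n T → ℝ}, A.Kern D K → (∀ s, L ≤ (D s).length) →
    ∑ s ∈ rng T, Ex (fun π => K s π * A.Wz π s ^ 2) ≤ 105 / 10 * A.base₂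
  pair : ∀ {D : ℤ → List ℤ} {K : ℤ → Path n T → ℝ}, A.Kern D K → (∀ s, L ≤ (D s).length) →
    ∀ i : ℤ, (∀ s π, K s π ≠ 0 → A.prec π (s + i) s) → (∀ s, ∃ d ∈ D s, d ≤ s + i + 3 * q) →
    q * ∑ s ∈ rng T, Ex (fun π => K s π * (A.Wz π (s + i) * A.Wz π s)) ≤ 83 / 10 * A.base₂

variable {A} {D : ℤ → List ℤ} {K : ℤ → Path n T → ℝ} {L : ℕ}

lemma Kern.length_le (h : A.Kern D K) {s : ℤ} {π : Path n T} (hK : K s π ≠ 0) :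
    (D s).length ≤ T := by
  obtain ⟨δ, hf⟩ := h.fam
  exact hf.length_le hK

/-- After rerooting, the accumulated error stays attached to the old root, now the earliest
committed leaf. This is the situation of `Bounds.head`. -/
lemma Kern.head_edge_le (h : A.Kern D K) (hB : A.Bounds L) (hL : ∀ s, L ≤ (D s).length + 1)
    {G : Fin n → Fin n → ℝ} (hG0 : ∀ a b, 0 ≤ G a b)
    (hG : ∀ a, (1 / n : ℝ) * ∑ b, G a b ≤ 1) {j : ℤ} (hj : -(3 * q : ℤ) ≤ j) :
    ∑ s ∈ rng T, Ex (fun π => K s π * (A.Oc π s * A.edge G π s (s + j))) ≤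
      49 / 10 * A.base₂ := by
  obtain ⟨δ, hf⟩ := h.fam
  refine (hf.sum_edge_le hG0 (X := fun s π => A.Oc π s) (fun s π => A.Oc_nonneg π s) j).trans ?_
  refine hB.head (h.edge hG0 hG j) (fun s => ?_) (fun w => w - j) (fun s => List.mem_cons_self)
    (fun w π hK d hd => ?_) (fun w => ⟨w - j, List.mem_cons_self, by omega⟩)
  · have := hL (s - j)
    simpa using this
  · rcases List.mem_cons.1 hd with rfl | hd
    · exact Or.inl rfl
    · exact Or.inr (h.prec _ π (left_ne_zero_of_mul hK) d hd)

lemma Kern.sum_Oc_ez_sq_le (h : A.Kern D K) (hB : A.Bounds L)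
    (hL : ∀ s, L ≤ (D s).length + 1) :
    ∑ s ∈ rng T, Ex (fun π => K s π * (A.Oc π s * A.ez π s ^ 2)) ≤
      1 / 160 * (49 / 10 * A.base₂) := by
  have hr := rbar_nonneg q
  have h0 := A.base₂_nonneg
  have h1 : ∀ s, Ex (fun π => K s π * (A.Oc π s * A.ez π s ^ 2)) ≤ 2 * q * rbar q *
      ∑ j ∈ offs q q, Ex (fun π => K s π * (A.Oc π s * A.edge A.Gg π s (s + j))) := by
    intro s
    rw [← Ex_sum, ← Ex_mul]
    refine Ex_mono fun π => ?_
    have := mul_le_mul_of_nonneg_left (A.ez_sq_le π s)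
      (mul_nonneg (h.nonneg s π) (A.Oc_nonneg π s))
    rw [← mul_assoc]
    refine this.trans (le_of_eq ?_)
    simp only [Finset.mul_sum]
    exact Finset.sum_congr rfl fun j _ => by ring
  refine (Finset.sum_le_sum fun s _ => h1 s).trans ?_
  rw [← Finset.mul_sum, Finset.sum_comm]
  have h2 : ∀ j ∈ offs q q, ∑ s ∈ rng T,
      Ex (fun π => K s π * (A.Oc π s * A.edge A.Gg π s (s + j))) ≤ 49 / 10 * A.base₂ := by
    intro j hj
    have hq := q_pos_of_mem_offs (q := q) (a := 1) (b := 1) (by simpa using hj)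
    rw [mem_offs] at hj
    exact h.head_edge_le hB hL A.Gg_nonneg (A.mean_Gg hq) (by omega)
  have h3 := Finset.sum_le_card_nsmul _ _ _ h2
  rw [card_offs, nsmul_eq_mul] at h3
  refine (mul_le_mul_of_nonneg_left h3 (by positivity)).trans ?_
  push_cast
  have h4 : 2 * (q : ℝ) * rbar q * ((q + q) * (49 / 10 * A.base₂)) =
    4 * (q ^ 2 * rbar q) * (49 / 10 * A.base₂) := by ring
  rw [h4]
  exact mul_le_mul_of_nonneg_right (by linarith [q_sq_rbar_le q]) (by positivity)

/-- The kernel whose root is the earlier update `x`, with the previous root `x - j` as a leaf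
weighted by the relative value of its best step. -/
lemma Kern.rat (h : A.Kern D K) {δ : ℤ} (hf : A.Fam δ D K) (j : ℤ) :
    A.Kern (fun x => (x - j) :: D (x - j)) (fun x π => K (x - j) π *
      (A.rat π (x - j - δ) (x - j) * ind (A.prec π x (x - j)))) := by
  have hne : ∀ x π, K (x - j) π * (A.rat π (x - j - δ) (x - j) * ind (A.prec π x (x - j))) ≠ 0 →
      K (x - j) π ≠ 0 ∧ A.prec π x (x - j) := by
    intro w π h1
    exact ⟨left_ne_zero_of_mul h1, of_ind_ne_zero (right_ne_zero_of_mul (right_ne_zero_of_mul h1))⟩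
  have hδ := hf.δ_nonneg
  refine h.extend j (g := fun x π => A.rat π (x - j - δ) (x - j)) ⟨-j, fun w => rfl⟩
    (fun w π => mul_nonneg (h.nonneg _ _) (mul_nonneg (rat_nonneg _ _ _) (ind_nonneg _)))
    (fun w π => mul_le_mul_of_nonneg_left
      (mul_le_of_le_one_right (rat_nonneg _ _ _) (ind_le_one _)) (h.nonneg _ _))
    (fun w π h1 => ?_) (fun w π h1 => ?_)
  · obtain ⟨h2, h3⟩ := hne w π h1
    exact ⟨h3, fun d hd => ⟨h3.trans (h.prec _ π h2 d hd), (h.prec _ π h2 d hd).ne.symm⟩⟩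
  · obtain ⟨h2, h3⟩ := hne w π h1
    exact rat_factor (by omega) h3.right_mem fun d hd =>
      ⟨hf.lower _ d hd, (h.prec _ π h2 d hd).ne.symm⟩

/-- The accumulated error at the commit of s is its value at the start of s - δ, which is free of
all the picks involved and yields `base₂`, plus errors of updates x committed in between. For these,
V = `rat`·`Vbar` and `Vbar` ≤ `om`·`Oc` at x, so x becomes the root of a kernel with one more leaf;
q·`om` ≤ 0.09 keeps the loss small. -/
lemma Kern.sum_Oc_base_le (h : A.Kern D K) {δ : ℤ} (hf : A.Fam δ D K) (hB : A.Bounds L)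
    (hL : ∀ s, L ≤ (D s).length + 1) :
    ∑ s ∈ rng T, Ex (fun π => K s π * (A.Oc π s * A.Vz π (s - δ) (A.pk π s))) ≤
      101 / 100 * A.base₂ := by
  have h0 := A.base₂_nonneg
  have hδ := hf.δ_nonneg
  have h1 : ∀ s ∈ rng T, Ex (fun π => K s π * (A.Oc π s * A.Vz π (s - δ) (A.pk π s))) ≤
      Ex (fun π => A.Os π (s - δ) * A.Vb π (s - δ)) + ∑ j ∈ offs (2 * q) q,
        A.om * Ex (fun π => K s π * (A.rat π (s - δ) s * ind (A.prec π (s + j) s)) *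
          (A.Oc π (s + j) * A.ez π (s + j) ^ 2)) := by
    intro s hs
    have hs' : 0 ≤ s ∧ s < T := by simpa using hs
    have h2 := hf.base_le hs (X := fun π => A.Os π (s - δ)) (fun π => A.Os_nonneg _ _)
      (fun i hi => A.free_Os hi)
    refine le_trans ?_ (add_le_add h2 le_rfl)
    simp only [← Ex_mul]
    rw [← Ex_sum, ← Ex_add]
    refine Ex_mono fun π => ?_
    by_cases hK : K s π = 0
    · simp [hK]
    have h3 := hf.δ_le hK
    have h4 := A.Oc_le_Os_add π (hf.zero_le hK hs'.1) (by omega : s - δ ≤ s) (by omega) hs'.2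
    have hV := A.Vz_nonneg π (s - δ) (A.pk π s)
    have h5 := mul_le_mul_of_nonneg_left (mul_le_mul_of_nonneg_right h4 hV) (h.nonneg s π)
    refine h5.trans ?_
    rw [add_mul, mul_add, Finset.sum_mul, Finset.mul_sum]
    refine add_le_add le_rfl (Finset.sum_le_sum fun j _ => ?_)
    by_cases ha : A.after π (s - δ) (s + j)
    · rw [ind_of ha, mul_one, ← rat_mul]
      have h6 := (A.Vb_le π (s - δ)).trans
        (mul_le_mul_of_nonneg_left (A.Os_le_Oc ha) A.om_nonneg)
      have h7 := mul_le_mul_of_nonneg_left h6 (mul_nonneg (mul_nonneg (h.nonneg s π)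
        (mul_nonneg (rat_nonneg (A := A) π (s - δ) s) (ind_nonneg (A.prec π (s + j) s))))
        (sq_nonneg (A.ez π (s + j))))
      linarith
    · rw [ind_of_not ha]
      have := A.om_nonneg
      have := h.nonneg s π
      have := rat_nonneg (A := A) π (s - δ) s
      have := ind_nonneg (A.prec π (s + j) s)
      have := A.Oc_nonneg π (s + j)
      simp only [mul_zero, zero_mul]
      positivity
  refine (Finset.sum_le_sum h1).trans ?_
  rw [Finset.sum_add_distrib, Finset.sum_comm]
  have h2 : ∑ s ∈ rng T, Ex (fun π => A.Os π (s - δ) * A.Vb π (s - δ)) ≤ A.base₂ := by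
    refine (sum_shift_le (T := T) (g := fun _ r => Ex fun π => A.Os π r * A.Vb π r)
      (fun _ r => Ex_nonneg fun π => mul_nonneg (A.Os_nonneg _ _) (A.Vb_nonneg _ _))
      (fun _ r hr => ?_) (-δ)).trans le_rfl
    have : ∀ π, A.Vb π r = 0 := fun π => zx_of_not _ _ (by simpa using hr)
    simp only [this, mul_zero, Ex_zero]
  have h3 : ∀ j ∈ offs (2 * q) q, ∑ s ∈ rng T,
      A.om * Ex (fun π => K s π * (A.rat π (s - δ) s * ind (A.prec π (s + j) s)) *
          (A.Oc π (s + j) * A.ez π (s + j) ^ 2)) ≤ A.om * (1 / 160 * (49 / 10 * A.base₂)) := by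
    intro j _
    rw [← Finset.mul_sum]
    refine mul_le_mul_of_nonneg_left ?_ A.om_nonneg
    refine (sum_reroot (g := fun s x π => K s π * (A.rat π (s - δ) s * ind (A.prec π x s)) *
          (A.Oc π x * A.ez π x ^ 2)) (fun s w π => ?_) (fun s w π hw => ?_) j).trans ?_
    · exact mul_nonneg (mul_nonneg (h.nonneg _ _) (mul_nonneg (rat_nonneg _ _ _) (ind_nonneg _)))
        (mul_nonneg (A.Oc_nonneg _ _) (sq_nonneg _))
    · have : A.ez π w = 0 := zx_of_not _ _ (by simpa using hw)
      rw [this]; ring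
    · refine (h.rat hf j).sum_Oc_ez_sq_le hB fun s => ?_
      have := hL (s - j)
      simp only [List.length_cons]
      omega
  have h4 := Finset.sum_le_card_nsmul _ _ _ h3
  rw [card_offs, nsmul_eq_mul] at h4
  push_cast at h4
  have h5 : (2 * (q : ℝ) + q) * (A.om * (1 / 160 * (49 / 10 * A.base₂))) =
    (q * A.om) * (147 / 1600 * A.base₂) := by ring
  rw [h5] at h4
  have h6 := mul_le_mul_of_nonneg_right A.q_om_le (show 0 ≤ 147 / 1600 * A.base₂ by positivity)
  linarith

lemma Kern.sum_Oc_Rz_le (h : A.Kern D K) {δ : ℤ} (hf : A.Fam δ D K) (hB : A.Bounds L)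
    (hL : ∀ s, L ≤ (D s).length + 1) :
    ∑ s ∈ rng T, Ex (fun π => K s π * (A.Oc π s * A.Rz π (s - δ) s)) ≤ 36 / 10 * A.base₂ := by
  have h0 := A.base₂_nonneg
  refine (sum_Rz_le (X := fun s π => A.Oc π s) (c := 49 / 10 * A.base₂) (by positivity)
    (h.sum_Oc_base_le hf hB hL) fun G hG0 hG j hj => ?_).trans (by linarith)
  rw [mem_offs] at hj
  exact h.head_edge_le hB hL hG0 hG (by push_cast at hj; omega)

lemma Kern.sum_Oc_Wz_le (h : A.Kern D K) (hB : A.Bounds L) (hL : ∀ s, L ≤ (D s).length + 1) :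
    ∑ s ∈ rng T, Ex (fun π => K s π * (A.Oc π s * A.Wz π s)) ≤ 36 / 10 * A.base₂ := by
  obtain ⟨δ, hf⟩ := h.fam
  exact (hf.sum_Wz_le_sum_Rz (X := fun s π => A.Oc π s) fun s π => A.Oc_nonneg π s).trans
    (h.sum_Oc_Rz_le hf hB hL)

lemma Kern.sum_ez_four_le (h : A.Kern D K) (hB : A.Bounds L)
    (hL : ∀ s, L ≤ (D s).length + 1) :
    ∑ s ∈ rng T, Ex (fun π => K s π * A.ez π s ^ 4) ≤ 12075 / 100000 * A.base₂ := by
  have h0 := A.base₂_nonneg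
  refine (h.sum_ez_pow_four_le (c := 105 / 10 * A.base₂) (by positivity)
    fun D' K' h' hl => hB.square h' fun s => ?_).trans (le_of_eq (by ring))
  obtain ⟨t, ht⟩ := hl s
  have := hL t
  omega

lemma Wz_sq_le (π : Path n T) (s : ℤ) :
    A.Wz π s ^ 2 ≤ 2 * (A.Oc π s * A.Wz π s) + 27 * A.ez π s ^ 4 := by
  rcases index_cases T s with ⟨s, rfl⟩ | h
  · simp only [Wz, Oc, ez, zx_coe]
    have h1 := mul_le_mul_of_nonneg_right (A.F_mem_le_Om π (A.S.commit π s)) (A.W_nonneg π s)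
    linarith [A.W_sq_le π s]
  · simp [Wz, Oc, ez, zx_of_not _ _ h]

lemma Kern.sum_Wz_sq_le (h : A.Kern D K) (hB : A.Bounds L) (hL : ∀ s, L ≤ (D s).length + 1) :
    ∑ s ∈ rng T, Ex (fun π => K s π * A.Wz π s ^ 2) ≤ 105 / 10 * A.base₂ := by
  have h0 := A.base₂_nonneg
  have h1 : ∀ s, Ex (fun π => K s π * A.Wz π s ^ 2) ≤
      2 * Ex (fun π => K s π * (A.Oc π s * A.Wz π s)) + 27 * Ex fun π => K s π * A.ez π s ^ 4 := by
    intro s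
    rw [← Ex_mul, ← Ex_mul, ← Ex_add]
    refine Ex_mono fun π => ?_
    have := mul_le_mul_of_nonneg_left (Wz_sq_le (A := A) π s) (h.nonneg s π)
    linarith
  refine (Finset.sum_le_sum fun s _ => h1 s).trans ?_
  rw [Finset.sum_add_distrib, ← Finset.mul_sum, ← Finset.mul_sum]
  linarith [h.sum_Oc_Wz_le hB hL, h.sum_ez_four_le hB hL]

end AsyncRun

/-! ### Second moments of pairs of steps -/

namespace AsyncRun
variable {n T q : ℕ} {A : AsyncRun n T q} {D : ℤ → List ℤ} {K : ℤ → Path n T → ℝ} {L : ℕ}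

lemma Kern.mono (h : A.Kern D K) {K' : ℤ → Path n T → ℝ} (h0 : ∀ s π, 0 ≤ K' s π)
    (hle : ∀ s π, K' s π ≤ K s π) : A.Kern D K' := by
  have hne : ∀ s π, K' s π ≠ 0 → K s π ≠ 0 := fun s π h1 h2 =>
    h1 (le_antisymm ((hle s π).trans h2.le) (h0 s π))
  exact ⟨fun s => (h.mean s).mono (h0 s) (hle s), fun s π hK => h.prec s π (hne s π hK),
    fun s π hK => h.nodup s π (hne s π hK), h.shift⟩

lemma Kern.mul_ind (h : A.Kern D K) (p : ℤ → Path n T → Prop) :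
    A.Kern D fun s π => K s π * ind (p s π) :=
  h.mono (fun s π => mul_nonneg (h.nonneg s π) (ind_nonneg _)) fun s π =>
    mul_le_of_le_one_right (h.nonneg s π) (ind_le_one _)

lemma mul_Wz_le_of_ne {s t : ℤ} (h : s ≠ t) (π : Path n T) :
    A.Wz π s * A.Wz π t ≤ (ind (A.prec π s t) + ind (A.prec π t s)) * (A.Wz π s * A.Wz π t) := by
  have h0 := mul_nonneg (A.Wz_nonneg π s) (A.Wz_nonneg π t)
  have h1 := ind_nonneg (A.prec π s t)
  have h2 := ind_nonneg (A.prec π t s)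
  rcases index_cases T s with ⟨s, rfl⟩ | hs
  · rcases index_cases T t with ⟨t, rfl⟩ | ht
    · refine le_mul_of_one_le_left h0 ?_
      rcases prec_or (A := A) (π := π) (s := (s : ℕ)) (t := (t : ℕ)) ⟨by omega, by omega⟩
        ⟨by omega, by omega⟩ h with h3 | h3
      · rw [ind_of h3]; linarith
      · rw [ind_of h3]; linarith
    · have : A.Wz π t = 0 := zx_of_not _ _ ht
      simp [this]
  · have : A.Wz π s = 0 := zx_of_not _ _ hs
    simp [this]

/-- The kernel with root `e` and an additional leaf `e - i`, when another update `e - i + j`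
commits before `e`. -/
lemma Kern.swap (h : A.Kern D K) {G : Fin n → Fin n → ℝ} (hG0 : ∀ a b, 0 ≤ G a b)
    (hG : ∀ a, (1 / n : ℝ) * ∑ b, G a b ≤ 1) {i : ℤ}
    (hi : ∀ s π, K s π ≠ 0 → A.prec π (s + i) s) (j : ℤ) :
    A.Kern (fun e => (e - i) :: D (e - i)) (fun e π => K (e - i) π *
      (G (A.pk π (e - i + j)) (A.pk π (e - i)) * ind (A.prec π (e - i + j) e))) := by
  have hne : ∀ e π, K (e - i) π * (G (A.pk π (e - i + j)) (A.pk π (e - i)) *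
      ind (A.prec π (e - i + j) e)) ≠ 0 → K (e - i) π ≠ 0 ∧ A.prec π e (e - i) ∧
      A.prec π (e - i + j) e := by
    intro w π h1
    have h2 := left_ne_zero_of_mul h1
    have h3 := hi _ π h2
    rw [sub_add_cancel] at h3
    exact ⟨h2, h3, of_ind_ne_zero (right_ne_zero_of_mul (right_ne_zero_of_mul h1))⟩
  refine h.extend i (g := fun e π => G (A.pk π (e - i + j)) (A.pk π (e - i))) ⟨-i, fun w => rfl⟩
    (fun w π => mul_nonneg (h.nonneg _ _) (mul_nonneg (hG0 _ _) (ind_nonneg _)))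
    (fun w π => mul_le_mul_of_nonneg_left (mul_le_of_le_one_right (hG0 _ _) (ind_le_one _))
      (h.nonneg _ _)) (fun w π h1 => ?_) (fun w π h1 => ?_)
  · obtain ⟨h2, h3, -⟩ := hne w π h1
    exact ⟨h3, fun d hd => ⟨h3.trans (h.prec _ π h2 d hd), (h.prec _ π h2 d hd).ne.symm⟩⟩
  · obtain ⟨h2, h3, h4⟩ := hne w π h1
    exact pair_factor hG0 hG (h4.trans h3).ne h3.right_mem fun d hd =>
      ⟨((h4.trans h3).trans (h.prec _ π h2 d hd)).ne.symm, (h.prec _ π h2 d hd).ne.symm⟩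

/-- The contribution of an offset to the expansion of a pair. -/
lemma Kern.pair_edge_le (h : A.Kern D K) (hB : A.Bounds L) (hL : ∀ s, L ≤ (D s).length + 1)
    {i : ℤ} (hi : ∀ s π, K s π ≠ 0 → A.prec π (s + i) s)
    (hnear : ∀ s, ∃ d ∈ D s, d ≤ s + i + 3 * q)
    {G : Fin n → Fin n → ℝ} (hG0 : ∀ a b, 0 ≤ G a b)
    (hG : ∀ a, (1 / n : ℝ) * ∑ b, G a b ≤ 1) {j : ℤ} (hj : -(3 * q : ℤ) ≤ j) :
    q * ∑ s ∈ rng T, Ex (fun π => K s π * (A.Wz π (s + i) * A.edge G π s (s + j))) ≤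
      83 / 10 * A.base₂ + (if j - i ∈ offs q q then 83 / 10 * A.base₂ else 0) +
        (if j = i then q * (105 / 10 * A.base₂) else 0) := by
  have h0 := A.base₂_nonneg
  have hlen : ∀ m s, L ≤ ((s - m) :: D (s - m)).length := fun m s => hL (s - m)
  rcases eq_or_ne j i with rfl | hji
  -- The edge leads to the other member of the pair, so a square appears, which lacks the gain of a
  -- factor q. This happens for one offset only.
  · rw [if_pos rfl, if_neg (by rw [mem_offs]; simp)]
    obtain ⟨δ, hf⟩ := h.fam
    have h1 := hf.sum_edge_le hG0 (X := fun s π => A.Wz π (s + j)) (fun s π => A.Wz_nonneg _ _) j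
    have h2 := hB.square (h.edge hG0 hG j) (hlen j)
    have h3 : ∑ s ∈ rng T, Ex (fun π => K s π * (A.Wz π (s + j) * A.edge G π s (s + j))) ≤
        105 / 10 * A.base₂ := by
      refine h1.trans (le_trans (le_of_eq ?_) h2)
      refine Finset.sum_congr rfl fun w _ => ?_
      congr 1
      ext π
      rw [sub_add_cancel, sq]
    have h4 := mul_le_mul_of_nonneg_left h3 (Nat.cast_nonneg (α := ℝ) q)
    linarith
  rw [if_neg hji, add_zero]
  -- the contributions of the two orders of the pair
  set a := ∑ s ∈ rng T, Ex (fun π => K s π * (G (A.pk π (s + j)) (A.pk π s) *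
    ind (A.prec π (s + j) s)) * ind (A.prec π (s + i) (s + j)) *
      (A.Wz π (s + i) * A.Wz π (s + j))) with ha
  set b := ∑ s ∈ rng T, Ex (fun π => K s π * (G (A.pk π (s + j)) (A.pk π s) *
    ind (A.prec π (s + j) (s + i))) * (A.Wz π (s + j) * A.Wz π (s + i))) with hb
  have hab : ∑ s ∈ rng T, Ex (fun π => K s π * (A.Wz π (s + i) * A.edge G π s (s + j))) ≤
      a + b := by
    rw [ha, hb, ← Finset.sum_add_distrib]
    refine Finset.sum_le_sum fun s _ => ?_
    rw [← Ex_add]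
    refine Ex_mono fun π => ?_
    have h1 := mul_Wz_le_of_ne (A := A) (show s + i ≠ s + j by omega) π
    have h2 : 0 ≤ K s π * (G (A.pk π (s + j)) (A.pk π s)) := mul_nonneg (h.nonneg _ _) (hG0 _ _)
    have h3 := mul_le_mul_of_nonneg_left h1 (mul_nonneg h2 (ind_nonneg (A.prec π (s + j) s)))
    have h4 : K s π * (G (A.pk π (s + j)) (A.pk π s)) * ind (A.prec π (s + j) s) *
        (ind (A.prec π (s + j) (s + i)) * (A.Wz π (s + i) * A.Wz π (s + j))) ≤
        K s π * (G (A.pk π (s + j)) (A.pk π s)) *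
        (ind (A.prec π (s + j) (s + i)) * (A.Wz π (s + i) * A.Wz π (s + j))) := by
      refine mul_le_mul_of_nonneg_right (mul_le_of_le_one_right h2 (ind_le_one _)) ?_
      exact mul_nonneg (ind_nonneg _) (mul_nonneg (A.Wz_nonneg _ _) (A.Wz_nonneg _ _))
    simp only [AsyncRun.edge]
    linarith
  -- Below this range s + i cannot commit before s + j, and this order of the pair contributes
  -- nothing; likewise for the other order in `hb1`.
  have ha1 : q * a ≤ if i - q ≤ j then 83 / 10 * A.base₂ else 0 := by
    split_ifs with hij
    · refine le_trans (mul_le_mul_of_nonneg_left ?_ (Nat.cast_nonneg q))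
        (hB.pair ((h.edge hG0 hG j).mul_ind fun w π => A.prec π (w + (i - j)) w) (hlen j) (i - j)
        (fun w π hK => of_ind_ne_zero (right_ne_zero_of_mul hK)) fun w => ?_)
      · refine (sum_reroot (g := fun s w π => K s π * (G (A.pk π w) (A.pk π s) *
          ind (A.prec π w s)) * ind (A.prec π (s + i) w) * (A.Wz π (s + i) * A.Wz π w))
          (fun s w π => ?_) (fun s w π hw => ?_) j).trans (le_of_eq ?_)
        · exact mul_nonneg (mul_nonneg (mul_nonneg (h.nonneg _ _)
            (mul_nonneg (hG0 _ _) (ind_nonneg _))) (ind_nonneg _))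
            (mul_nonneg (A.Wz_nonneg _ _) (A.Wz_nonneg _ _))
        · rw [A.Wz_of_notMem π hw]; ring
        · refine Finset.sum_congr rfl fun w _ => ?_
          rw [show w - j + i = w + (i - j) by ring]
      · obtain ⟨d, hd, h1⟩ := hnear (w - j)
        exact ⟨d, List.mem_cons_of_mem _ hd, by omega⟩
    · have : ∀ s π, ind (A.prec π (s + i) (s + j)) = 0 := fun s π => ind_of_not fun hc => by
        have := hc.le_add
        omega
      rw [ha]
      simp only [this, mul_zero, zero_mul, Ex_zero, Finset.sum_const_zero, le_refl]
  have hb1 : q * b ≤ if j ≤ i + q then 83 / 10 * A.base₂ else 0 := by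
    split_ifs with hij
    · refine le_trans (mul_le_mul_of_nonneg_left ?_ (Nat.cast_nonneg q))
        (hB.pair (h.swap hG0 hG hi j) (hlen i) (j - i)
        (fun e π hK => ?_) fun w => ⟨w - i, List.mem_cons_self, by omega⟩)
      · refine (sum_reroot (g := fun s e π => K s π * (G (A.pk π (s + j)) (A.pk π s) *
          ind (A.prec π (s + j) e)) * (A.Wz π (s + j) * A.Wz π e))
          (fun s w π => ?_) (fun s w π hw => ?_) i).trans (le_of_eq ?_)
        · exact mul_nonneg (mul_nonneg (h.nonneg _ _) (mul_nonneg (hG0 _ _) (ind_nonneg _)))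
            (mul_nonneg (A.Wz_nonneg _ _) (A.Wz_nonneg _ _))
        · rw [A.Wz_of_notMem π hw]; ring
        · refine Finset.sum_congr rfl fun w _ => ?_
          rw [show w + (j - i) = w - i + j by ring]
      · have h1 := of_ind_ne_zero (right_ne_zero_of_mul (right_ne_zero_of_mul hK))
        rwa [show e + (j - i) = e - i + j by ring]
    · have : ∀ s π, ind (A.prec π (s + j) (s + i)) = 0 := fun s π => ind_of_not fun hc => by
        have := hc.le_add
        omega
      rw [hb]
      simp only [this, mul_zero, zero_mul, Ex_zero, Finset.sum_const_zero, le_refl]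
  have hsum := mul_le_mul_of_nonneg_left hab (Nat.cast_nonneg (α := ℝ) q)
  have hite : (if i - q ≤ j then 83 / 10 * A.base₂ else 0) +
      (if j ≤ i + q then 83 / 10 * A.base₂ else 0) ≤
      83 / 10 * A.base₂ + if j - i ∈ offs q q then 83 / 10 * A.base₂ else 0 := by
    by_cases h1 : j - i ∈ offs q q
    · rw [if_pos h1]
      split_ifs <;> linarith
    · rw [if_neg h1]
      rw [mem_offs] at h1
      have : ¬(i - q ≤ j ∧ j ≤ i + q) := fun hc => h1 ⟨by omega, by omega, by omega⟩
      split_ifs with h2 h3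
      · exact absurd ⟨h2, h3⟩ this
      all_goals linarith
  linarith

/-- Each of the (m + 1)q offsets counts once, at most 2q of them twice because both orders are
possible, and one may produce a square. -/
lemma Kern.sum_pair_edges_le (h : A.Kern D K) (hB : A.Bounds L)
    (hL : ∀ s, L ≤ (D s).length + 1)
    {i : ℤ} (hi : ∀ s π, K s π ≠ 0 → A.prec π (s + i) s)
    (hnear : ∀ s, ∃ d ∈ D s, d ≤ s + i + 3 * q)
    {G : Fin n → Fin n → ℝ} (hG0 : ∀ a b, 0 ≤ G a b)
    (hG : ∀ a, (1 / n : ℝ) * ∑ b, G a b ≤ 1) (hq : 0 < q) {m : ℕ} (hm : m ≤ 3) :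
    ∑ j ∈ offs (m * q) q, ∑ s ∈ rng T,
      Ex (fun π => K s π * (A.Wz π (s + i) * A.edge G π s (s + j))) ≤
      (m + 3) * (83 / 10 * A.base₂) + 105 / 10 * A.base₂ := by
  have h0 := A.base₂_nonneg
  have hq' : (0 : ℝ) < q := by exact_mod_cast hq
  refine le_of_mul_le_mul_left ?_ hq'
  rw [Finset.mul_sum]
  refine (Finset.sum_le_sum fun j hj => h.pair_edge_le hB hL hi hnear hG0 hG (j := j) (by
    rw [mem_offs] at hj
    have : (m : ℤ) * q ≤ 3 * q := by exact_mod_cast Nat.mul_le_mul_right q hm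
    push_cast at hj
    omega)).trans ?_
  rw [Finset.sum_add_distrib, Finset.sum_add_distrib, Finset.sum_const, card_offs,
    nsmul_eq_mul]
  have h1 : ∑ j ∈ offs (m * q) q, (if j - i ∈ offs q q then 83 / 10 * A.base₂ else 0) ≤
      2 * q * (83 / 10 * A.base₂) := by
    rw [← Finset.sum_filter, Finset.sum_const, nsmul_eq_mul]
    refine mul_le_mul_of_nonneg_right ?_ (by positivity)
    have h2 : ((offs (m * q) q).filter fun j => j - i ∈ offs q q).card ≤ (offs q q).card :=
      Finset.card_le_card_of_injOn (· - i) (fun j hj => (Finset.mem_filter.1 hj).2)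
        fun a _ b _ hab => by simpa using hab
    rw [card_offs] at h2
    have : ((q + q : ℕ) : ℝ) = 2 * q := by push_cast; ring
    rw [← this]
    exact_mod_cast h2
  have h2 : ∑ j ∈ offs (m * q) q, (if j = i then q * (105 / 10 * A.base₂) else 0) ≤
      q * (105 / 10 * A.base₂) := by
    rw [Finset.sum_ite_eq']
    split_ifs
    · exact le_rfl
    · positivity
  push_cast
  linarith

lemma after_of_le {π : Path n T} {r s : ℤ} (hr : 0 ≤ r) (hrs : r ≤ s) (hs : s < T) :
    A.after π r s := by
  rcases index_cases T s with ⟨s, rfl⟩ | h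
  · rcases index_cases T r with ⟨r, rfl⟩ | h'
    · have hrs' : r ≤ s := by rw [Fin.le_def]; omega
      exact ⟨r, s, rfl, rfl, ((A.valid.start_strictMono π).monotone hrs').trans
        (A.start_le_commit π s)⟩
    · exact absurd ⟨hr, by omega⟩ h'
  · exact absurd ⟨by omega, hs⟩ h

/-- V is `rat`·`Vbar` with `Vbar` ≤ `om`·`Oc` at s. Rerooting at the other member s + i of the pair
makes s a leaf and reduces the claim to `Bounds.head`. -/
lemma Kern.sum_pair_base_le (h : A.Kern D K) {δ : ℤ} (hf : A.Fam δ D K) (hB : A.Bounds L)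
    (hL : ∀ s, L ≤ (D s).length + 1)
    {i : ℤ} (hi : ∀ s π, K s π ≠ 0 → A.prec π (s + i) s)
    (hnear : ∀ s, ∃ d ∈ D s, d ≤ s + i + 3 * q) :
    ∑ s ∈ rng T, Ex (fun π => K s π * (A.Wz π (s + i) * A.Vz π (s - δ) (A.pk π s))) ≤
      A.om * (49 / 10 * A.base₂) := by
  have hδ := hf.δ_nonneg
  have h1 : ∀ s ∈ rng T,
      Ex (fun π => K s π * (A.Wz π (s + i) * A.Vz π (s - δ) (A.pk π s))) ≤
      A.om * Ex (fun π => K s π * (A.rat π (s - δ) s * ind (A.prec π (s + i) s)) *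
        (A.Oc π s * A.Wz π (s + i))) := by
    intro s hs
    have hs' : 0 ≤ s ∧ s < T := by simpa using hs
    rw [← Ex_mul]
    refine Ex_mono fun π => ?_
    by_cases hK : K s π = 0
    · simp [hK]
    have h2 := (A.Vb_le π (s - δ)).trans (mul_le_mul_of_nonneg_left
      (A.Os_le_Oc (after_of_le (π := π) (hf.zero_le hK hs'.1) (by omega : s - δ ≤ s) hs'.2))
      A.om_nonneg)
    have h3 := mul_le_mul_of_nonneg_left h2 (mul_nonneg (mul_nonneg (h.nonneg s π)
      (rat_nonneg (A := A) π (s - δ) s)) (A.Wz_nonneg π (s + i)))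
    rw [ind_of (hi s π hK), mul_one, ← rat_mul]
    linarith
  refine (Finset.sum_le_sum h1).trans ?_
  rw [← Finset.mul_sum]
  refine mul_le_mul_of_nonneg_left ?_ A.om_nonneg
  refine (sum_reroot (g := fun s e π => K s π * (A.rat π (s - δ) s * ind (A.prec π e s)) *
    (A.Oc π s * A.Wz π e)) (fun s w π => ?_) (fun s w π hw => ?_) i).trans
    (hB.head (h.rat hf i) (fun s => hL (s - i)) (fun e => e - i) (fun e => List.mem_cons_self)
      (fun e π hK d hd => ?_) fun e => ?_)
  · exact mul_nonneg (mul_nonneg (h.nonneg _ _) (mul_nonneg (rat_nonneg _ _ _) (ind_nonneg _)))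
      (mul_nonneg (A.Oc_nonneg _ _) (A.Wz_nonneg _ _))
  · rw [A.Wz_of_notMem π hw]; ring
  · rcases List.mem_cons.1 hd with rfl | hd
    · exact Or.inl rfl
    · exact Or.inr (h.prec _ π (left_ne_zero_of_mul hK) d hd)
  · obtain ⟨d, hd, h2⟩ := hnear (e - i)
    exact ⟨d, List.mem_cons_of_mem _ hd, by omega⟩

/-- Each contribution to the propagation of W at s carries a factor of order 1/q, namely `om`, 1/n
or q·`rbar`. This is where the gain of q over the square comes from. -/
lemma Kern.sum_pair_le (h : A.Kern D K) (hB : A.Bounds L) (hL : ∀ s, L ≤ (D s).length + 1)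
    {i : ℤ} (hi : ∀ s π, K s π ≠ 0 → A.prec π (s + i) s)
    (hnear : ∀ s, ∃ d ∈ D s, d ≤ s + i + 3 * q) :
    q * ∑ s ∈ rng T, Ex (fun π => K s π * (A.Wz π (s + i) * A.Wz π s)) ≤ 83 / 10 * A.base₂ := by
  have h0 := A.base₂_nonneg
  rcases Nat.eq_zero_or_pos q with hq | hq
  · have : (q : ℝ) = 0 := by exact_mod_cast hq
    rw [this, zero_mul]
    positivity
  obtain ⟨δ, hf⟩ := h.fam
  have h1 := hf.sum_Wz_le_sum_Rz (X := fun s π => A.Wz π (s + i)) fun s π => A.Wz_nonneg _ _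
  have h2 := sum_Rz_le_of_sums (X := fun s π => A.Wz π (s + i))
    (h.sum_pair_base_le hf hB hL hi hnear)
    (h.sum_pair_edges_le hB hL hi hnear Gc_nonneg mean_Gc hq (m := 2) (by norm_num))
    (h.sum_pair_edges_le hB hL hi hnear A.Gg_nonneg (A.mean_Gg hq) hq (m := 3) le_rfl)
  have h3 := mul_le_mul_of_nonneg_left (h1.trans h2) (Nat.cast_nonneg (α := ℝ) q)
  refine h3.trans ?_
  have h4 := mul_le_mul_of_nonneg_right A.q_om_le (show 0 ≤ 13 / 10 * (49 / 10 * A.base₂) by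
    positivity)
  have h5 := mul_le_mul_of_nonneg_right A.nu_le (show 0 ≤ 13 / 10 * (52 * A.base₂) by positivity)
  have h6 := mul_le_mul_of_nonneg_right (q_sq_rbar_le q)
    (show 0 ≤ 52 / 3 * (603 / 10 * A.base₂) by positivity)
  have e1 : (q : ℝ) / n * (13 / 10 * (52 * A.base₂)) = q * (13 / 10 / n * (52 * A.base₂)) := by
    ring
  push_cast
  linarith

end AsyncRun

/-! ### Errors accumulated up to a later leaf, and the downward induction -/

namespace AsyncRun
variable {n T q : ℕ} {A : AsyncRun n T q} {D : ℤ → List ℤ} {K : ℤ → Path n T → ℝ} {L : ℕ}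

lemma Oc_le_add {π : Path n T} {s h : ℤ} (hsh : A.prec π s h)
    (hx : ∀ x, A.prec π x h → x ≤ s + 4 * q) :
    A.Oc π h ≤ A.Oc π s + A.ez π s ^ 2 + ∑ j ∈ offs q (4 * q),
      ind (A.prec π s (s + j)) * ind (A.prec π (s + j) h) * A.ez π (s + j) ^ 2 := by
  obtain ⟨s, h, rfl, rfl, hlt⟩ := hsh
  simp only [Oc, zx_coe]
  rw [A.Om_eq_add π hlt.le, add_assoc]
  have e : (Finset.univ.filter fun u => A.S.commit π s ≤ A.S.commit π u ∧
      A.S.commit π u < A.S.commit π h) = insert s (Finset.univ.filter fun u =>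
      A.S.commit π s < A.S.commit π u ∧ A.S.commit π u < A.S.commit π h) := by
    ext u
    simp only [Finset.mem_insert, Finset.mem_filter, Finset.mem_univ, true_and]
    constructor
    · rintro ⟨h1, h2⟩
      rcases h1.lt_or_eq with h1 | h1
      · exact Or.inr ⟨h1, h2⟩
      · exact Or.inl (A.valid.commit_injective π h1).symm
    · rintro (rfl | h1)
      · exact ⟨le_rfl, hlt⟩
      · exact ⟨h1.1.le, h1.2⟩
  rw [e, Finset.sum_insert (by simp)]
  refine add_le_add le_rfl (add_le_add (by simp [ez]) (sum_fin_le (s := ((s : ℕ) : ℤ))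
    (H := fun w => ind (A.prec π (s : ℕ) w) * ind (A.prec π w (h : ℕ)) * A.ez π w ^ 2)
    (fun w => mul_nonneg (mul_nonneg (ind_nonneg _) (ind_nonneg _)) (sq_nonneg _)) ?_ ?_))
  · rintro v ⟨h2, h3⟩
    have h4 := A.le_add_of_commit_lt h2
    have h5 := hx (v : ℕ) (prec_coe.2 h3)
    have h6 : v ≠ s := by rintro rfl; exact lt_irrefl _ h2
    have h7 : (v : ℕ) ≠ s := fun hc => h6 (Fin.ext hc)
    rw [mem_offs]
    omega
  · rintro v ⟨h2, h3⟩
    rw [ind_of (prec_coe.2 h2), ind_of (prec_coe.2 h3), one_mul, one_mul, ez, zx_coe]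

/-- The kernel with the additional leaf `s + j`, committed between `s` and the leaves of `s`, with
root `s` or another update `s + j + k` committed before `s + j`. -/
lemma Kern.leaf (h : A.Kern D K) {hd : ℤ → ℤ}
    (hearliest : ∀ s π, K s π ≠ 0 → ∀ d ∈ D s, d = hd s ∨ A.prec π (hd s) d)
    {G : Fin n → Fin n → ℝ} (hG0 : ∀ a b, 0 ≤ G a b)
    (hG : ∀ a, (1 / n : ℝ) * ∑ b, G a b ≤ 1) (j k : ℤ) {m : ℤ} (hm : m = 0 ∨ m = j + k) :
    A.Kern (fun w => (w - m + j) :: D (w - m)) (fun w π => K (w - m) π *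
      (G (A.pk π (w - m + j + k)) (A.pk π (w - m + j)) * (ind (A.prec π (w - m) (w - m + j)) *
        ind (A.prec π (w - m + j) (hd (w - m))) *
          ind (A.prec π (w - m + j + k) (w - m + j))))) := by
  have hne : ∀ w π, K (w - m) π *
      (G (A.pk π (w - m + j + k)) (A.pk π (w - m + j)) * (ind (A.prec π (w - m) (w - m + j)) *
        ind (A.prec π (w - m + j) (hd (w - m))) *
          ind (A.prec π (w - m + j + k) (w - m + j)))) ≠ 0 →
      A.prec π w (w - m + j) ∧ A.prec π (w - m + j + k) (w - m + j) ∧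
        ∀ d ∈ D (w - m), A.prec π (w - m + j) d := by
    intro w π h1
    have h2 := left_ne_zero_of_mul h1
    have h3 := right_ne_zero_of_mul (right_ne_zero_of_mul h1)
    have h4 := of_ind_ne_zero (right_ne_zero_of_mul h3)
    have h5 := of_ind_ne_zero (right_ne_zero_of_mul (left_ne_zero_of_mul h3))
    have h6 := of_ind_ne_zero (left_ne_zero_of_mul (left_ne_zero_of_mul h3))
    refine ⟨?_, h4, fun d hd' => ?_⟩
    · rcases hm with rfl | rfl
      · simpa using h6
      · rwa [show w - (j + k) + j + k = w by ring] at h4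
    · rcases hearliest _ π h2 d hd' with rfl | h7
      · exact h5
      · exact h5.trans h7
  refine h.extend m (X := fun w => w - m + j)
    (g := fun w π => G (A.pk π (w - m + j + k)) (A.pk π (w - m + j)))
    ⟨j - m, fun w => by ring⟩
    (fun w π => mul_nonneg (h.nonneg _ _) (mul_nonneg (hG0 _ _)
      (mul_nonneg (mul_nonneg (ind_nonneg _) (ind_nonneg _)) (ind_nonneg _))))
    (fun w π => mul_le_mul_of_nonneg_left (mul_le_of_le_one_right (hG0 _ _)
      (mul_le_one₀ (mul_le_one₀ (ind_le_one _) (ind_nonneg _) (ind_le_one _)) (ind_nonneg _)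
        (ind_le_one _))) (h.nonneg _ _)) (fun w π h1 => ?_) (fun w π h1 => ?_)
  · obtain ⟨h2, -, h4⟩ := hne w π h1
    exact ⟨h2, fun d hd => ⟨h2.trans (h4 d hd), (h4 d hd).ne.symm⟩⟩
  · obtain ⟨h2, h3, h4⟩ := hne w π h1
    exact pair_factor hG0 hG h3.ne h2.right_mem fun d hd =>
      ⟨(h3.trans (h4 d hd)).ne.symm, (h4 d hd).ne.symm⟩

/-- The error of s + j is caused by an update s + j + k committed before it. Whichever of s and s +
j + k commits first becomes the root of a pair; if they coincide, the square bound is used. -/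
lemma Kern.head_pair_le (h : A.Kern D K) (hB : A.Bounds L) (hL : ∀ s, L ≤ (D s).length + 1)
    {hd : ℤ → ℤ} (hearliest : ∀ s π, K s π ≠ 0 → ∀ d ∈ D s, d = hd s ∨ A.prec π (hd s) d)
    (hnear : ∀ s, ∃ d ∈ D s, d ≤ s + 3 * q)
    {G : Fin n → Fin n → ℝ} (hG0 : ∀ a b, 0 ≤ G a b)
    (hG : ∀ a, (1 / n : ℝ) * ∑ b, G a b ≤ 1) {j k : ℤ} (hk : -(q : ℤ) ≤ k) :
    q * ∑ s ∈ rng T, Ex (fun π => K s π * (ind (A.prec π s (s + j)) *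
      ind (A.prec π (s + j) (hd s)) * A.edge G π (s + j) (s + j + k) * A.Wz π s)) ≤
      166 / 10 * A.base₂ + if k = -j then q * (105 / 10 * A.base₂) else 0 := by
  have h0 := A.base₂_nonneg
  have hq0 : (0 : ℝ) ≤ q := Nat.cast_nonneg q
  have hk0 := h.leaf hearliest hG0 hG j k (Or.inl rfl)
  have hk1 := h.leaf hearliest hG0 hG j k (Or.inr rfl)
  simp only [sub_zero] at hk0
  by_cases hkj : k = -j
  · rw [if_pos hkj]
    have h2 := hB.square hk0 hL
    have h3 : ∑ s ∈ rng T, Ex (fun π => K s π * (ind (A.prec π s (s + j)) *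
        ind (A.prec π (s + j) (hd s)) * A.edge G π (s + j) (s + j + k) * A.Wz π s)) ≤
        105 / 10 * A.base₂ := by
      refine le_trans (le_of_eq ?_) h2
      refine Finset.sum_congr rfl fun s _ => ?_
      congr 1
      ext π
      rw [show s + j + k = s by omega, AsyncRun.edge]
      ring
    have h4 := mul_le_mul_of_nonneg_left h3 hq0
    linarith
  rw [if_neg hkj, add_zero]
  set Q : ℤ → Path n T → ℝ := fun s π => K s π *
      (G (A.pk π (s + j + k)) (A.pk π (s + j)) * (ind (A.prec π s (s + j)) *
        ind (A.prec π (s + j) (hd s)) * ind (A.prec π (s + j + k) (s + j)))) with hQ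
  have hQ0 : ∀ s π, 0 ≤ Q s π := hk0.nonneg
  have hsplit : ∑ s ∈ rng T, Ex (fun π => K s π * (ind (A.prec π s (s + j)) *
      ind (A.prec π (s + j) (hd s)) * A.edge G π (s + j) (s + j + k) * A.Wz π s)) ≤
      ∑ s ∈ rng T, Ex (fun π => Q s π * ind (A.prec π (s + (j + k)) s) *
        (A.Wz π (s + (j + k)) * A.Wz π s)) +
      ∑ s ∈ rng T, Ex (fun π => Q s π * ind (A.prec π s (s + (j + k))) *
        (A.Wz π s * A.Wz π (s + (j + k)))) := by
    rw [← Finset.sum_add_distrib]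
    refine Finset.sum_le_sum fun s _ => ?_
    rw [← Ex_add]
    refine Ex_mono fun π => ?_
    have h1 := mul_le_mul_of_nonneg_left (mul_Wz_le_of_ne (A := A)
      (show s ≠ s + (j + k) by omega) π) (hQ0 s π)
    refine le_trans (le_of_eq ?_) (h1.trans (le_of_eq (by ring)))
    simp only [hQ, AsyncRun.edge, ← add_assoc]
    ring
  have h1 : q * ∑ s ∈ rng T, Ex (fun π => Q s π * ind (A.prec π (s + (j + k)) s) *
        (A.Wz π (s + (j + k)) * A.Wz π s)) ≤ 83 / 10 * A.base₂ :=
    hB.pair (hk0.mul_ind fun s π => A.prec π (s + (j + k)) s) hL (j + k)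
      (fun s π hK => of_ind_ne_zero (right_ne_zero_of_mul hK))
      fun s => ⟨s + j, List.mem_cons_self, by omega⟩
  have h2 : q * ∑ s ∈ rng T, Ex (fun π => Q s π * ind (A.prec π s (s + (j + k))) *
        (A.Wz π s * A.Wz π (s + (j + k)))) ≤ 83 / 10 * A.base₂ := by
    refine le_trans (mul_le_mul_of_nonneg_left ?_ hq0)
      (hB.pair (hk1.mul_ind fun w π => A.prec π (w + -(j + k)) w)
      (fun s => hL (s - (j + k))) (-(j + k))
      (fun s π hK => of_ind_ne_zero (right_ne_zero_of_mul hK)) fun w => ?_)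
    · refine (sum_reroot (g := fun s w π => Q s π * ind (A.prec π s w) *
        (A.Wz π s * A.Wz π w)) (fun s w π => ?_) (fun s w π hw => ?_) (j + k)).trans (le_of_eq ?_)
      · exact mul_nonneg (mul_nonneg (hQ0 _ _) (ind_nonneg _))
          (mul_nonneg (A.Wz_nonneg _ _) (A.Wz_nonneg _ _))
      · rw [A.Wz_of_notMem π hw]; ring
      · rfl
    · obtain ⟨d, hd, h3⟩ := hnear (w - (j + k))
      exact ⟨d, List.mem_cons_of_mem _ hd, by omega⟩
  have h3 := mul_le_mul_of_nonneg_left hsplit hq0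
  linarith

lemma Kern.sum_between_le (h : A.Kern D K) (hB : A.Bounds L) (hL : ∀ s, L ≤ (D s).length + 1)
    {hd : ℤ → ℤ} (hearliest : ∀ s π, K s π ≠ 0 → ∀ d ∈ D s, d = hd s ∨ A.prec π (hd s) d)
    (hnear : ∀ s, ∃ d ∈ D s, d ≤ s + 3 * q) {j : ℤ} (hq : 0 < q) :
    q * ∑ s ∈ rng T, Ex (fun π => K s π * (ind (A.prec π s (s + j)) *
      ind (A.prec π (s + j) (hd s)) * A.ez π (s + j) ^ 2 * A.Wz π s)) ≤
      2 / 640 * (437 / 10 * A.base₂) := by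
  have h0 := A.base₂_nonneg
  have hr := rbar_nonneg q
  have hq' : (0 : ℝ) < q := by exact_mod_cast hq
  have h1 : ∑ s ∈ rng T, Ex (fun π => K s π * (ind (A.prec π s (s + j)) *
      ind (A.prec π (s + j) (hd s)) * A.ez π (s + j) ^ 2 * A.Wz π s)) ≤
      2 * q * rbar q * ∑ k ∈ offs q q, ∑ s ∈ rng T, Ex (fun π => K s π *
        (ind (A.prec π s (s + j)) * ind (A.prec π (s + j) (hd s)) *
          A.edge A.Gg π (s + j) (s + j + k) * A.Wz π s)) := by
    rw [Finset.sum_comm, Finset.mul_sum]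
    refine Finset.sum_le_sum fun s _ => ?_
    rw [← Ex_sum, ← Ex_mul]
    refine Ex_mono fun π => ?_
    have := mul_le_mul_of_nonneg_left (A.ez_sq_le π (s + j)) (mul_nonneg (mul_nonneg
      (h.nonneg s π) (mul_nonneg (ind_nonneg (A.prec π s (s + j)))
        (ind_nonneg (A.prec π (s + j) (hd s))))) (A.Wz_nonneg π s))
    refine le_trans (le_of_eq (by ring)) (this.trans (le_of_eq ?_))
    simp only [Finset.mul_sum]
    exact Finset.sum_congr rfl fun j _ => by ring
  have h2 : q * ∑ k ∈ offs q q, ∑ s ∈ rng T, Ex (fun π => K s π *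
        (ind (A.prec π s (s + j)) * ind (A.prec π (s + j) (hd s)) *
          A.edge A.Gg π (s + j) (s + j + k) * A.Wz π s)) ≤ q * (437 / 10 * A.base₂) := by
    rw [Finset.mul_sum]
    refine (Finset.sum_le_sum fun k hk => h.head_pair_le hB hL hearliest hnear A.Gg_nonneg
      (A.mean_Gg hq) (j := j) (k := k) (by rw [mem_offs] at hk; exact hk.2.1)).trans ?_
    rw [Finset.sum_add_distrib, Finset.sum_const, card_offs, nsmul_eq_mul, Finset.sum_ite_eq']
    push_cast
    have : 0 ≤ q * (105 / 10 * A.base₂) := by positivity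
    split_ifs <;> linarith
  have h3 := mul_le_mul_of_nonneg_left h2 (show 0 ≤ 2 * q * rbar q by positivity)
  have h4 := mul_le_mul_of_nonneg_left h1 hq'.le
  have h5 := mul_le_mul_of_nonneg_right (q_sq_rbar_le q)
    (show 0 ≤ 2 * (437 / 10 * A.base₂) by positivity)
  linarith

lemma Wz_le (π : Path n T) (s : ℤ) :
    A.Wz π s ≤ 3 / 2 * A.Oc π s + 9 / 2 * A.ez π s ^ 2 := by
  rcases index_cases T s with ⟨s, rfl⟩ | h
  · simp only [Wz, Oc, ez, zx_coe]
    linarith [A.W_le π s, A.F_mem_le_Om π (A.S.commit π s)]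
  · simp [Wz, Oc, ez, zx_of_not _ _ h]

/-- Between the commits of s and of the head leaf the accumulated error grows by the error of s
itself, handled by `Wz_le`, and by errors of at most 5q updates in between, each of order 1/q by
`sum_between_le`. -/
lemma Kern.sum_head_le (h : A.Kern D K) (hB : A.Bounds L) (hL : ∀ s, L ≤ (D s).length + 1)
    {hd : ℤ → ℤ} (hmem : ∀ s, hd s ∈ D s)
    (hearliest : ∀ s π, K s π ≠ 0 → ∀ d ∈ D s, d = hd s ∨ A.prec π (hd s) d)
    (hnear : ∀ s, ∃ d ∈ D s, d ≤ s + 3 * q) :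
    ∑ s ∈ rng T, Ex (fun π => K s π * (A.Oc π (hd s) * A.Wz π s)) ≤ 49 / 10 * A.base₂ := by
  have h0 := A.base₂_nonneg
  have h1 : ∀ s, Ex (fun π => K s π * (A.Oc π (hd s) * A.Wz π s)) ≤
      Ex (fun π => K s π * (A.Oc π s * A.Wz π s)) +
      (3 / 2 * Ex (fun π => K s π * (A.Oc π s * A.ez π s ^ 2)) +
        9 / 2 * Ex (fun π => K s π * A.ez π s ^ 4)) +
      ∑ j ∈ offs q (4 * q), Ex (fun π => K s π * (ind (A.prec π s (s + j)) *
        ind (A.prec π (s + j) (hd s)) * A.ez π (s + j) ^ 2 * A.Wz π s)) := by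
    intro s
    rw [← Ex_mul, ← Ex_mul, ← Ex_sum, ← Ex_add, ← Ex_add, ← Ex_add]
    refine Ex_mono fun π => ?_
    by_cases hK : K s π = 0
    · simp [hK]
    obtain ⟨d, hd', hd3⟩ := hnear s
    have h2 := Oc_le_add (h.prec s π hK _ (hmem s)) fun x hx => by
      have h3 : A.prec π x d := by
        rcases hearliest s π hK d hd' with rfl | h4
        · exact hx
        · exact hx.trans h4
      have := h3.le_add
      omega
    have h5 := mul_le_mul_of_nonneg_left (mul_le_mul_of_nonneg_right h2 (A.Wz_nonneg π s))
      (h.nonneg s π)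
    have h6 := mul_le_mul_of_nonneg_left (mul_le_mul_of_nonneg_left (Wz_le (A := A) π s)
      (sq_nonneg (A.ez π s))) (h.nonneg s π)
    rw [add_mul, Finset.sum_mul, mul_add, Finset.mul_sum] at h5
    linarith
  refine (Finset.sum_le_sum fun s _ => h1 s).trans ?_
  rw [Finset.sum_add_distrib, Finset.sum_add_distrib, Finset.sum_add_distrib, ← Finset.mul_sum,
    ← Finset.mul_sum, Finset.sum_comm]
  have h2 : ∑ j ∈ offs q (4 * q), ∑ s ∈ rng T, Ex (fun π => K s π * (ind (A.prec π s (s + j)) *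
        ind (A.prec π (s + j) (hd s)) * A.ez π (s + j) ^ 2 * A.Wz π s)) ≤
      10 / 640 * (437 / 10 * A.base₂) := by
    rcases Nat.eq_zero_or_pos q with rfl | hq
    · have : offs 0 (4 * 0) = ∅ := by simp [← Finset.card_eq_zero, card_offs]
      rw [this, Finset.sum_empty]
      positivity
    have hq' : (0 : ℝ) < q := by exact_mod_cast hq
    refine le_of_mul_le_mul_left ?_ hq'
    rw [Finset.mul_sum]
    refine (Finset.sum_le_card_nsmul _ _ _ fun j _ =>
      h.sum_between_le hB hL hearliest hnear (j := j) hq).trans ?_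
    rw [card_offs, nsmul_eq_mul]
    push_cast
    linarith
  linarith [h.sum_Oc_Wz_le hB hL, h.sum_Oc_ez_sq_le hB hL, h.sum_ez_four_le hB hL]

/-- Each recursive use in the three estimates concerns kernels with at least one more leaf, and the
constants reproduce themselves. -/
lemma Bounds.of_succ (hB : A.Bounds (L + 1)) : A.Bounds L where
  head h hL _ hmem hearliest hnear :=
    h.sum_head_le hB (fun s => Nat.succ_le_succ (hL s)) hmem hearliest hnear
  square h hL := h.sum_Wz_sq_le hB fun s => Nat.succ_le_succ (hL s)
  pair h hL _ hi hnear := h.sum_pair_le hB (fun s => Nat.succ_le_succ (hL s)) hi hnear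

lemma bounds_of_lt (h : T < L) : A.Bounds L := by
  have h0 := A.base₂_nonneg
  have key : ∀ {D : ℤ → List ℤ} {K : ℤ → Path n T → ℝ}, A.Kern D K →
      (∀ s, L ≤ (D s).length) → ∀ s π, K s π = 0 := by
    intro D K hk hL s π
    by_contra hK
    have := hk.length_le hK
    have := hL s
    omega
  refine ⟨fun hk hL _ _ _ _ => ?_, fun hk hL => ?_, fun hk hL _ _ _ => ?_⟩ <;>
  · simp only [key hk hL, zero_mul, Ex_zero, Finset.sum_const_zero, mul_zero]
    positivity

variable (A) in
lemma bounds (L : ℕ) : A.Bounds L := by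
  rcases lt_or_ge T L with h | h
  · exact bounds_of_lt h
  · exact Nat.decreasingInduction' (P := A.Bounds) (n := T + 1) (fun _ _ _ h => h.of_succ)
      (by omega) (bounds_of_lt (Nat.lt_succ_self T))

end AsyncRun

/-! ### The potential and the second moment of the accumulated errors -/

namespace AsyncRun
variable {n T q : ℕ} (A : AsyncRun n T q)

lemma eq_add_sum (π : Path n T) (H : Finset (Fin T) → ℝ) :
    H Finset.univ = H ∅ + ∑ u, (H (insert u (A.below π (A.S.commit π u))) -
      H (A.below π (A.S.commit π u))) := by
  rw [A.final_eq_add_sum π H (A.S.start π ⟨0, A.T_pos⟩), below_start_zero,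
    Finset.filter_true_of_mem fun u _ => A.start_zero_le π u]

lemma Om_insert (π : Path n T) (u : Fin T) :
    A.F A.x₀ + ∑ v ∈ insert u (A.below π (A.S.commit π u)), A.eps π v ^ 2 =
      A.Om π (A.S.commit π u) + A.eps π u ^ 2 := by
  rw [Finset.sum_insert (by simp [below]), Om]
  ring

lemma Ofin_sq_eq (π : Path n T) : A.Ofin π ^ 2 = A.F A.x₀ ^ 2 +
    ∑ s ∈ rng T, (2 * (A.Oc π s * A.ez π s ^ 2) + A.ez π s ^ 4) := by
  have h := A.eq_add_sum π fun s => (A.F A.x₀ + ∑ v ∈ s, A.eps π v ^ 2) ^ 2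
  simp only [Finset.sum_empty, add_zero] at h
  rw [Ofin, h, sum_rng]
  congr 1
  refine Finset.sum_congr rfl fun u _ => ?_
  rw [Om_insert]
  change _ - A.Om π (A.S.commit π u) ^ 2 = _
  simp only [Oc, ez, zx_coe]
  ring

/-- The product of the objective and the accumulated errors, along a path. -/
lemma potential_le (π : Path n T) : 0 ≤ A.F A.x₀ ^ 2 +
    ∑ s ∈ rng T, (-(4 / 5) * (A.Os π s * A.prog π s) + 7 * (A.Oc π s * A.ez π s ^ 2) +
      A.ez π s ^ 4) := by
  have h := A.eq_add_sum π fun s => (A.F A.x₀ + ∑ v ∈ s, A.eps π v ^ 2) * A.F (A.memOf π s)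
  simp only [Finset.sum_empty, add_zero, memOf_empty] at h
  have h0 : 0 ≤ (A.F A.x₀ + ∑ v, A.eps π v ^ 2) * A.F (A.memOf π Finset.univ) :=
    mul_nonneg (add_nonneg A.F_x₀_nonneg (Finset.sum_nonneg fun _ _ => sq_nonneg _))
      (A.nonneg _)
  rw [h] at h0
  refine h0.trans ?_
  rw [sq, sum_rng]
  refine add_le_add le_rfl (Finset.sum_le_sum fun u _ => ?_)
  rw [Om_insert]
  have e : A.F A.x₀ + ∑ v ∈ A.below π (A.S.commit π u), A.eps π v ^ 2 =
    A.Om π (A.S.commit π u) := rfl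
  rw [e, ← mem_eq_memOf]
  simp only [Oc, Os, ez, zx_coe]
  have h1 := A.inc_le π u
  have h2 := A.commit_step_le_eps_sq π u
  have h3 := A.F_mem_le_Om π (A.S.commit π u)
  have h4 := A.Om_nonneg π (A.S.start π u)
  have h5 := A.Om_mono (π := π) (A.start_le_commit π u)
  have h6 := sq_nonneg (A.eps π u)
  rw [inc] at h1
  set F' := A.F (A.memOf π (insert u (A.below π (A.S.commit π u))))
  set F := A.F (A.mem π (A.S.commit π u))
  set O := A.Om π (A.S.commit π u)
  set p := A.prog π (u : ℕ)
  have h7 : O * (F' - F) ≤ -(4 / 5) * (A.Om π (A.S.start π u) * p) + 6 * (O * A.eps π u ^ 2) := by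
    rcases le_total 0 p with hp | hp
    · have h8 := mul_le_mul_of_nonneg_left h1 (h4.trans h5)
      have h9 := mul_le_mul_of_nonneg_right h5 hp
      linarith
    · have h8 := mul_le_mul_of_nonneg_left (sub_le_iff_le_add'.2 h2) (h4.trans h5)
      have h9 := mul_nonneg h4 (neg_nonneg.2 hp)
      have h10 := mul_nonneg (h4.trans h5) h6
      linarith
  have h8 := mul_le_mul_of_nonneg_left (h2.trans (add_le_add h3 le_rfl)) h6
  linarith

/-- The second moment of the accumulated errors. -/
lemma Ex_Ofin_sq_le : Ex (fun π => A.Ofin π ^ 2) ≤ 4 * A.F A.x₀ ^ 2 := by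
  have := A.neZero
  have h0 := A.base₂_nonneg
  have hK := Kern.one (A := A)
  have hL : ∀ s : ℤ, 1 ≤ ((fun _ => []) s : List ℤ).length + 1 := fun s => le_rfl
  have hc := hK.sum_Oc_Rz_le Fam.one (A.bounds 1) hL
  have he := hK.sum_Oc_ez_sq_le (A.bounds 1) hL
  have he4 := hK.sum_ez_four_le (A.bounds 1) hL
  simp only [one_mul, sub_zero] at hc he he4
  have hV : ∑ s ∈ rng T, Ex (fun π => A.Os π s * A.Vz π s (A.pk π s)) = A.base₂ :=
    Finset.sum_congr rfl fun s hs => Ex_mul_Vz_pk hs (A.free_Os le_rfl)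
  have hp := sum_prog_ge (A := A) (X := fun s π => A.Os π s) (Y := fun s π => A.Oc π s)
    (fun s π => A.Os_nonneg π s) (fun s π => A.Oc_nonneg π s) (fun u i h => A.free_Os h)
    (fun π u v _ h => A.Os_le_Oc h) (b := A.base₂) le_rfl hc (by positivity)
  rw [hV] at hp
  -- Since 0.8·(1 - 0.09·4.6) exceeds 7·0.030625 + 0.12075, nonnegativity of the final potential
  -- bounds `base₂` by a multiple of F(x₀)². The growth of the squared error is a small multiple of
  -- `base₂` as well.
  have h1 := Ex_mono A.potential_le
  have h2 : Ex (fun π => A.Ofin π ^ 2) = A.F A.x₀ ^ 2 +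
      (2 * ∑ s ∈ rng T, Ex (fun π => A.Oc π s * A.ez π s ^ 2) +
        ∑ s ∈ rng T, Ex fun π => A.ez π s ^ 4) := by
    simp only [Ofin_sq_eq, Ex_add, Ex_sum, Ex_mul, Ex_const, Finset.sum_add_distrib,
      Finset.mul_sum]
  simp only [Ex_add, Ex_sum, Ex_mul, Ex_const, Finset.sum_add_distrib, ← Finset.mul_sum] at h1
  rw [h2]
  linarith

end AsyncRun

end SACD
end

/-! ### Assembly of the two rates -/

theorem theorem4 {n T q : ℕ} (hn : 0 < n) (hT : 1 ≤ T)
    (f : SACD.Pt n → ℝ) (Ψ : Fin n → ℝ → ℝ)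
    (hf : Differentiable ℝ f) (hfc : ConvexOn ℝ Set.univ f)
    (hΨ : ∀ k, ConvexOn ℝ Set.univ (Ψ k))
    (hmin : ∃ y, SACD.objective f Ψ y = 0) (hnonneg : ∀ y, 0 ≤ SACD.objective f Ψ y)
    (L : Fin n → Fin n → ℝ) (hL : SACD.CoordLipschitz f L)
    (Γ : ℝ) (hΓ : 0 < Γ) (hΓL : ∀ j, L j j ≤ Γ)
    (hq₁ : (q : ℝ) * (8 * Real.sqrt 10 * SACD.Lres L) ≤ Γ * Real.sqrt ((n : ℝ) - q))
    (hq₂ : (q : ℝ) ≤ 9 / 100 * n)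
    (S : SACD.Schedule n T) (hS : S.Valid) (hSq : S.BoundedInterference q)
    (x₀ : SACD.Pt n) (Δ : SACD.Path n T → Fin T → ℝ)
    (hΔ : ∀ π, S.IsRun f Ψ Γ x₀ π (Δ π)) :
    (∀ μF μf : ℝ, 0 < μF → 0 ≤ μf →
      StrongConvexOn Set.univ μF (SACD.objective f Ψ) → StrongConvexOn Set.univ μf f →
      (𝔼 π : SACD.Path n T, SACD.objective f Ψ (SACD.finalPoint x₀ π (Δ π))) ≤
        (1 - min ((1 / 2) / (2 * (n : ℝ)) * (μF / (μF + Γ - μf))) ((1 / 2) / (2 * (n : ℝ))))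
            ^ (T - 1) * SACD.objective f Ψ x₀) ∧
    (𝔼 π : SACD.Path n T, SACD.objective f Ψ (SACD.finalPoint x₀ π (Δ π))) ≤
      SACD.objective f Ψ x₀ /
        (1 + min (min ((1 / 2) / (4 * (n : ℝ))) ((1 / 2) / (8 * (n : ℝ))))
              ((1 / 2) * SACD.objective f Ψ x₀ / (16 * (n : ℝ) * Γ) *
                ((SACD.levelRadius (SACD.objective f Ψ) x₀ ^ 2)⁻¹).toReal)
            * ((T : ℝ) - 1)) := by
  let A : SACD.AsyncRun n T q :=
    { f := f, Ψ := Ψ, L := L, Γ := Γ, n_pos := hn, diff := hf, convex := hfc, convexΨ := hΨ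
      exists_zero := hmin, nonneg := hnonneg, lip := hL, Γ_pos := hΓ, L_le := hΓL, T_pos := hT
      q_lip := hq₁, q_le := hq₂, S := S, valid := hS, bounded := hSq, x₀ := x₀, Δ := Δ, run := hΔ }
  have hn' : (0 : ℝ) < n := by exact_mod_cast hn
  have hF0 : 0 ≤ SACD.objective f Ψ x₀ := hnonneg x₀
  -- The linear rate with constant 0: the mean of the objective never ends above its initial value.
  have hdecr : SACD.Ex A.Ffin ≤ SACD.objective f Ψ x₀ := by
    have h := A.linear_rate le_rfl zero_le_one fun z => by
      rw [zero_mul]; exact Finset.sum_nonneg fun k _ => A.V_nonneg z k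
    simpa using h
  constructor
  · intro μF μf hμF _ hF hf'
    have hμ := A.strong_param_le hf'
    have hden : 0 < μF + Γ - μf := by
      have : μf ≤ Γ := hμ
      linarith
    have hle : μF / (μF + Γ - μf) ≤ 1 := by
      rw [div_le_one hden]
      have : μf ≤ Γ := hμ
      linarith
    have h := A.linear_rate (c := μF / (μF + Γ - μf)) (by positivity) hle
      (A.sum_V_ge_strong hμF hF hf')
    have e : min ((1 / 2) / (2 * (n : ℝ)) * (μF / (μF + Γ - μf))) ((1 / 2) / (2 * (n : ℝ))) =
        μF / (μF + Γ - μf) / (4 * n) := by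
      rw [min_eq_left (mul_le_of_le_one_right (by positivity) hle)]
      field_simp
      norm_num
    rw [e]
    exact h
  · set F0 := SACD.objective f Ψ x₀ with hF0'
    set R := SACD.levelRadius (SACD.objective f Ψ) x₀ with hR
    -- For F(x₀) = 0, R = 0 or R = ∞ the last term of the minimum is 0 and `hdecr` suffices. For R =
    -- 0 this is because `toReal` sends (0²)⁻¹ = ⊤ to 0.
    have hzero : F0 / (16 * n * Γ) * ((R ^ 2)⁻¹).toReal = 0 → (𝔼 π : SACD.Path n T,
        SACD.objective f Ψ (SACD.finalPoint x₀ π (Δ π))) ≤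
        F0 / (1 + min (min ((1 / 2) / (4 * (n : ℝ))) ((1 / 2) / (8 * (n : ℝ))))
              ((1 / 2) * F0 / (16 * (n : ℝ) * Γ) * ((R ^ 2)⁻¹).toReal) * ((T : ℝ) - 1)) := by
      intro h0
      have e : (1 / 2) * F0 / (16 * (n : ℝ) * Γ) * ((R ^ 2)⁻¹).toReal = 0 := by
        rw [mul_div_assoc, mul_assoc, h0, mul_zero]
      rw [e, min_eq_right (by positivity), zero_mul, add_zero, div_one]
      exact hdecr
    rcases eq_or_ne F0 0 with h0 | h0
    · exact hzero (by rw [h0]; simp)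
    rcases eq_or_ne R 0 with hR0 | hR0
    · exact hzero (by rw [hR0]; simp)
    rcases eq_or_ne R ⊤ with hRt | hRt
    · exact hzero (by rw [hRt]; simp)
    have hRp : 0 < R.toReal := ENNReal.toReal_pos hR0 hRt
    have hF0p : 0 < F0 := lt_of_le_of_ne hF0 h0.symm
    rw [ENNReal.toReal_inv, ENNReal.toReal_pow]
    refine A.sublinear_rate A.Ex_Ofin_sq_le hF0p (R := R.toReal)
      (by rw [ENNReal.ofReal_toReal hRt]) hRp (by positivity) ?_ ?_
    · refine (min_le_left _ _).trans ((min_le_right _ _).trans (le_of_eq ?_))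
      field_simp
      norm_num
    · refine (mul_le_mul_of_nonneg_right (min_le_right _ _) (by positivity)).trans (le_of_eq ?_)
      change (1 / 2) * F0 / (16 * (n : ℝ) * Γ) * (R.toReal ^ 2)⁻¹ *
        (32 * n * Γ * R.toReal ^ 2) = F0
      field_simp
      norm_num
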